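/- Let $\mathbb{T}=[-\pi,\pi)\cong\mathbb{R}/2\pi\mathbb{Z}$ with Lebesgue measure, $\widehat f(k)=\int_{\mathbb{T}}f(x)e^{-ikx}\,dx$ and $\|f\|_{H^s(\mathbb{T})}^2=\frac1{2\pi}\sum_{k\in\mathbb{Z}}(1+k^2)^{s}|\widehat f(k)|^2$. For an integer $M\ge 1$ put $h=\pi/M$ and $\mathbb{T}_h=\{hj: j=-M,\dots,M-1\}\cong\mathbb{Z}/2M\mathbb{Z}$. For $f:\mathbb{T}\to\mathbb{C}$ and $g:\mathbb{T}_h\to\mathbb{C}$ let $$d_hf(x)=\frac1h\int_x^{x+h}f(x')\,dx'\quad(x\in\mathbb{T}_h),\qquad p_hg(x)=g(x_0)+\frac{g(x_0+h)-g(x_0)}{h}(x-x_0)\quad(x_0\in\mathbb{T}_h,\ x\in[x_0,x_0+h)).$$ Let $U(t)=e^{-it(-\Delta)^{\alpha/2}}$ be the Fourier multiplier on $\mathbb{T}$ with symbol $e^{-it|k|^\alpha}$, and let $U_h(t)=e^{-it(-\Delta_h)^{\alpha/2}}$ be the multiplier on $\mathbb{T}_h$, for the discrete Fourier transform $\mathcal{F}_h[g](k)=h\sum_{x\in\mathbb{T}_h}g(x)e^{-ikx}$,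 with symbol $e^{-it\sigma_h(k)}$, where $\sigma_h(k)=\left|\frac2h\sin\frac{hk}2\right|^\alpha$. **Proposition.** Let $\alpha\in(1,2]$. There are functions $C_1,C_2:\mathbb{R}\to(0,\infty)$, depending only on $\alpha$, such that the following holds for $\mu\in\{1,-1\}$ and every $u_0\in H^{\alpha/2}(\mathbb{T})$. 1. There is a unique $u\in C(\mathbb{R};H^{\alpha/2}(\mathbb{T}))$, denoted $S(t)u_0=u(t)$, with $$u(t)=U(t)u_0-i\mu\int_0^tU(t-\tau)\big(|u(\tau)|^2u(\tau)\big)\,d\tau\qquad\text{for all }t\in\mathbb{R},$$ the global solution of $i\partial_tu=(-\Delta)^{\alpha/2}u+\mu|u|^2u$ on $\mathbb{T}$ with $u(0)=u_0$. 2. For every integer $M\ge1$, with $h=\pi/M$, there is a unique continuous $u_h:\mathbb{R}\to\mathbb{C}^{\mathbb{T}_h}$, denoted $S_h(t)d_hu_0=u_h(t)$, with $$u_h(t)=U_h(t)d_hu_0-i\mu\int_0^tU_h(t-\tau)\big(|u_h(\tau)|^2u_h(\tau)\big)\,d\tau\qquad\text{for all }t\in\mathbb{R},$$ the global solution of $i\dot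 u_h=(-\Delta_h)^{\alpha/2}u_h+\mu|u_h|^2u_h$ on $\mathbb{T}_h$ with $u_h(0)=d_hu_0$; and, for all $t\in\mathbb{R}$, $$\|p_hS_h(t)d_hu_0-S(t)u_0\|_{L^2(\mathbb{T})}\le C_1\,h^{\frac{\alpha}{2+\alpha}}\,e^{C_2|t|}\,\big(1+\|u_0\|_{H^{\alpha/2}}\big)^3,$$ where $C_i=C_i(\|u_0\|_{H^{\alpha/2}})$. In particular the constants depend only on $\|u_0\|_{H^{\alpha/2}}$ and $\alpha$, and not on $h$, $t$, $\mu$ or otherwise on $u_0$. -/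

import Mathlib

open scoped Real ENNReal

noncomputable section

namespace FDNLS

instance factTwoPiPos : Fact (0 < 2 * π) := ⟨Real.two_pi_pos⟩

/-- The torus `𝕋 = ℝ / 2πℤ`, with its measure `volume` of total mass `2π` (Lebesgue measure on
`[-π, π)`). -/
abbrev Torus : Type := AddCircle (2 * π)

/-- The space `L²(𝕋)` of square-integrable functions, for Lebesgue measure on `[-π, π)`. -/
abbrev L2T : Type := MeasureTheory.Lp ℂ 2 (MeasureTheory.volume : MeasureTheory.Measure Torus)

/-! ### The continuum equation -/

/-- The Fourier transform `f̂(k) = ∫_{-π}^{π} f(x) e^{-ikx} dx`. (Mathlib's `fourierCoeff` is the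
average over the period, whence the factor `2π`.) -/
def fourierT (f : Torus → ℂ) (k : ℤ) : ℂ := (2 * π : ℂ) * fourierCoeff f k

/-- The character `x ↦ e^{ikx}`, as an element of `L²(𝕋)`. -/
def mode (k : ℤ) : L2T :=
  ContinuousMap.toLp (E := ℂ) 2 (MeasureTheory.volume : MeasureTheory.Measure Torus) ℂ (fourier k)

/-- `f ∈ H^s(𝕋)`, for `s ≥ 0`: `∑ₖ ⟨k⟩^{2s} |f̂(k)|² < ∞`. -/
def MemSobolev (s : ℝ) (f : L2T) : Prop :=
  Summable fun k : ℤ => (1 + (k : ℝ) ^ 2) ^ s * ‖fourierT f k‖ ^ 2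

/-- The norm `‖f‖_{H^s} = ((2π)⁻¹ ∑ₖ ⟨k⟩^{2s} |f̂(k)|²)^{1/2}`, for `f ∈ H^s(𝕋)`. -/
def sobolevNorm (s : ℝ) (f : L2T) : ℝ :=
  Real.sqrt ((2 * π)⁻¹ * ∑' k : ℤ, (1 + (k : ℝ) ^ 2) ^ s * ‖fourierT f k‖ ^ 2)

/-- The unitary group `U(t) = e^{-it(-Δ)^{α/2}}` on `L²(𝕋)`: the Fourier multiplier with symbol
`e^{-it|k|^α}`, i.e. `U(t)f = (2π)⁻¹ ∑ₖ e^{-it|k|^α} f̂(k) e^{ikx}` (convergent in `L²`). -/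
def propagator (α t : ℝ) (f : L2T) : L2T :=
  ∑' k : ℤ, (((2 * π : ℂ)⁻¹ * Complex.exp (-Complex.I * ((t * |(k : ℝ)| ^ α : ℝ) : ℂ)) *
    fourierT f k) • mode k)

open Classical in
/-- The nonlinearity `|f|² f`, as an element of `L²(𝕋)`; the value `0` is only a convention for
those `f ∈ L²` for which `|f|² f` is not square-integrable (for `s > 1/2` no `f ∈ H^s` is such). -/
def cubic (f : L2T) : L2T :=
  if hf : MeasureTheory.MemLp (fun x : Torus => ((‖f x‖ ^ 2 : ℝ) : ℂ) * f x) 2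
      MeasureTheory.volume
  then hf.toLp _ else 0

/-- `u ∈ C(ℝ; H^s(𝕋))`. -/
def ContinuousInSobolev (s : ℝ) (u : ℝ → L2T) : Prop :=
  (∀ t, MemSobolev s (u t)) ∧
    ∀ t₀, Filter.Tendsto (fun t => sobolevNorm s (u t - u t₀)) (nhds t₀) (nhds 0)

/-- `u` is a global solution of the fractional nonlinear Schrödinger equation
`i ∂ₜu = (-Δ)^{α/2} u + μ |u|² u` on `𝕋 × ℝ` with `u(0) = u₀`, in the energy space: it belongs to
`C(ℝ; H^{α/2}(𝕋))` and
`u(t) = U(t) u₀ - iμ ∫₀ᵗ U(t - τ) (|u(τ)|² u(τ)) dτ` for all `t`. -/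
def IsSolution (α μ : ℝ) (u₀ : L2T) (u : ℝ → L2T) : Prop :=
  ContinuousInSobolev (α / 2) u ∧
    ∀ t : ℝ, u t = propagator α t u₀ -
      (Complex.I * (μ : ℂ)) • ∫ τ in (0 : ℝ)..t, propagator α (t - τ) (cubic (u τ))

/-! ### The lattice equation

For `M ≥ 1` and `h = π / M`, a function on the lattice `𝕋_h = {hj : -M ≤ j < M}` is regarded as a
function of `j ∈ ℤ/2Mℤ`. -/

/-- The mesh size `h = π / M`. -/
def mesh (M : ℕ) : ℝ := π / M

section Lattice

variable (M : ℕ) [NeZero M]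

/-- The discrete Fourier transform `F_h[g](k) = h ∑_{x ∈ 𝕋_h} g(x) e^{-ikx}`, `k ∈ ℤ/2Mℤ`. (For
`x = hj` one has `e^{ikx} = e^{2πi jk/(2M)} = ZMod.stdAddChar (j * k)`.) -/
def latticeFourier (g : ZMod (2 * M) → ℂ) (k : ZMod (2 * M)) : ℂ :=
  (mesh M : ℂ) * ∑ j : ZMod (2 * M), g j * ZMod.stdAddChar (-(j * k))

/-- The inverse transform `F_h⁻¹[G](x) = (2π)⁻¹ ∑ₖ G(k) e^{ikx}`, `x = hj`. -/
def latticeFourierInv (G : ZMod (2 * M) → ℂ) (j : ZMod (2 * M)) : ℂ :=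
  (2 * π : ℂ)⁻¹ * ∑ k : ZMod (2 * M), G k * ZMod.stdAddChar (j * k)

/-- The symbol `σ_h(k) = |(2/h) sin(hk/2)|^α` of `(-Δ_h)^{α/2}` (which is `2M`-periodic in `k`). -/
def latticeSymbol (α : ℝ) (k : ZMod (2 * M)) : ℝ :=
  |2 / mesh M * Real.sin (mesh M * (k.valMinAbs : ℝ) / 2)| ^ α

/-- The unitary group `U_h(t) = e^{-it(-Δ_h)^{α/2}} = F_h⁻¹ e^{-itσ_h(k)} F_h`. -/
def latticePropagator (α t : ℝ) (g : ZMod (2 * M) → ℂ) : ZMod (2 * M) → ℂ :=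
  latticeFourierInv M fun k =>
    Complex.exp (-Complex.I * ((t * latticeSymbol M α k : ℝ) : ℂ)) * latticeFourier M g k

/-- `v` is a global solution of the fractional discrete nonlinear Schrödinger equation
`i v' = (-Δ_h)^{α/2} v + μ |v|² v` on `𝕋_h × ℝ` with `v(0) = v₀`: it is continuous in time and
`v(t) = U_h(t) v₀ - iμ ∫₀ᵗ U_h(t - τ) (|v(τ)|² v(τ)) dτ` for all `t`. -/
def IsLatticeSolution (α μ : ℝ) (v₀ : ZMod (2 * M) → ℂ) (v : ℝ → ZMod (2 * M) → ℂ) : Prop :=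
  Continuous v ∧
    ∀ t : ℝ, v t = latticePropagator M α t v₀ -
      (Complex.I * (μ : ℂ)) • ∫ τ in (0 : ℝ)..t,
        latticePropagator M α (t - τ) (fun j => ((‖v τ j‖ ^ 2 : ℝ) : ℂ) * v τ j)

/-- The discretization `d_h f(x) = h⁻¹ ∫_x^{x+h} f`, `x = hj ∈ 𝕋_h`. -/
def discretize (f : Torus → ℂ) (j : ZMod (2 * M)) : ℂ :=
  (mesh M : ℂ)⁻¹ * ∫ y in (mesh M * (j.val : ℝ))..(mesh M * ((j.val : ℝ) + 1)), f (y : Torus)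

/-- The linear interpolation `p_h g(x) = g(x₀) + (g(x₀ + h) - g(x₀)) / h * (x - x₀)` for
`x₀ ∈ 𝕋_h` and `x ∈ [x₀, x₀ + h)`: with `y ∈ [-π, π)` the representative of the point `x`, one has
`x₀ = hj` for `j = ⌊y / h⌋`. -/
def interpolate (g : ZMod (2 * M) → ℂ) (x : Torus) : ℂ :=
  let y : ℝ := (AddCircle.equivIco (2 * π) (-π) x : ℝ)
  let j : ℤ := ⌊y / mesh M⌋
  g (j : ZMod (2 * M)) +
    (g ((j : ZMod (2 * M)) + 1) - g (j : ZMod (2 * M))) / (mesh M : ℂ) *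
      ((y - mesh M * (j : ℝ) : ℝ) : ℂ)

end Lattice

end FDNLS

end

noncomputable section
namespace FDNLS

open MeasureTheory Filter Topology

/-! ### Fourier series in `L²(𝕋)` -/

/-! Both flows are compared inside `L2T`, through the isometric embedding `stepL` of lattice
functions as step functions. Its adjoint is `discretize`, so `stepL ∘ discretize` is the orthogonal
projection onto step functions; and the cubic nonlinearity, acting pointwise, commutes with `stepL`
exactly. Three errors remain: projecting the datum, comparing the two unitary groups, and passing
from step functions to linear interpolation. Under an energy bound the first and the third are
`O(√h)`. The second rests on `abs_symbol_sub_le`, a symbol error `O(h²|k|^(α+2))`; interpolating it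
with the trivial bound 2 on a difference of phases, so that exactly the weight `|k|^(α/2)` is spent,
gives the rate `h^(α/(2+α))` (`norm_phase_sub_le`), which dominates `√h` because `α ≤ 2`.

This requires bounds on lattice solutions that are uniform in `h` and `t`. They follow from
conservation of mass and energy (`exists_uniform_bound`): Cauchy–Schwarz with the weight `l +
|k|^α`, whose inverse is summable for `α > 1`, bounds the Wiener norm, hence the quartic energy,
with a coefficient tending to zero as `l → ∞`, so the kinetic energy absorbs it even for the
focusing sign. A fractional Leibniz rule (`gradSq_mul_le`) carries the bound over to the
nonlinearity, as the Duhamel term demands.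

The continuum solution is obtained from the lattice, without any continuum conservation law.
Truncated at height `R`, the nonlinearity is globally Lipschitz on `L2T`, so a global mild solution
`u` exists by contraction. Lattice solutions stay below `R`, and Gronwall's inequality shows that
they converge to `u` at the stated rate. The energy bounds pass to the limit by lower
semicontinuity, the Sobolev embedding then puts `u` below `R`, and the truncation is inactive: `u`
solves the original equation. Uniqueness is Gronwall's inequality in `L²` with locally uniform `L^∞`
bounds. -/

theorem coeFn_mode (k : ℤ) : (mode k : Torus → ℂ) =ᵐ[volume] fourier k :=
  ContinuousMap.coeFn_toLp volume (fourier k)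

theorem fourierT_eq_integral (f : Torus → ℂ) (k : ℤ) :
    fourierT f k = ∫ x, fourier (-k) x * f x := by
  unfold fourierT fourierCoeff
  rw [AddCircle.integral_haarAddCircle, ← Complex.coe_smul, smul_eq_mul]
  push_cast
  rw [mul_inv_cancel_left₀ (by exact_mod_cast Real.two_pi_pos.ne')]
  rfl

theorem fourierT_congr {f g : Torus → ℂ} (h : f =ᵐ[volume] g) (k : ℤ) :
    fourierT f k = fourierT g k := by
  rw [fourierT_eq_integral, fourierT_eq_integral]
  refine integral_congr_ae ?_
  filter_upwards [h] with x hx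
  rw [hx]

theorem fourierT_eq_inner (f : L2T) (k : ℤ) : fourierT f k = inner ℂ (mode k) f := by
  rw [fourierT_eq_integral, L2.inner_def]
  refine integral_congr_ae ?_
  filter_upwards [coeFn_mode k] with x hx
  rw [hx, RCLike.inner_apply', fourier_neg]

theorem inner_mode_mode (j k : ℤ) :
    inner ℂ (mode j) (mode k) = if j = k then (2 * π : ℂ) else 0 := by
  have h := orthonormal_iff_ite.1 (orthonormal_fourier (T := 2 * π)) j k
  rw [ContinuousMap.inner_toLp, AddCircle.integral_haarAddCircle] at h
  unfold mode
  rw [ContinuousMap.inner_toLp]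
  have h2 : (2 * π : ℝ) ≠ 0 := Real.two_pi_pos.ne'
  rw [inv_smul_eq_iff₀ h2] at h
  rw [h]
  split_ifs <;> simp

/-- The `L²`-normalised character `(2π)^{-1/2} e^{ikx}`. -/
def unitMode (k : ℤ) : L2T := (((√(2 * π))⁻¹ : ℝ) : ℂ) • mode k

theorem sqrt_two_pi_mul_self : ((√(2 * π) : ℝ) : ℂ) * (√(2 * π) : ℝ) = 2 * π := by
  rw [← Complex.ofReal_mul, Real.mul_self_sqrt Real.two_pi_pos.le]
  push_cast
  rfl

theorem sqrt_two_pi_ne_zero : ((√(2 * π) : ℝ) : ℂ) ≠ 0 := by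
  exact_mod_cast (Real.sqrt_pos.2 Real.two_pi_pos).ne'

theorem orthonormal_unitMode : Orthonormal ℂ unitMode := by
  rw [orthonormal_iff_ite]
  intro j k
  rw [unitMode, unitMode, inner_smul_left, inner_smul_right, inner_mode_mode, Complex.conj_ofReal]
  split_ifs
  · rw [← sqrt_two_pi_mul_self]
    have := sqrt_two_pi_ne_zero
    push_cast
    field_simp
  · simp

/-- Trigonometric polynomials are uniformly dense in the continuous functions, which are dense in
`L²`. -/
theorem span_unitMode_closure_eq_top :
    (Submodule.span ℂ (Set.range unitMode)).topologicalClosure = ⊤ := by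
  have h : (Submodule.span ℂ (Set.range mode)).topologicalClosure = ⊤ := by
    convert!
      (ContinuousMap.toLp_denseRange (p := 2) ℂ (volume : Measure Torus) ℂ
        (by simp)).topologicalClosure_map_submodule
        (span_fourier_closure_eq_top (T := 2 * π))
    rw [Submodule.map_span]
    rw [← Set.range_comp]
    rfl
  rw [eq_top_iff, ← h]
  refine Submodule.topologicalClosure_mono (Submodule.span_le.2 ?_)
  rintro _ ⟨k, rfl⟩
  have : mode k = ((√(2 * π) : ℝ) : ℂ) • unitMode k := by
    rw [unitMode, smul_smul, ← Complex.ofReal_mul,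
      mul_inv_cancel₀ (Real.sqrt_pos.2 Real.two_pi_pos).ne', Complex.ofReal_one, one_smul]
  rw [this]
  exact Submodule.smul_mem _ _ (Submodule.subset_span ⟨k, rfl⟩)

/-- The Hilbert basis of normalised characters of `L²(𝕋)`. -/
def modeBasis : HilbertBasis ℤ ℂ L2T :=
  HilbertBasis.mk orthonormal_unitMode span_unitMode_closure_eq_top.ge

theorem coe_modeBasis : ⇑modeBasis = unitMode := HilbertBasis.coe_mk _ _

theorem modeBasis_repr (f : L2T) (k : ℤ) :
    modeBasis.repr f k = (((√(2 * π))⁻¹ : ℝ) : ℂ) * fourierT f k := by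
  rw [HilbertBasis.repr_apply_apply, coe_modeBasis, unitMode, inner_smul_left,
    Complex.conj_ofReal, fourierT_eq_inner]

theorem hasSum_norm_fourierT_sq (f : L2T) :
    HasSum (fun k : ℤ => ‖fourierT f k‖ ^ 2) (2 * π * ‖f‖ ^ 2) := by
  have h : HasSum (fun k => ‖modeBasis.repr f k‖ ^ 2) (‖modeBasis.repr f‖ ^ 2) := by
    exact_mod_cast lp.hasSum_norm (by simp) (modeBasis.repr f)
  rw [LinearIsometryEquiv.norm_map] at h
  have e : (fun k : ℤ => ‖fourierT f k‖ ^ 2) = fun k => 2 * π * ‖modeBasis.repr f k‖ ^ 2 := by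
    ext k
    rw [modeBasis_repr, norm_mul, mul_pow, Complex.norm_real, Real.norm_of_nonneg (by positivity),
      inv_pow, Real.sq_sqrt Real.two_pi_pos.le, mul_inv_cancel_left₀ Real.two_pi_pos.ne']
  rw [e]
  exact h.mul_left (2 * π)

theorem norm_sq_eq_tsum (f : L2T) : ‖f‖ ^ 2 = (2 * π)⁻¹ * ∑' k : ℤ, ‖fourierT f k‖ ^ 2 := by
  rw [(hasSum_norm_fourierT_sq f).tsum_eq, inv_mul_cancel_left₀ Real.two_pi_pos.ne']

theorem fourierT_add (f g : L2T) (k : ℤ) :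
    fourierT (f + g : L2T) k = fourierT f k + fourierT g k := by
  simp only [fourierT_eq_inner, inner_add_right]

theorem fourierT_sub (f g : L2T) (k : ℤ) :
    fourierT (f - g : L2T) k = fourierT f k - fourierT g k := by
  simp only [fourierT_eq_inner, inner_sub_right]

theorem fourierT_smul (c : ℂ) (f : L2T) (k : ℤ) :
    fourierT (c • f : L2T) k = c * fourierT f k := by
  simp only [fourierT_eq_inner, inner_smul_right]

theorem ext_fourierT {f g : L2T} (h : ∀ k, fourierT f k = fourierT g k) : f = g := by
  rw [← sub_eq_zero, ← norm_eq_zero, ← sq_eq_zero_iff, norm_sq_eq_tsum]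
  simp only [fourierT_sub, h, sub_self, norm_zero]
  simp

theorem continuous_fourierT (k : ℤ) : Continuous fun f : L2T => fourierT f k := by
  simp only [fourierT_eq_inner]
  fun_prop

/-- Riesz–Fischer. The convergence statement ensures that the sum in `propagator` is a genuine limit
rather than the default value `0`. -/
theorem hasSum_fourier_synthesis {c : ℤ → ℂ} (hc : Summable fun k => ‖c k‖ ^ 2) :
    ∃ f : L2T, HasSum (fun k => ((2 * π : ℂ)⁻¹ * c k) • mode k) f ∧ ∀ k, fourierT f k = c k := by
  set a : ℤ → ℂ := fun k => (((√(2 * π))⁻¹ : ℝ) : ℂ) * c k with ha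
  have hmem : Memℓp a 2 := by
    refine memℓp_gen ?_
    have e : (fun k => ‖a k‖ ^ (2 : ℝ≥0∞).toReal) = fun k => (√(2 * π))⁻¹ ^ 2 * ‖c k‖ ^ 2 := by
      ext k
      simp [ha, mul_pow, abs_of_nonneg (Real.sqrt_nonneg _)]
    rw [e]
    exact hc.mul_left _
  have h := modeBasis.hasSum_repr_symm ⟨a, hmem⟩
  refine ⟨modeBasis.repr.symm ⟨a, hmem⟩, ?_, fun k => ?_⟩
  rotate_left
  · have h1 := modeBasis_repr (modeBasis.repr.symm ⟨a, hmem⟩) k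
    rw [LinearIsometryEquiv.apply_symm_apply] at h1
    have h2 : (((√(2 * π))⁻¹ : ℝ) : ℂ) ≠ 0 := by
      exact_mod_cast inv_ne_zero (Real.sqrt_pos.2 Real.two_pi_pos).ne'
    exact (mul_left_cancel₀ h2 h1).symm
  · have e : (fun k => ((2 * π : ℂ)⁻¹ * c k) • mode k) = fun k => a k • modeBasis k := by
      ext1 k
      rw [coe_modeBasis, unitMode, smul_smul]
      congr 1
      simp only [ha]
      rw [← sqrt_two_pi_mul_self]
      push_cast
      rw [mul_inv]
      ring
    rw [e]
    exact h

theorem hasSum_fourier_series (f : L2T) :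
    HasSum (fun k : ℤ => ((2 * π : ℂ)⁻¹ * fourierT f k) • mode k) f := by
  obtain ⟨g, hg, hk⟩ := hasSum_fourier_synthesis (hasSum_norm_fourierT_sq f).summable
  rwa [ext_fourierT hk] at hg

/-! ### The unitary group -/

/-- The symbol `e^{-it|k|^α}` of the unitary group. -/
def phase (α t : ℝ) (k : ℤ) : ℂ := Complex.exp (-Complex.I * ((t * |(k : ℝ)| ^ α : ℝ) : ℂ))

theorem norm_exp_neg_I_mul (x : ℝ) : ‖Complex.exp (-Complex.I * (x : ℂ))‖ = 1 := by
  rw [Complex.norm_exp]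
  simp

theorem norm_phase (α t : ℝ) (k : ℤ) : ‖phase α t k‖ = 1 := norm_exp_neg_I_mul _

theorem phase_add (α t t' : ℝ) (k : ℤ) : phase α (t + t') k = phase α t k * phase α t' k := by
  rw [phase, phase, phase, ← Complex.exp_add]
  push_cast
  ring_nf

theorem continuous_phase (α : ℝ) (k : ℤ) : Continuous fun t => phase α t k := by
  unfold phase
  fun_prop

theorem fourierT_propagator (α t : ℝ) (f : L2T) (k : ℤ) :
    fourierT (propagator α t f) k = phase α t k * fourierT f k := by
  have hc : Summable fun k : ℤ => ‖phase α t k * fourierT f k‖ ^ 2 := by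
    simpa only [norm_mul, norm_phase, one_mul] using (hasSum_norm_fourierT_sq f).summable
  obtain ⟨g, hg, hk⟩ := hasSum_fourier_synthesis hc
  have : propagator α t f = g := by
    rw [propagator, ← hg.tsum_eq]
    refine tsum_congr fun k => ?_
    rw [mul_assoc]
    rfl
  rw [this, hk]

theorem norm_propagator (α t : ℝ) (f : L2T) : ‖propagator α t f‖ = ‖f‖ := by
  rw [← sq_eq_sq₀ (norm_nonneg _) (norm_nonneg _), norm_sq_eq_tsum, norm_sq_eq_tsum]
  simp only [fourierT_propagator, norm_mul, norm_phase, one_mul]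

/-- The unitary group as a continuous linear map on `L²(𝕋)`. -/
def propagatorL (α t : ℝ) : L2T →L[ℂ] L2T :=
  LinearMap.mkContinuous
    { toFun := propagator α t
      map_add' := fun f g => ext_fourierT fun k => by
        simp only [fourierT_propagator, fourierT_add]; ring
      map_smul' := fun c f => ext_fourierT fun k => by
        simp only [fourierT_propagator, fourierT_smul, RingHom.id_apply]; ring }
    1 fun f => by
      rw [one_mul]
      exact (norm_propagator α t f).le

theorem propagatorL_apply (α t : ℝ) (f : L2T) : propagatorL α t f = propagator α t f := rfl

theorem propagatorL_add (α t t' : ℝ) (f : L2T) :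
    propagatorL α (t + t') f = propagatorL α t (propagatorL α t' f) :=
  ext_fourierT fun k => by
    simp only [propagatorL_apply, fourierT_propagator, phase_add, mul_assoc]

/-- Dominated convergence, two phases differing by at most 2. The weight `|f̂|²` gives strong
continuity in `L²`, the weight `|k|^α |f̂|²` continuity in the Sobolev space. -/
theorem tendsto_tsum_multiplier {w : ℤ → ℝ} (hw : Summable w) (hw0 : ∀ k, 0 ≤ w k) {α t₀ : ℝ} :
    Tendsto (fun t => ∑' k : ℤ, ‖phase α t k - phase α t₀ k‖ ^ 2 * w k) (𝓝 t₀) (𝓝 0) := by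
  have h := tendsto_tsum_of_dominated_convergence (𝓕 := 𝓝 t₀) (bound := fun k => 4 * w k)
    (f := fun t k => ‖phase α t k - phase α t₀ k‖ ^ 2 * w k) (g := fun _ => 0) (hw.mul_left 4)
    (fun k => by
      have : Continuous fun t => ‖phase α t k - phase α t₀ k‖ ^ 2 * w k := by
        have := continuous_phase α k
        fun_prop
      simpa using this.tendsto t₀)
    (Eventually.of_forall fun t k => by
      rw [Real.norm_of_nonneg (mul_nonneg (by positivity) (hw0 k))]
      refine mul_le_mul_of_nonneg_right ?_ (hw0 k)
      have : ‖phase α t k - phase α t₀ k‖ ≤ 2 := by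
        refine (norm_sub_le _ _).trans ?_
        rw [norm_phase, norm_phase]
        norm_num
      nlinarith [norm_nonneg (phase α t k - phase α t₀ k)])
  simpa using h

theorem continuous_propagatorL (α : ℝ) (f : L2T) : Continuous fun t => propagatorL α t f := by
  rw [continuous_iff_continuousAt]
  intro t₀
  rw [ContinuousAt, tendsto_iff_norm_sub_tendsto_zero]
  have h := (tendsto_tsum_multiplier (α := α) (t₀ := t₀) (hasSum_norm_fourierT_sq f).summable
    fun _ => by positivity).const_mul ((2 * π)⁻¹)
  rw [mul_zero] at h
  have h2 := h.sqrt
  rw [Real.sqrt_zero] at h2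
  refine h2.congr fun t => ?_
  rw [← Real.sqrt_sq (norm_nonneg (propagatorL α t f - propagatorL α t₀ f)), norm_sq_eq_tsum]
  congr 3
  ext k
  rw [fourierT_sub, propagatorL_apply, propagatorL_apply, fourierT_propagator,
    fourierT_propagator, ← sub_mul, norm_mul, mul_pow]

/-! ### Integral inequalities -/

theorem abs_integral_comp_abs {f : ℝ → ℝ} (hf : ∀ x, 0 ≤ x → 0 ≤ f x) (t : ℝ) :
    |∫ τ in (0 : ℝ)..t, f (abs τ)| = ∫ τ in (0 : ℝ)..|t|, f τ := by
  have key : ∀ s : ℝ, 0 ≤ s → ∫ τ in (0 : ℝ)..s, f |τ| = ∫ τ in (0 : ℝ)..s, f τ := fun s hs =>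
    intervalIntegral.integral_congr fun τ hτ => by
      rw [Set.uIcc_of_le hs] at hτ
      simp only [abs_of_nonneg hτ.1]
  have pos : ∀ s : ℝ, 0 ≤ s → 0 ≤ ∫ τ in (0 : ℝ)..s, f τ := fun s hs =>
    intervalIntegral.integral_nonneg hs fun x hx => hf x hx.1
  rcases le_total 0 t with h | h
  · rw [key t h, abs_of_nonneg h, abs_of_nonneg (pos t h)]
  · have h1 : ∫ τ in (0 : ℝ)..t, f |τ| = -∫ τ in (0 : ℝ)..(-t), f |τ| := by
      have := intervalIntegral.integral_comp_neg (a := 0) (b := t) (fun τ => f |τ|)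
      simp only [abs_neg] at this
      rw [this, neg_zero, intervalIntegral.integral_symm]
    rw [h1, abs_neg, key _ (neg_nonneg.2 h), abs_of_nonpos h,
      abs_of_nonneg (pos _ (neg_nonneg.2 h))]

theorem abs_integral_exp_le {l : ℝ} (hl : 0 < l) (t : ℝ) :
    |∫ τ in (0 : ℝ)..t, Real.exp (l * |τ|)| ≤ Real.exp (l * |t|) / l := by
  rw [abs_integral_comp_abs (f := fun x => Real.exp (l * x)) fun x _ => (Real.exp_pos _).le]
  rw [intervalIntegral.integral_comp_mul_left (fun x => Real.exp x) hl.ne', integral_exp,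
    smul_eq_mul, mul_zero, Real.exp_zero, inv_mul_eq_div]
  gcongr
  linarith

/-- With `G` the primitive of `f`, the hypothesis makes `e^{-Kx} (a + K G x)` nonincreasing on `[0,
T]`; no sign of `f` or `a` is required. -/
theorem gronwall_nonneg {f : ℝ → ℝ} (hf : Continuous f) {a K T : ℝ} (hK : 0 ≤ K)
    (h : ∀ t, 0 ≤ t → t ≤ T → f t ≤ a + K * ∫ τ in (0 : ℝ)..t, f τ) {t : ℝ} (h0 : 0 ≤ t)
    (hT : t ≤ T) : f t ≤ a * Real.exp (K * t) := by
  set G : ℝ → ℝ := fun t => ∫ τ in (0 : ℝ)..t, f τ with hG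
  have hGd : ∀ x, HasDerivAt G (f x) x := fun x =>
    (hf.integral_hasStrictDerivAt 0 x).hasDerivAt
  set H : ℝ → ℝ := fun x => Real.exp (-(K * x)) * (a + K * G x) with hH
  have hHd : ∀ x, HasDerivAt H (Real.exp (-(K * x)) * (-(K * 1)) * (a + K * G x) +
      Real.exp (-(K * x)) * (K * f x)) x := fun x =>
    (((hasDerivAt_id x).const_mul K).neg.exp).mul (((hGd x).const_mul K).const_add a)
  have hanti : AntitoneOn H (Set.Icc 0 T) := by
    refine antitoneOn_of_deriv_nonpos (convex_Icc 0 T)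
      (fun x _ => (hHd x).continuousAt.continuousWithinAt)
      (fun x _ => (hHd x).differentiableAt.differentiableWithinAt) fun x hx => ?_
    rw [interior_Icc] at hx
    rw [(hHd x).deriv]
    have h1 := h x hx.1.le hx.2.le
    have h2 : K * (f x - (a + K * G x)) ≤ 0 :=
      mul_nonpos_of_nonneg_of_nonpos hK (by linarith)
    have h3 := Real.exp_pos (-(K * x))
    nlinarith
  have h4 := hanti ⟨le_rfl, h0.trans hT⟩ ⟨h0, hT⟩ h0
  have h5 : H 0 = a := by simp [hH, hG]
  rw [h5] at h4
  have h6 : a + K * G t ≤ a * Real.exp (K * t) := by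
    have := mul_le_mul_of_nonneg_right h4 (Real.exp_pos (K * t)).le
    rwa [hH, mul_right_comm, ← Real.exp_add, neg_add_cancel, Real.exp_zero, one_mul] at this
  exact (h t h0 hT).trans h6

theorem gronwall {f : ℝ → ℝ} (hf : Continuous f) (hf0 : ∀ t, 0 ≤ f t) {a K T : ℝ} (hK : 0 ≤ K)
    (h : ∀ t, |t| ≤ T → f t ≤ a + K * |∫ τ in (0 : ℝ)..t, f τ|) {t : ℝ} (hT : |t| ≤ T) :
    f t ≤ a * Real.exp (K * |t|) := by
  have pos : ∀ (g : ℝ → ℝ) (s : ℝ), (∀ x, 0 ≤ g x) → 0 ≤ s → 0 ≤ ∫ τ in (0 : ℝ)..s, g τ :=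
    fun g s hg hs => intervalIntegral.integral_nonneg hs fun x _ => hg x
  rcases le_total 0 t with h0 | h0
  · rw [abs_of_nonneg h0] at hT ⊢
    refine gronwall_nonneg hf hK (fun s hs hsT => ?_) h0 hT
    have := h s (by rwa [abs_of_nonneg hs])
    rwa [abs_of_nonneg (pos f s hf0 hs)] at this
  · rw [abs_of_nonpos h0] at hT ⊢
    have := gronwall_nonneg (f := fun x => f (-x)) (a := a) (K := K) (T := T) (by fun_prop) hK
      (fun s hs hsT => ?_) (neg_nonneg.2 h0) hT
    · simpa using this
    · have := h (-s) (by rwa [abs_neg, abs_of_nonneg hs])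
      have h2 := intervalIntegral.integral_comp_neg (a := 0) (b := s) (fun x => f x)
      rwa [intervalIntegral.integral_symm, abs_neg, ← neg_zero (G := ℝ), ← h2,
        abs_of_nonneg (pos (fun x => f (-x)) s (fun x => hf0 _) hs)] at this

/-! ### Mild solutions of semilinear equations -/

section Mild

variable {X : Type*} [NormedAddCommGroup X] [NormedSpace ℂ X]

/-- A bounded strongly continuous group of operators. -/
structure IsBoundedGroup (U : ℝ → X →L[ℂ] X) (C : ℝ) : Prop where
  add : ∀ s t x, U (s + t) x = U s (U t x)
  norm_le : ∀ t x, ‖U t x‖ ≤ C * ‖x‖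
  continuous : ∀ x, Continuous fun t => U t x

variable {U : ℝ → X →L[ℂ] X} {C : ℝ}

theorem IsBoundedGroup.continuous_uncurry (hU : IsBoundedGroup U C) :
    Continuous fun p : ℝ × X => U p.1 p.2 := by
  rw [continuous_iff_continuousAt]
  rintro ⟨t₀, x₀⟩
  rw [ContinuousAt, tendsto_iff_norm_sub_tendsto_zero]
  have h1 : Tendsto (fun p : ℝ × X => C * ‖p.2 - x₀‖ + ‖U p.1 x₀ - U t₀ x₀‖) (𝓝 (t₀, x₀))
      (𝓝 0) := by
    have hc := hU.continuous x₀
    have : Continuous fun p : ℝ × X => C * ‖p.2 - x₀‖ + ‖U p.1 x₀ - U t₀ x₀‖ := by fun_prop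
    simpa using this.tendsto (t₀, x₀)
  refine squeeze_zero (fun _ => norm_nonneg _) (fun p => ?_) h1
  have h2 : U p.1 p.2 - U t₀ x₀ = U p.1 (p.2 - x₀) + (U p.1 x₀ - U t₀ x₀) := by
    rw [map_sub]; abel
  rw [h2]
  exact (norm_add_le _ _).trans (add_le_add_left (hU.norm_le _ _) _)

theorem IsBoundedGroup.continuous_apply (hU : IsBoundedGroup U C) {Y : Type*} [TopologicalSpace Y]
    {s : Y → ℝ} {G : Y → X} (hs : Continuous s) (hG : Continuous G) :
    Continuous fun y => U (s y) (G y) :=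
  hU.continuous_uncurry.comp (hs.prodMk hG)

theorem IsBoundedGroup.norm_duhamel_le (hU : IsBoundedGroup U C) {G : ℝ → X} {g : ℝ → ℝ} {t : ℝ}
    (hg : Continuous g) (hC : 0 ≤ C) (h : ∀ τ, |τ| ≤ |t| → ‖G τ‖ ≤ g τ) :
    ‖∫ τ in (0 : ℝ)..t, U (t - τ) (G τ)‖ ≤ C * |∫ τ in (0 : ℝ)..t, g τ| := by
  have h1 : ‖∫ τ in (0 : ℝ)..t, U (t - τ) (G τ)‖ ≤ |∫ τ in (0 : ℝ)..t, C * g τ| := by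
    refine intervalIntegral.norm_integral_le_abs_of_norm_le
      ((ae_restrict_mem measurableSet_uIoc).mono fun τ hτ => ?_)
      ((hg.const_smul C).intervalIntegrable _ _)
    refine (hU.norm_le _ _).trans (mul_le_mul_of_nonneg_left (h τ ?_) hC)
    rcases Set.mem_uIoc.1 hτ with hτ | hτ
    · rw [abs_of_pos hτ.1, abs_of_pos (hτ.1.trans_le hτ.2)]; exact hτ.2
    · rw [abs_of_nonpos hτ.2, abs_of_neg (hτ.1.trans_le hτ.2)]; linarith
  rwa [intervalIntegral.integral_const_mul, abs_mul, abs_of_nonneg hC] at h1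

/-- Gronwall's inequality for a difference in Duhamel form. Taking `e = 0` gives both uniqueness
theorems; for the convergence rate `e` is the consistency error. -/
theorem IsBoundedGroup.stability (hU : IsBoundedGroup U C) (hC : 0 ≤ C) {c : ℂ} (hc : ‖c‖ ≤ 1)
    {v₁ v₂ e G : ℝ → X} (h₁ : Continuous v₁) (h₂ : Continuous v₂) {a K T : ℝ} (hK : 0 ≤ K)
    (h : ∀ t, |t| ≤ T → v₁ t - v₂ t = e t - c • ∫ τ in (0 : ℝ)..t, U (t - τ) (G τ))
    (he : ∀ t, |t| ≤ T → ‖e t‖ ≤ a) (hG : ∀ t, |t| ≤ T → ‖G t‖ ≤ K * ‖v₁ t - v₂ t‖)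
    {t : ℝ} (ht : |t| ≤ T) : ‖v₁ t - v₂ t‖ ≤ a * Real.exp (C * K * |t|) := by
  refine gronwall (f := fun t => ‖v₁ t - v₂ t‖) (by fun_prop) (fun _ => norm_nonneg _)
    (mul_nonneg hC hK) (fun s hs => ?_) ht
  rw [h s hs]
  refine (norm_sub_le _ _).trans (add_le_add (he s hs) ?_)
  rw [norm_smul]
  refine (mul_le_of_le_one_left (norm_nonneg _) hc).trans ?_
  refine (hU.norm_duhamel_le (g := fun τ => K * ‖v₁ τ - v₂ τ‖) (by fun_prop) hC
    fun τ hτ => hG τ (hτ.trans hs)).trans ?_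
  rw [intervalIntegral.integral_const_mul, abs_mul, abs_of_nonneg hK, mul_assoc]

variable [CompleteSpace X]

/-- Once `U t` is taken out, `t` enters the integral only through its upper limit, so regularity in
time reduces to that of a primitive. -/
theorem IsBoundedGroup.duhamel_eq (hU : IsBoundedGroup U C) {G : ℝ → X} (hG : Continuous G)
    (t : ℝ) :
    ∫ τ in (0 : ℝ)..t, U (t - τ) (G τ) = U t (∫ τ in (0 : ℝ)..t, U (-τ) (G τ)) := by
  rw [← ContinuousLinearMap.intervalIntegral_comp_comm _
    ((hU.continuous_apply continuous_neg hG).intervalIntegrable _ _)]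
  simp only [← hU.add, sub_eq_add_neg]

theorem IsBoundedGroup.continuous_duhamel (hU : IsBoundedGroup U C) {G : ℝ → X}
    (hG : Continuous G) : Continuous fun t => ∫ τ in (0 : ℝ)..t, U (t - τ) (G τ) := by
  simp only [hU.duhamel_eq hG]
  exact hU.continuous_apply continuous_id
    (intervalIntegral.continuous_primitive
      (fun a b => (hU.continuous_apply continuous_neg hG).intervalIntegrable a b) 0)

/-- Solutions of a semilinear evolution equation in Duhamel form. -/
def IsMild (U : ℝ → X →L[ℂ] X) (c : ℂ) (F : X → X) (x₀ : X) (v : ℝ → X) : Prop :=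
  ∀ t, v t = U t x₀ - c • ∫ τ in (0 : ℝ)..t, U (t - τ) (F (v τ))

/-- Picard iteration for all times at once: the unknown is a bounded `g` with `v t = e^{l|t|} g t`,
and a large `l` makes the Duhamel term a contraction without shortening the time interval. -/
theorem IsBoundedGroup.exists_mild (hU : IsBoundedGroup U C) (hC : 0 ≤ C) {c : ℂ} (hc : ‖c‖ ≤ 1)
    {F : X → X} {K : ℝ} (hK : 0 ≤ K) (hF : ∀ x y, ‖F x - F y‖ ≤ K * ‖x - y‖) (hF0 : F 0 = 0)
    (x₀ : X) : ∃ v : ℝ → X, Continuous v ∧ IsMild U c F x₀ v := by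
  have hFc : Continuous F := (LipschitzWith.of_dist_le_mul (K := K.toNNReal) fun x y => by
    rw [dist_eq_norm, dist_eq_norm, Real.coe_toNNReal _ hK]; exact hF x y).continuous
  have hFn : ∀ x, ‖F x‖ ≤ K * ‖x‖ := fun x => by simpa [hF0] using hF x 0
  -- In the weighted norm the Duhamel map has Lipschitz constant at most `C K / l ≤ 1/2`; the added
  -- 1 keeps `l` positive.
  set l : ℝ := 2 * (C * K) + 1 with hl
  have hl0 : 0 < l := by positivity
  set E : ℝ → ℂ := fun t => ((Real.exp (l * |t|) : ℝ) : ℂ) with hE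
  have hEc : Continuous E := by fun_prop
  have hEn : ∀ t, ‖E t‖ = Real.exp (l * |t|) := fun t => by
    rw [hE, Complex.norm_real, Real.norm_of_nonneg (Real.exp_pos _).le]
  have hE0 : ∀ t, E t ≠ 0 := fun t => by simp [hE]
  set D : (BoundedContinuousFunction ℝ X) → ℝ → X := fun g t =>
    U t x₀ - c • ∫ τ in (0 : ℝ)..t, U (t - τ) (F (E τ • g τ)) with hD
  have hGc : ∀ g : BoundedContinuousFunction ℝ X, Continuous fun τ => F (E τ • g τ) := fun g => by
    have := g.continuous
    fun_prop
  have hDc : ∀ g, Continuous (D g) := fun g =>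
    (hU.continuous x₀).sub ((hU.continuous_duhamel (hGc g)).const_smul c)
  have hint : ∀ (H : ℝ → X) (b : ℝ) (t : ℝ), 0 ≤ b → (∀ τ, ‖H τ‖ ≤ K * (Real.exp (l * |τ|) * b)) →
      ‖(E t)⁻¹ • c • ∫ τ in (0 : ℝ)..t, U (t - τ) (H τ)‖ ≤ 1 / 2 * b := by
    intro H b t hb hH
    rw [norm_smul, norm_smul, norm_inv, hEn]
    have h1 := hU.norm_duhamel_le (t := t) (G := H) (g := fun τ => K * (Real.exp (l * |τ|) * b))
      (by fun_prop) hC fun τ _ => hH τ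
    rw [intervalIntegral.integral_const_mul, intervalIntegral.integral_mul_const, abs_mul, abs_mul,
      abs_of_nonneg hK, abs_of_nonneg hb] at h1
    have h2 := abs_integral_exp_le hl0 t
    have h3 : ‖c‖ * ‖∫ τ in (0 : ℝ)..t, U (t - τ) (H τ)‖ ≤
        C * (K * (Real.exp (l * |t|) / l * b)) := by
      refine (mul_le_of_le_one_left (norm_nonneg _) hc).trans (h1.trans ?_)
      gcongr
    rw [inv_mul_le_iff₀ (Real.exp_pos _)]
    refine h3.trans ?_
    have h4 : C * K / l ≤ 1 / 2 := by
      rw [div_le_iff₀ hl0, hl]; linarith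
    calc C * (K * (Real.exp (l * |t|) / l * b)) = C * K / l * (Real.exp (l * |t|) * b) := by ring
      _ ≤ 1 / 2 * (Real.exp (l * |t|) * b) := by gcongr
      _ = _ := by ring
  set P : BoundedContinuousFunction ℝ X → BoundedContinuousFunction ℝ X := fun g =>
    BoundedContinuousFunction.ofNormedAddCommGroup (fun t => (E t)⁻¹ • D g t)
      ((hEc.inv₀ hE0).smul (hDc g)) (C * ‖x₀‖ + 1 / 2 * ‖g‖) (fun t => by
        simp only [hD]
        rw [smul_sub]
        refine (norm_sub_le _ _).trans (add_le_add ?_ (hint _ _ t (norm_nonneg g) fun τ => ?_))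
        · rw [norm_smul, norm_inv, hEn]
          refine (mul_le_of_le_one_left (norm_nonneg _) (inv_le_one_of_one_le₀ ?_)).trans
            (hU.norm_le _ _)
          exact Real.one_le_exp (by positivity)
        · refine (hFn _).trans ?_
          rw [norm_smul, hEn]
          gcongr
          exact g.norm_coe_le_norm τ) with hP
  have hcontr : ContractingWith (1 / 2) P := by
    refine ⟨by norm_num, LipschitzWith.of_dist_le_mul fun g₁ g₂ => ?_⟩
    rw [BoundedContinuousFunction.dist_le (by positivity)]
    intro t
    have h1 : P g₁ t - P g₂ t = -((E t)⁻¹ • c • ∫ τ in (0 : ℝ)..t,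
        U (t - τ) (F (E τ • g₁ τ) - F (E τ • g₂ τ))) := by
      simp only [hP, hD, BoundedContinuousFunction.coe_ofNormedAddCommGroup, map_sub]
      rw [intervalIntegral.integral_sub]
      · simp only [smul_sub]; abel
      · exact (hU.continuous_apply (by fun_prop) (hGc g₁)).intervalIntegrable _ _
      · exact (hU.continuous_apply (by fun_prop) (hGc g₂)).intervalIntegrable _ _
    rw [dist_eq_norm, h1, norm_neg]
    have := hint (fun τ => F (E τ • g₁ τ) - F (E τ • g₂ τ)) (dist g₁ g₂) t dist_nonneg fun τ => by
      refine (hF _ _).trans ?_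
      rw [← smul_sub, norm_smul, hEn, ← dist_eq_norm]
      gcongr
      exact BoundedContinuousFunction.dist_coe_le_dist τ
    simpa using this
  set g := hcontr.fixedPoint P
  have hg : P g = g := hcontr.fixedPoint_isFixedPt
  refine ⟨fun t => E t • g t, by have := g.continuous; fun_prop, fun t => ?_⟩
  have : g t = (E t)⁻¹ • D g t := by
    conv_lhs => rw [← hg]
    rfl
  simp only
  rw [this, smul_inv_smul₀ (hE0 t)]

end Mild

/-! ### The truncated nonlinearity -/

/-- The cubic nonlinearity `|z|² z`, with the factor `|z|` truncated at height `R`. -/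
def trunc (R : ℝ) (z : ℂ) : ℂ := ((min ‖z‖ R ^ 2 : ℝ) : ℂ) * z

theorem trunc_zero (R : ℝ) : trunc R 0 = 0 := by simp [trunc]

theorem trunc_of_le {R : ℝ} {z : ℂ} (h : ‖z‖ ≤ R) : trunc R z = ((‖z‖ ^ 2 : ℝ) : ℂ) * z := by
  rw [trunc, min_eq_left h]

/-- The constant is `1 + 2`. The truncated factor in front of `z - w` costs `R²`. The change of that
factor vanishes if both moduli are at least `R`; otherwise it is a difference of squares, at most
`2R‖z - w‖`, multiplied by `‖w‖ ≤ R`. -/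
theorem norm_trunc_sub_le {R : ℝ} (hR : 0 ≤ R) (z w : ℂ) :
    ‖trunc R z - trunc R w‖ ≤ 3 * R ^ 2 * ‖z - w‖ := by
  wlog h : ‖w‖ ≤ ‖z‖ generalizing z w
  · rw [norm_sub_rev, norm_sub_rev z w]
    exact this w z (le_of_not_ge h)
  have e : trunc R z - trunc R w = ((min ‖z‖ R ^ 2 : ℝ) : ℂ) * (z - w) +
      ((min ‖z‖ R ^ 2 - min ‖w‖ R ^ 2 : ℝ) : ℂ) * w := by
    unfold trunc
    push_cast
    ring
  rw [e]
  refine (norm_add_le _ _).trans ?_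
  rw [norm_mul, norm_mul, Complex.norm_real, Complex.norm_real]
  have hz0 : 0 ≤ min ‖z‖ R := le_min (norm_nonneg _) hR
  have hw0 : 0 ≤ min ‖w‖ R := le_min (norm_nonneg _) hR
  have hzR : min ‖z‖ R ≤ R := min_le_right _ _
  have hd : ‖z‖ - ‖w‖ ≤ ‖z - w‖ := norm_sub_norm_le _ _
  have hmono : min ‖w‖ R ≤ min ‖z‖ R := min_le_min_right _ h
  have h1 : ‖(min ‖z‖ R ^ 2 : ℝ)‖ ≤ R ^ 2 := by
    rw [Real.norm_of_nonneg (by positivity)]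
    gcongr
  have h2 : ‖(min ‖z‖ R ^ 2 - min ‖w‖ R ^ 2 : ℝ)‖ * ‖w‖ ≤ 2 * R ^ 2 * ‖z - w‖ := by
    rw [Real.norm_of_nonneg (sub_nonneg.2 (by gcongr))]
    rcases le_total R ‖w‖ with hw | hw
    · rw [min_eq_right hw, min_eq_right (hw.trans h), sub_self, zero_mul]
      positivity
    · rw [min_eq_left hw] at hmono ⊢
      have h3 : min ‖z‖ R - ‖w‖ ≤ ‖z - w‖ := (sub_le_sub_right (min_le_left _ _) _).trans hd
      have h4 : min ‖z‖ R ^ 2 - ‖w‖ ^ 2 ≤ 2 * R * ‖z - w‖ := by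
        calc min ‖z‖ R ^ 2 - ‖w‖ ^ 2 = (min ‖z‖ R + ‖w‖) * (min ‖z‖ R - ‖w‖) := by ring
          _ ≤ (2 * R) * ‖z - w‖ := by
            apply mul_le_mul (by linarith) h3 (by linarith) (by positivity)
      calc _ ≤ 2 * R * ‖z - w‖ * R := by gcongr
        _ = _ := by ring
  nlinarith [mul_le_mul_of_nonneg_right h1 (norm_nonneg (z - w))]

/-! ### Fourier analysis on the lattice -/

section LatticeTheory

variable (M : ℕ) [NeZero M]

theorem mesh_pos : 0 < mesh M :=
  div_pos Real.pi_pos (Nat.cast_pos.2 (Nat.pos_of_ne_zero (NeZero.ne M)))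

theorem mesh_le_pi : mesh M ≤ π :=
  div_le_self Real.pi_pos.le (Nat.one_le_cast.2 (Nat.pos_of_ne_zero (NeZero.ne M)))

theorem mesh_mul : mesh M * M = π :=
  div_mul_cancel₀ _ (Nat.cast_ne_zero.2 (NeZero.ne M))

theorem two_pi_ne_zero : (2 * π : ℂ) ≠ 0 := by exact_mod_cast Real.two_pi_pos.ne'

theorem latticeFourier_eq_dft (g : ZMod (2 * M) → ℂ) (k : ZMod (2 * M)) :
    latticeFourier M g k = (mesh M : ℂ) * ZMod.dft g k := by
  rw [latticeFourier, ZMod.dft_apply]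
  congr 1
  exact Finset.sum_congr rfl fun j _ => by rw [smul_eq_mul, mul_comm]

theorem latticeFourierInv_eq (G : ZMod (2 * M) → ℂ) (j : ZMod (2 * M)) :
    latticeFourierInv M G j = (mesh M : ℂ)⁻¹ * ZMod.dft.symm G j := by
  have h1 : (mesh M : ℂ) * M = π := by exact_mod_cast mesh_mul M
  have h2 : (mesh M : ℂ) ≠ 0 := by exact_mod_cast (mesh_pos M).ne'
  have h3 : (M : ℂ) ≠ 0 := by exact_mod_cast NeZero.ne M
  rw [latticeFourierInv, ZMod.invDFT_apply, smul_eq_mul, ← mul_assoc]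
  congr 1
  -- The normalisations agree because `(2π)⁻¹ = h⁻¹ (2M)⁻¹`, as `h M = π`.
  · rw [← h1]
    push_cast
    field_simp
  · exact Finset.sum_congr rfl fun i _ => by rw [smul_eq_mul, mul_comm (G i), mul_comm j i]

theorem latticeFourierInv_latticeFourier (g : ZMod (2 * M) → ℂ) :
    latticeFourierInv M (latticeFourier M g) = g := by
  have h2 : (mesh M : ℂ) ≠ 0 := by exact_mod_cast (mesh_pos M).ne'
  ext j
  have : latticeFourier M g = (mesh M : ℂ) • ZMod.dft g := funext (latticeFourier_eq_dft M g)
  rw [latticeFourierInv_eq, this, map_smul, LinearEquiv.symm_apply_apply, Pi.smul_apply,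
    smul_eq_mul, inv_mul_cancel_left₀ h2]

theorem latticeFourier_latticeFourierInv (G : ZMod (2 * M) → ℂ) :
    latticeFourier M (latticeFourierInv M G) = G := by
  have h2 : (mesh M : ℂ) ≠ 0 := by exact_mod_cast (mesh_pos M).ne'
  ext k
  have : latticeFourierInv M G = (mesh M : ℂ)⁻¹ • ZMod.dft.symm G :=
    funext (latticeFourierInv_eq M G)
  rw [latticeFourier_eq_dft, this, map_smul, LinearEquiv.apply_symm_apply, Pi.smul_apply,
    smul_eq_mul, mul_inv_cancel_left₀ h2]

/-- The lattice Fourier transform as a continuous linear map. -/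
def latticeFourierL : (ZMod (2 * M) → ℂ) →L[ℂ] (ZMod (2 * M) → ℂ) :=
  LinearMap.toContinuousLinearMap ((mesh M : ℂ) • (ZMod.dft (N := 2 * M) (E := ℂ)).toLinearMap)

theorem latticeFourierL_apply (g : ZMod (2 * M) → ℂ) :
    latticeFourierL M g = latticeFourier M g :=
  funext fun k => (latticeFourier_eq_dft M g k).symm

theorem latticeFourier_add (f g : ZMod (2 * M) → ℂ) (k : ZMod (2 * M)) :
    latticeFourier M (f + g) k = latticeFourier M f k + latticeFourier M g k := by
  simp only [← latticeFourierL_apply, map_add, Pi.add_apply]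

theorem latticeFourier_sub (f g : ZMod (2 * M) → ℂ) (k : ZMod (2 * M)) :
    latticeFourier M (f - g) k = latticeFourier M f k - latticeFourier M g k := by
  simp only [← latticeFourierL_apply, map_sub, Pi.sub_apply]

theorem latticeFourier_smul (c : ℂ) (g : ZMod (2 * M) → ℂ) (k : ZMod (2 * M)) :
    latticeFourier M (c • g) k = c * latticeFourier M g k := by
  simp only [← latticeFourierL_apply, map_smul, Pi.smul_apply, smul_eq_mul]

variable {M} in
theorem ext_latticeFourier {f g : ZMod (2 * M) → ℂ}
    (h : ∀ k, latticeFourier M f k = latticeFourier M g k) : f = g := by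
  rw [← latticeFourierInv_latticeFourier M f, ← latticeFourierInv_latticeFourier M g, funext h]

/-- The polarised form is needed because the conservation laws pair the solution, or its time
derivative, with the forcing. -/
theorem lattice_parseval (f g : ZMod (2 * M) → ℂ) :
    (mesh M : ℂ) * ∑ j, f j * starRingEnd ℂ (g j) =
      (2 * π : ℂ)⁻¹ * ∑ k, latticeFourier M f k * starRingEnd ℂ (latticeFourier M g k) := by
  have h1 : ∀ j, starRingEnd ℂ (g j) = (2 * π : ℂ)⁻¹ *
      ∑ k, starRingEnd ℂ (latticeFourier M g k) * ZMod.stdAddChar (-(j * k)) := fun j => by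
    conv_lhs => rw [← latticeFourierInv_latticeFourier M g]
    rw [latticeFourierInv, map_mul, map_sum, map_inv₀, map_mul, Complex.conj_ofReal, map_ofNat]
    congr 1
    exact Finset.sum_congr rfl fun k _ => by rw [map_mul, AddChar.map_neg_eq_conj]
  simp only [h1, Finset.mul_sum]
  rw [Finset.sum_comm]
  refine Finset.sum_congr rfl fun k _ => ?_
  conv_rhs => rw [latticeFourier, Finset.mul_sum, Finset.sum_mul, Finset.mul_sum]
  exact Finset.sum_congr rfl fun j _ => by ring

/-- The discrete mass `h ∑ |g(x)|²`. -/
def mass (g : ZMod (2 * M) → ℂ) : ℝ := mesh M * ∑ j, ‖g j‖ ^ 2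

theorem mass_nonneg (g : ZMod (2 * M) → ℂ) : 0 ≤ mass M g :=
  mul_nonneg (mesh_pos M).le (Finset.sum_nonneg fun _ _ => by positivity)

theorem mass_eq (g : ZMod (2 * M) → ℂ) :
    mass M g = (2 * π)⁻¹ * ∑ k, ‖latticeFourier M g k‖ ^ 2 := by
  have h := lattice_parseval M g g
  simp only [Complex.mul_conj'] at h
  exact_mod_cast h

theorem norm_sq_le_mass (g : ZMod (2 * M) → ℂ) (j : ZMod (2 * M)) :
    ‖g j‖ ^ 2 ≤ mass M g / mesh M := by
  rw [mass, mul_div_cancel_left₀ _ (mesh_pos M).ne']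
  exact Finset.single_le_sum (f := fun j => ‖g j‖ ^ 2) (fun _ _ => by positivity)
    (Finset.mem_univ j)

/-! ### The lattice unitary group -/

/-- The symbol of the lattice unitary group. -/
def latticePhase (α t : ℝ) (k : ZMod (2 * M)) : ℂ :=
  Complex.exp (-Complex.I * ((t * latticeSymbol M α k : ℝ) : ℂ))

omit [NeZero M] in
theorem norm_latticePhase (α t : ℝ) (k : ZMod (2 * M)) : ‖latticePhase M α t k‖ = 1 :=
  norm_exp_neg_I_mul _

omit [NeZero M] in
theorem latticePhase_add (α t t' : ℝ) (k : ZMod (2 * M)) :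
    latticePhase M α (t + t') k = latticePhase M α t k * latticePhase M α t' k := by
  rw [latticePhase, latticePhase, latticePhase, ← Complex.exp_add]
  push_cast
  ring_nf

theorem latticeFourier_latticePropagator (α t : ℝ) (g : ZMod (2 * M) → ℂ) (k : ZMod (2 * M)) :
    latticeFourier M (latticePropagator M α t g) k =
      latticePhase M α t k * latticeFourier M g k := by
  rw [latticePropagator, latticeFourier_latticeFourierInv]
  rfl

/-- The lattice unitary group as a continuous linear map. -/
def latticePropagatorL (α t : ℝ) : (ZMod (2 * M) → ℂ) →L[ℂ] (ZMod (2 * M) → ℂ) :=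
  LinearMap.toContinuousLinearMap
    { toFun := latticePropagator M α t
      map_add' := fun f g => ext_latticeFourier fun k => by
        simp only [latticeFourier_latticePropagator, latticeFourier_add]; ring
      map_smul' := fun c f => ext_latticeFourier fun k => by
        simp only [latticeFourier_latticePropagator, latticeFourier_smul, RingHom.id_apply]; ring }

theorem latticePropagatorL_apply (α t : ℝ) (g : ZMod (2 * M) → ℂ) :
    latticePropagatorL M α t g = latticePropagator M α t g := rfl

theorem mass_latticePropagator (α t : ℝ) (g : ZMod (2 * M) → ℂ) :
    mass M (latticePropagator M α t g) = mass M g := by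
  simp only [mass_eq, latticeFourier_latticePropagator, norm_mul, norm_latticePhase, one_mul]

theorem continuous_latticePropagator (α : ℝ) (g : ZMod (2 * M) → ℂ) :
    Continuous fun t => latticePropagator M α t g := by
  unfold latticePropagator latticeFourierInv
  fun_prop

/-- The function space carries the sup norm, which the group does not preserve; comparison with the
conserved mass costs `√(2M)`. This is harmless, since the bound serves only at fixed `M`, for
existence, uniqueness and continuity. -/
theorem isBoundedGroup_latticePropagatorL (α : ℝ) :
    IsBoundedGroup (latticePropagatorL M α) (√(2 * M : ℕ)) where
  add s t x := ext_latticeFourier fun k => by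
    simp only [latticePropagatorL_apply, latticeFourier_latticePropagator, latticePhase_add,
      mul_assoc]
  norm_le t x := by
    rw [latticePropagatorL_apply, pi_norm_le_iff_of_nonneg (by positivity)]
    intro j
    refine (sq_le_sq₀ (norm_nonneg _) (by positivity)).1 ?_
    refine (norm_sq_le_mass M _ j).trans ?_
    rw [mass_latticePropagator, mass, mul_div_cancel_left₀ _ (mesh_pos M).ne', mul_pow,
      Real.sq_sqrt (Nat.cast_nonneg _)]
    refine (Finset.sum_le_card_nsmul _ _ (‖x‖ ^ 2) fun j _ => ?_).trans ?_
    · gcongr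
      exact norm_le_pi_norm x j
    · rw [Finset.card_univ, ZMod.card, nsmul_eq_mul]
  continuous x := continuous_latticePropagator M α x

/-! ### Conservation laws on the lattice -/

/-- The discrete kinetic energy. -/
def kinetic (α : ℝ) (g : ZMod (2 * M) → ℂ) : ℝ :=
  (2 * π)⁻¹ * ∑ k, latticeSymbol M α k * ‖latticeFourier M g k‖ ^ 2

/-- Mild solutions with a given continuous forcing term. -/
structure IsForced (α μ : ℝ) (v G : ℝ → ZMod (2 * M) → ℂ) : Prop where
  continuous : Continuous v
  continuous_force : Continuous G
  eq : ∀ t, v t = latticePropagator M α t (v 0) -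
    (Complex.I * (μ : ℂ)) • ∫ τ in (0 : ℝ)..t, latticePropagator M α (t - τ) (G τ)

variable {M} {α μ : ℝ} {v G : ℝ → ZMod (2 * M) → ℂ}

/-- Mode by mode the Duhamel formula is a phase times a constant plus a primitive (`duhamel_eq`), so
a mild solution is automatically classical. -/
theorem IsForced.hasDerivAt_latticeFourier (h : IsForced M α μ v G) (k : ZMod (2 * M)) (t : ℝ) :
    HasDerivAt (fun t => latticeFourier M (v t) k)
      (-Complex.I * (latticeSymbol M α k * latticeFourier M (v t) k + μ * latticeFourier M (G t) k))
      t := by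
  have hGk : Continuous fun τ => latticePhase M α (-τ) k * latticeFourier M (G τ) k := by
    have h1 : Continuous fun τ => latticeFourierL M (G τ) k := by
      have := h.continuous_force
      fun_prop
    simp only [latticeFourierL_apply] at h1
    unfold latticePhase
    fun_prop
  have e : ∀ t, latticeFourier M (v t) k = latticePhase M α t k * (latticeFourier M (v 0) k -
      (Complex.I * μ) * ∫ τ in (0 : ℝ)..t, latticePhase M α (-τ) k * latticeFourier M (G τ) k) := by
    intro t
    have hU := isBoundedGroup_latticePropagatorL M α
    have hd := hU.duhamel_eq h.continuous_force t
    simp only [latticePropagatorL_apply] at hd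
    conv_lhs => rw [h.eq t]
    rw [latticeFourier_sub, latticeFourier_smul, hd, latticeFourier_latticePropagator,
      latticeFourier_latticePropagator]
    have h2 : latticeFourier M (∫ τ in (0 : ℝ)..t, latticePropagator M α (-τ) (G τ)) k =
        ∫ τ in (0 : ℝ)..t, latticePhase M α (-τ) k * latticeFourier M (G τ) k := by
      have h3 := ContinuousLinearMap.intervalIntegral_comp_comm (a := 0) (b := t)
        ((ContinuousLinearMap.proj (R := ℂ) (φ := fun _ : ZMod (2 * M) => ℂ) k).comp
          (latticeFourierL M))
        ((hU.continuous_apply continuous_neg h.continuous_force).intervalIntegrable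
          (μ := volume) 0 t)
      simp only [ContinuousLinearMap.comp_apply, ContinuousLinearMap.proj_apply,
        latticeFourierL_apply, latticePropagatorL_apply,
        latticeFourier_latticePropagator] at h3
      exact h3.symm
    rw [h2]
    ring
  have hph : HasDerivAt (fun t => latticePhase M α t k)
      (-Complex.I * latticeSymbol M α k * latticePhase M α t k) t := by
    have h1 : HasDerivAt (fun t : ℝ => -Complex.I * ((t * latticeSymbol M α k : ℝ) : ℂ))
        (-Complex.I * ((1 * latticeSymbol M α k : ℝ) : ℂ)) t :=
      (((hasDerivAt_id t).mul_const (latticeSymbol M α k)).ofReal_comp).const_mul _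
    refine h1.cexp.congr_deriv ?_
    rw [latticePhase]
    push_cast
    ring
  have hint := (hGk.integral_hasStrictDerivAt 0 t).hasDerivAt
  have hD := hph.mul ((hint.const_mul (Complex.I * μ)).const_sub (latticeFourier M (v 0) k))
  have h1 : latticePhase M α t k * latticePhase M α (-t) k = 1 := by
    rw [← latticePhase_add]
    simp [latticePhase]
  have hfun : (fun t => latticeFourier M (v t) k) = fun t => latticePhase M α t k *
      (latticeFourier M (v 0) k - (Complex.I * μ) *
        ∫ τ in (0 : ℝ)..t, latticePhase M α (-τ) k * latticeFourier M (G τ) k) := funext e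
  rw [hfun]
  refine hD.congr_deriv ?_
  rw [e t]
  linear_combination (-Complex.I * μ * latticeFourier M (G t) k) * h1

/-- The real symbol contributes a purely imaginary term. By Parseval the forcing contributes a
multiple of `Re(-iμ h ∑ G v̄)`, where every `G v̄` is real. Asking only for a real multiple of `v`
makes the law available for the truncated nonlinearity too. -/
theorem IsForced.mass_eq (h : IsForced M α μ v G)
    (hG : ∀ t j, ∃ ρ : ℝ, G t j = ρ * v t j) (t : ℝ) : mass M (v t) = mass M (v 0) := by
  have hd : ∀ t, HasDerivAt (fun t => mass M (v t)) 0 t := by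
    intro t
    simp only [FDNLS.mass_eq]
    have h1 := (HasDerivAt.fun_sum (u := Finset.univ) fun k _ =>
      (h.hasDerivAt_latticeFourier k t).norm_sq).const_mul ((2 * π)⁻¹)
    refine h1.congr_deriv ?_
    have h2 : ∀ k, 2 * inner ℝ (latticeFourier M (v t) k) (-Complex.I *
        (latticeSymbol M α k * latticeFourier M (v t) k + μ * latticeFourier M (G t) k)) =
        (2 * (-Complex.I * μ * (latticeFourier M (G t) k *
          starRingEnd ℂ (latticeFourier M (v t) k)))).re := by
      intro k
      have : -Complex.I * (latticeSymbol M α k * latticeFourier M (v t) k +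
          μ * latticeFourier M (G t) k) * starRingEnd ℂ (latticeFourier M (v t) k) =
          -Complex.I * μ * (latticeFourier M (G t) k * starRingEnd ℂ (latticeFourier M (v t) k)) +
          -Complex.I * ((latticeSymbol M α k * ‖latticeFourier M (v t) k‖ ^ 2 : ℝ) : ℂ) := by
        have := Complex.mul_conj' (latticeFourier M (v t) k)
        push_cast
        linear_combination (-Complex.I * latticeSymbol M α k) * this
      rw [Complex.inner, this, Complex.add_re]
      simp [-Complex.ofReal_pow]
    have h3 : ((2 * π)⁻¹ * ∑ k, (2 * (-Complex.I * μ * (latticeFourier M (G t) k *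
          starRingEnd ℂ (latticeFourier M (v t) k)))).re : ℝ) =
        (2 * (-Complex.I * μ) * ((2 * π : ℂ)⁻¹ * ∑ k, latticeFourier M (G t) k *
          starRingEnd ℂ (latticeFourier M (v t) k))).re := by
      rw [← Complex.re_sum, ← Complex.re_ofReal_mul]
      congr 1
      rw [← Finset.mul_sum, ← Finset.mul_sum]
      push_cast
      ring
    rw [Finset.sum_congr rfl fun k _ => h2 k, h3, ← lattice_parseval]
    have h4 : ∑ j, G t j * starRingEnd ℂ (v t j) = ((∑ j, (G t j * starRingEnd ℂ (v t j)).re : ℝ) : ℂ) := by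
      rw [Complex.ofReal_sum]
      refine Finset.sum_congr rfl fun j _ => ?_
      obtain ⟨ρ, hρ⟩ := hG t j
      rw [hρ, mul_assoc, Complex.mul_conj', ← Complex.ofReal_pow, ← Complex.ofReal_mul,
        Complex.ofReal_re]
    rw [h4, ← Complex.ofReal_mul]
    simp
  exact is_const_of_deriv_eq_zero (fun t => (hd t).differentiableAt) (fun t => (hd t).deriv) t 0

/-- The quartic part of the energy is local in space, so its derivative requires that of `v` at the
lattice points. -/
theorem IsForced.hasDerivAt_apply (h : IsForced M α μ v G) (t : ℝ) :
    ∃ v' : ZMod (2 * M) → ℂ, (∀ j, HasDerivAt (fun t => v t j) (v' j) t) ∧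
      ∀ k, latticeFourier M v' k = -Complex.I * (latticeSymbol M α k * latticeFourier M (v t) k +
        μ * latticeFourier M (G t) k) := by
  refine ⟨latticeFourierInv M fun k => -Complex.I * (latticeSymbol M α k *
    latticeFourier M (v t) k + μ * latticeFourier M (G t) k), fun j => ?_, fun k => ?_⟩
  · have e : (fun t => v t j) = fun t => latticeFourierInv M (latticeFourier M (v t)) j := by
      ext t
      rw [latticeFourierInv_latticeFourier]
    rw [e]
    unfold latticeFourierInv
    exact (HasDerivAt.fun_sum fun k _ =>
      (h.hasDerivAt_latticeFourier k t).mul_const _).const_mul _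
  · rw [latticeFourier_latticeFourierInv]

/-- Let `S` pair `σ v̂` with `Ĝ`. The kinetic and quartic parts have derivatives `-2μ Re(-iS)` and
`2μ Re(-iS)`; the terms in `σ²|v̂|²` and `|Ĝ|²` are purely imaginary and drop out. -/
theorem IsForced.energy_eq (h : IsForced M α μ v G)
    (hG : ∀ t j, G t j = ((‖v t j‖ ^ 2 : ℝ) : ℂ) * v t j) (t : ℝ) :
    kinetic M α (v t) + μ / 2 * (mesh M * ∑ j, ‖v t j‖ ^ 4) =
      kinetic M α (v 0) + μ / 2 * (mesh M * ∑ j, ‖v 0 j‖ ^ 4) := by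
  have hd : ∀ t, HasDerivAt (fun t => kinetic M α (v t) + μ / 2 * (mesh M * ∑ j, ‖v t j‖ ^ 4))
      0 t := by
    intro t
    obtain ⟨v', hv', hv'F⟩ := h.hasDerivAt_apply t
    set S : ℂ := (2 * π : ℂ)⁻¹ * ∑ k, latticeSymbol M α k * (latticeFourier M (v t) k *
      starRingEnd ℂ (latticeFourier M (G t) k)) with hS
    have hK : HasDerivAt (fun t => kinetic M α (v t)) (-2 * μ * (-Complex.I * S).re) t := by
      unfold kinetic
      have h1 := (HasDerivAt.fun_sum (u := Finset.univ) fun k _ =>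
        ((h.hasDerivAt_latticeFourier k t).norm_sq).const_mul
          (latticeSymbol M α k)).const_mul ((2 * π)⁻¹)
      refine h1.congr_deriv ?_
      have h2 : ∀ k, latticeSymbol M α k * (2 * inner ℝ (latticeFourier M (v t) k) (-Complex.I *
          (latticeSymbol M α k * latticeFourier M (v t) k + μ * latticeFourier M (G t) k))) =
          (((-2 * μ : ℝ) : ℂ) * (-Complex.I * (latticeSymbol M α k * (latticeFourier M (v t) k *
            starRingEnd ℂ (latticeFourier M (G t) k))))).re := by
        intro k
        rw [Complex.inner, Complex.re_ofReal_mul]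
        simp only [Complex.mul_re, Complex.mul_im, Complex.add_re, Complex.add_im, Complex.neg_re,
          Complex.neg_im, Complex.I_re, Complex.I_im, Complex.conj_re, Complex.conj_im,
          Complex.ofReal_re, Complex.ofReal_im]
        ring
      rw [Finset.sum_congr rfl fun k _ => h2 k, ← Complex.re_sum, ← Complex.re_ofReal_mul,
        ← Complex.re_ofReal_mul, hS]
      congr 1
      rw [← Finset.mul_sum, ← Finset.mul_sum]
      push_cast
      ring
    have hP : HasDerivAt (fun t => μ / 2 * (mesh M * ∑ j, ‖v t j‖ ^ 4))
        (2 * μ * (-Complex.I * S).re) t := by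
      have h1 := ((HasDerivAt.fun_sum (u := Finset.univ) fun j _ =>
        ((hv' j).norm_sq).pow 2).const_mul (mesh M)).const_mul (μ / 2)
      have e : (fun t => μ / 2 * (mesh M * ∑ j, ‖v t j‖ ^ 4)) =
          fun t => μ / 2 * (mesh M * ∑ j, ((fun t => ‖v t j‖ ^ 2) ^ 2) t) := by
        ext t
        simp only [Pi.pow_apply, ← pow_mul]
      rw [e]
      refine h1.congr_deriv ?_
      -- Since `G = |v|² v`, the derivative of `|v|⁴` is `4 Re(v' Ḡ)`, a pairing to which Parseval
      -- applies.
      have h2 : ∀ j, ((2 : ℕ) : ℝ) * (‖v t j‖ ^ 2) ^ (2 - 1) * (2 * inner ℝ (v t j) (v' j)) =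
          (4 * (v' j * starRingEnd ℂ (G t j))).re := by
        intro j
        rw [Complex.inner, hG, map_mul, Complex.conj_ofReal, mul_left_comm (v' j),
          show (4 : ℂ) = ((4 : ℝ) : ℂ) by norm_num, Complex.re_ofReal_mul, Complex.re_ofReal_mul]
        push_cast
        ring
      rw [Finset.sum_congr rfl fun j _ => h2 j, ← Complex.re_sum, ← Finset.mul_sum,
        ← Complex.re_ofReal_mul, ← Complex.re_ofReal_mul]
      have h3 : ((μ / 2 : ℝ) : ℂ) * ((mesh M : ℂ) * (4 * ∑ j, v' j * starRingEnd ℂ (G t j))) =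
          2 * μ * ((mesh M : ℂ) * ∑ j, v' j * starRingEnd ℂ (G t j)) := by
        push_cast; ring
      rw [h3, lattice_parseval]
      have h4 : (2 * π : ℂ)⁻¹ * ∑ k, latticeFourier M v' k *
          starRingEnd ℂ (latticeFourier M (G t) k) = -Complex.I * S +
          -Complex.I * (((2 * π)⁻¹ * ∑ k, μ * ‖latticeFourier M (G t) k‖ ^ 2 : ℝ) : ℂ) := by
        rw [hS]
        push_cast
        simp only [Finset.mul_sum]
        rw [← Finset.sum_add_distrib]
        refine Finset.sum_congr rfl fun k _ => ?_
        rw [hv'F]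
        have := Complex.mul_conj' (latticeFourier M (G t) k)
        linear_combination ((2 * π : ℂ)⁻¹ * (-Complex.I * μ)) * this
      rw [h4]
      have h5 : ((2 : ℂ) * μ) = ((2 * μ : ℝ) : ℂ) := by push_cast; ring
      rw [h5, Complex.re_ofReal_mul, Complex.add_re]
      congr 1
      simp [-Complex.ofReal_pow]
    refine (hK.add hP).congr_deriv ?_
    ring
  exact is_const_of_deriv_eq_zero (fun t => (hd t).differentiableAt) (fun t => (hd t).deriv) t 0

end LatticeTheory

section LatticeTheory

variable {M : ℕ} [NeZero M] {α μ : ℝ}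

/-! ### Well-posedness on the lattice -/

/-- The cubic nonlinearity on the lattice. -/
def latticeCubic (M : ℕ) (g : ZMod (2 * M) → ℂ) : ZMod (2 * M) → ℂ :=
  fun j => ((‖g j‖ ^ 2 : ℝ) : ℂ) * g j

omit [NeZero M] in
theorem continuous_latticeCubic : Continuous (latticeCubic M) := by
  unfold latticeCubic
  fun_prop

theorem latticePropagator_zero (g : ZMod (2 * M) → ℂ) : latticePropagator M α 0 g = g :=
  ext_latticeFourier fun k => by
    rw [latticeFourier_latticePropagator, latticePhase]
    simp

theorem IsLatticeSolution.apply_zero {v₀ : ZMod (2 * M) → ℂ} {v : ℝ → ZMod (2 * M) → ℂ}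
    (h : IsLatticeSolution M α μ v₀ v) : v 0 = v₀ := by
  rw [h.2 0, intervalIntegral.integral_same, smul_zero, sub_zero, latticePropagator_zero]

theorem IsLatticeSolution.isForced {v₀ : ZMod (2 * M) → ℂ} {v : ℝ → ZMod (2 * M) → ℂ}
    (h : IsLatticeSolution M α μ v₀ v) : IsForced M α μ v fun t => latticeCubic M (v t) :=
  ⟨h.1, continuous_latticeCubic.comp h.1, fun t => by rw [h.apply_zero]; exact h.2 t⟩

theorem IsLatticeSolution.mass_eq {v₀ : ZMod (2 * M) → ℂ} {v : ℝ → ZMod (2 * M) → ℂ}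
    (h : IsLatticeSolution M α μ v₀ v) (t : ℝ) : mass M (v t) = mass M v₀ := by
  rw [h.isForced.mass_eq (fun t j => ⟨_, rfl⟩) t, h.apply_zero]

theorem norm_I_mul (hμ : μ = 1 ∨ μ = -1) : ‖Complex.I * (μ : ℂ)‖ = 1 := by
  rcases hμ with rfl | rfl <;> simp

theorem norm_le_sqrt_mass (g : ZMod (2 * M) → ℂ) (j : ZMod (2 * M)) :
    ‖g j‖ ≤ √(mass M g / mesh M) :=
  Real.le_sqrt_of_sq_le (norm_sq_le_mass M g j)

/-- The truncation height is the largest modulus compatible with the mass. The truncated flow also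
conserves mass, so its solution never exceeds that height and solves the original equation. The
height depends on `h`, which does not matter at fixed `M`. -/
theorem exists_isLatticeSolution (hμ : μ = 1 ∨ μ = -1) (v₀ : ZMod (2 * M) → ℂ) :
    ∃ v, IsLatticeSolution M α μ v₀ v := by
  set R : ℝ := √(mass M v₀ / mesh M) with hR
  have hU := isBoundedGroup_latticePropagatorL M α
  obtain ⟨v, hv, hvm⟩ := hU.exists_mild (by positivity) (norm_I_mul hμ).le
    (F := fun g j => trunc R (g j)) (K := 3 * R ^ 2) (by positivity)
    (fun f g => by
      rw [pi_norm_le_iff_of_nonneg (by positivity)]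
      intro j
      refine (norm_trunc_sub_le (Real.sqrt_nonneg _) _ _).trans ?_
      gcongr
      exact norm_le_pi_norm (f - g) j)
    (by ext j; simp [trunc_zero]) v₀
  have h0 : v 0 = v₀ := by
    rw [hvm 0, intervalIntegral.integral_same, smul_zero, sub_zero]
    exact latticePropagator_zero v₀
  have hT : Continuous (trunc R) := by
    unfold trunc
    fun_prop
  have hf : IsForced M α μ v fun t j => trunc R (v t j) :=
    ⟨hv, by fun_prop, fun t => by rw [h0]; exact hvm t⟩
  have hmass : ∀ t, mass M (v t) = mass M v₀ := fun t => by
    rw [hf.mass_eq (fun t j => ⟨_, rfl⟩) t, h0]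
  refine ⟨v, hv, fun t => (hvm t).trans ?_⟩
  congr 3
  ext1 τ
  rw [latticePropagatorL_apply]
  congr 1
  ext1 j
  refine trunc_of_le ((norm_le_sqrt_mass (v τ) j).trans ?_)
  rw [hmass]

theorem norm_cubic_sub_le {R : ℝ} {z w : ℂ} (hz : ‖z‖ ≤ R) (hw : ‖w‖ ≤ R) :
    ‖((‖z‖ ^ 2 : ℝ) : ℂ) * z - ((‖w‖ ^ 2 : ℝ) : ℂ) * w‖ ≤ 3 * R ^ 2 * ‖z - w‖ := by
  rw [← trunc_of_le hz, ← trunc_of_le hw]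
  exact norm_trunc_sub_le ((norm_nonneg z).trans hz) z w

theorem IsLatticeSolution.unique (hμ : μ = 1 ∨ μ = -1) {v₀ : ZMod (2 * M) → ℂ}
    {v w : ℝ → ZMod (2 * M) → ℂ} (hv : IsLatticeSolution M α μ v₀ v)
    (hw : IsLatticeSolution M α μ v₀ w) : v = w := by
  set R : ℝ := √(mass M v₀ / mesh M) with hR
  have hU := isBoundedGroup_latticePropagatorL M α
  ext1 t
  rw [← sub_eq_zero, ← norm_le_zero_iff]
  have h := hU.stability (by positivity) (norm_I_mul hμ).le hv.1 hw.1 (e := fun _ => 0)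
    (G := fun τ => latticeCubic M (v τ) - latticeCubic M (w τ)) (a := 0) (K := 3 * R ^ 2) (T := |t|)
    (by positivity) (fun s _ => ?_) (fun _ _ => by simp) (fun s _ => ?_) (t := t) le_rfl
  · simpa using h
  · rw [hv.2 s, hw.2 s, sub_sub_sub_cancel_left, zero_sub, ← smul_sub, ← smul_neg]
    simp only [map_sub]
    rw [intervalIntegral.integral_sub]
    · rw [neg_sub]; rfl
    · exact (hU.continuous_apply (by fun_prop)
        (continuous_latticeCubic.comp hv.1)).intervalIntegrable _ _
    · exact (hU.continuous_apply (by fun_prop)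
        (continuous_latticeCubic.comp hw.1)).intervalIntegrable _ _
  · rw [pi_norm_le_iff_of_nonneg (by positivity)]
    intro j
    have h1 : ∀ (u : ℝ → ZMod (2 * M) → ℂ), IsLatticeSolution M α μ v₀ u → ‖u s j‖ ≤ R :=
      fun u hu => by
        rw [hR, ← hu.mass_eq s]
        exact norm_le_sqrt_mass _ _
    refine (norm_cubic_sub_le (h1 v hv) (h1 w hw)).trans ?_
    gcongr
    exact norm_le_pi_norm (v s - w s) j

/-! ### Comparison of the lattice symbol with `|k|^α` -/

/-- Changing the representative shifts the argument of the sine by a multiple of `π`, hence changes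
only its sign. This gives access to aliased frequencies, beyond the range of `valMinAbs`. -/
theorem latticeSymbol_intCast (n : ℤ) :
    latticeSymbol M α (n : ZMod (2 * M)) = |2 / mesh M * Real.sin (mesh M * n / 2)| ^ α := by
  have h : (((n : ZMod (2 * M)).valMinAbs : ℤ) : ZMod (2 * M)) = (n : ZMod (2 * M)) :=
    ZMod.coe_valMinAbs _
  rw [ZMod.intCast_eq_intCast_iff_dvd_sub] at h
  obtain ⟨l, hl⟩ := h
  have hn : (n : ℝ) = ((n : ZMod (2 * M)).valMinAbs : ℝ) + 2 * M * l := by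
    have : n = (n : ZMod (2 * M)).valMinAbs + ((2 * M : ℕ) : ℤ) * l := by rw [← hl]; ring
    exact_mod_cast this
  have hs : Real.sin (mesh M * n / 2) =
      (-1) ^ l * Real.sin (mesh M * ((n : ZMod (2 * M)).valMinAbs : ℝ) / 2) := by
    rw [← Real.sin_add_int_mul_pi, ← mesh_mul M]
    congr 1
    rw [hn]
    ring
  rw [latticeSymbol, hs, abs_mul, abs_mul, abs_mul, abs_zpow, abs_neg, abs_one, one_zpow, one_mul]

omit [NeZero M] in
theorem latticeSymbol_nonneg (k : ZMod (2 * M)) : 0 ≤ latticeSymbol M α k :=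
  Real.rpow_nonneg (abs_nonneg _) _

theorem latticeSymbol_intCast_le (hα : 0 ≤ α) (n : ℤ) :
    latticeSymbol M α (n : ZMod (2 * M)) ≤ |(n : ℝ)| ^ α := by
  have hh := mesh_pos M
  rw [latticeSymbol_intCast]
  refine Real.rpow_le_rpow (abs_nonneg _) ?_ hα
  rw [abs_mul, abs_of_pos (by positivity : 0 < 2 / mesh M)]
  have h1 : |Real.sin (mesh M * n / 2)| ≤ |mesh M * n / 2| := Real.abs_sin_le_abs
  rw [abs_div, abs_mul, abs_of_pos hh, abs_of_pos (by norm_num : (0 : ℝ) < 2)] at h1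
  calc 2 / mesh M * |Real.sin (mesh M * n / 2)| ≤ 2 / mesh M * (mesh M * |(n : ℝ)| / 2) := by gcongr
    _ = |(n : ℝ)| := by field_simp

theorem abs_mesh_mul_valMinAbs_le (k : ZMod (2 * M)) : mesh M * |(k.valMinAbs : ℝ)| ≤ π := by
  have h := ZMod.valMinAbs_mem_Ioc k
  have h1 : |(k.valMinAbs : ℝ)| ≤ M := by
    rw [abs_le]
    have h2 := h.1
    have h3 := h.2
    push_cast at h2 h3
    constructor
    · have : -(M : ℤ) ≤ k.valMinAbs := by omega
      exact_mod_cast this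
    · have : k.valMinAbs ≤ (M : ℤ) := by omega
      exact_mod_cast this
  calc _ ≤ mesh M * M := by gcongr; exact (mesh_pos M).le
    _ = π := mesh_mul M

/-- Jordan's inequality `|sin y| ≥ (2/π)|y|`, valid because the minimal representative keeps `|y| ≤
π/2`. Then `2/π ≥ 1/2`, and 4 bounds `2^α`. -/
theorem rpow_valMinAbs_le (hα : 0 ≤ α) (hα₂ : α ≤ 2) (k : ZMod (2 * M)) :
    |(k.valMinAbs : ℝ)| ^ α ≤ 4 * latticeSymbol M α k := by
  have hh := mesh_pos M
  have hk := abs_mesh_mul_valMinAbs_le k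
  set n : ℝ := (k.valMinAbs : ℝ) with hn
  have h1 : 2 / π * |mesh M * n / 2| ≤ |Real.sin (mesh M * n / 2)| := by
    refine Real.mul_abs_le_abs_sin ?_
    rw [abs_div, abs_mul, abs_of_pos hh, abs_of_pos (by norm_num : (0 : ℝ) < 2)]
    linarith
  rw [abs_div, abs_mul, abs_of_pos hh, abs_of_pos (by norm_num : (0 : ℝ) < 2)] at h1
  have h2 : |n| / 2 ≤ |2 / mesh M * Real.sin (mesh M * n / 2)| := by
    rw [abs_mul, abs_of_pos (by positivity : 0 < 2 / mesh M)]
    calc |n| / 2 ≤ 2 / π * |n| := by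
          rw [div_mul_eq_mul_div, div_le_div_iff₀ (by norm_num) Real.pi_pos]
          nlinarith [Real.pi_le_four, abs_nonneg n]
      _ = 2 / mesh M * (2 / π * (mesh M * |n| / 2)) := by field_simp
      _ ≤ _ := by gcongr
  have h3 := Real.rpow_le_rpow (by positivity) h2 hα
  rw [Real.div_rpow (abs_nonneg _) (by norm_num)] at h3
  have h4 : (2 : ℝ) ^ α ≤ 4 := by
    calc (2 : ℝ) ^ α ≤ 2 ^ (2 : ℝ) := Real.rpow_le_rpow_of_exponent_le (by norm_num) hα₂
      _ = 4 := by norm_num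
  rw [div_le_iff₀ (by positivity)] at h3
  refine h3.trans ?_
  rw [mul_comm]
  exact mul_le_mul_of_nonneg_right h4 (latticeSymbol_nonneg k)

/-! ### The discrete Sobolev seminorm and Wiener norm -/

variable (M) in
/-- The square of the discrete homogeneous Sobolev norm of order `α / 2`. -/
def gradSq (α : ℝ) (g : ZMod (2 * M) → ℂ) : ℝ :=
  (2 * π)⁻¹ * ∑ k, |(k.valMinAbs : ℝ)| ^ α * ‖latticeFourier M g k‖ ^ 2

variable (M) in
/-- The discrete Wiener norm. -/
def wiener (g : ZMod (2 * M) → ℂ) : ℝ := (2 * π)⁻¹ * ∑ k, ‖latticeFourier M g k‖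

theorem gradSq_nonneg (g : ZMod (2 * M) → ℂ) : 0 ≤ gradSq M α g :=
  mul_nonneg (by positivity) (Finset.sum_nonneg fun _ _ => by positivity)

theorem wiener_nonneg (g : ZMod (2 * M) → ℂ) : 0 ≤ wiener M g :=
  mul_nonneg (by positivity) (Finset.sum_nonneg fun _ _ => by positivity)

theorem gradSq_le_kinetic (hα : 0 ≤ α) (hα₂ : α ≤ 2) (g : ZMod (2 * M) → ℂ) :
    gradSq M α g ≤ 4 * kinetic M α g := by
  unfold kinetic gradSq
  rw [mul_left_comm, Finset.mul_sum (a := (4 : ℝ))]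
  refine mul_le_mul_of_nonneg_left (Finset.sum_le_sum fun k _ => ?_) (by positivity)
  rw [← mul_assoc]
  gcongr
  exact rpow_valMinAbs_le hα hα₂ k

theorem norm_le_wiener (g : ZMod (2 * M) → ℂ) (j : ZMod (2 * M)) : ‖g j‖ ≤ wiener M g := by
  conv_lhs => rw [← latticeFourierInv_latticeFourier M g]
  rw [latticeFourierInv, norm_mul, wiener]
  have h : ‖(2 * π : ℂ)⁻¹‖ = (2 * π)⁻¹ := by
    rw [norm_inv, norm_mul, Complex.norm_real, Real.norm_of_nonneg Real.pi_pos.le]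
    simp
  rw [h]
  refine mul_le_mul_of_nonneg_left ((norm_sum_le _ _).trans (Finset.sum_le_sum fun k _ => ?_))
    (by positivity)
  rw [norm_mul, AddChar.norm_apply, mul_one]

/-- The resolvent sum `∑ₖ (l + |k|^α)⁻¹` over `ℤ`. -/
def resolventSum (α l : ℝ) : ℝ := ∑' k : ℤ, (l + |(k : ℝ)| ^ α)⁻¹

theorem summable_resolvent (hα : 1 < α) {l : ℝ} (hl : 1 ≤ l) :
    Summable fun k : ℤ => (l + |(k : ℝ)| ^ α)⁻¹ := by
  refine Summable.of_norm_bounded_eventually (Real.summable_abs_int_rpow hα) ?_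
  filter_upwards [(Set.finite_singleton (0 : ℤ)).compl_mem_cofinite] with k hk
  have hk' : (0 : ℝ) < |(k : ℝ)| := by simpa using hk
  rw [Real.norm_of_nonneg (by positivity), Real.rpow_neg (abs_nonneg _)]
  gcongr
  linarith

/-- Smallness for large `l` plays the role of a Gagliardo–Nirenberg inequality: it lets the kinetic
energy absorb the focusing potential. -/
theorem tendsto_resolventSum (hα : 1 < α) : Tendsto (resolventSum α) atTop (𝓝 0) := by
  have h := tendsto_tsum_of_dominated_convergence (𝓕 := atTop)
    (f := fun (l : ℝ) (k : ℤ) => (l + |(k : ℝ)| ^ α)⁻¹) (g := fun _ => 0)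
    (summable_resolvent hα le_rfl)
    (fun k => (tendsto_atTop_add_const_right _ _ tendsto_id).inv_tendsto_atTop)
    (by
      filter_upwards [eventually_ge_atTop 1] with l hl k
      rw [Real.norm_of_nonneg (by positivity)]
      gcongr)
  rwa [tsum_zero] at h

theorem resolventSum_nonneg {l : ℝ} (hl : 1 ≤ l) : 0 ≤ resolventSum α l :=
  tsum_nonneg fun _ => by positivity

/-- Cauchy–Schwarz with weight `l + |k|^α`; `l` stays free so that the coefficient of `gradSq` can
be made small. -/
theorem wiener_sq_le (hα : 1 < α) {l : ℝ} (hl : 1 ≤ l) (g : ZMod (2 * M) → ℂ) :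
    wiener M g ^ 2 ≤ resolventSum α l * (l * mass M g + gradSq M α g) := by
  have h1 : (∑ k, ‖latticeFourier M g k‖) ^ 2 ≤
      (∑ k : ZMod (2 * M), (l + |(k.valMinAbs : ℝ)| ^ α)⁻¹) *
        ∑ k : ZMod (2 * M), (l + |(k.valMinAbs : ℝ)| ^ α) * ‖latticeFourier M g k‖ ^ 2 := by
    refine Finset.sum_sq_le_sum_mul_sum_of_sq_le_mul _ (fun _ _ => by positivity)
      (fun _ _ => by positivity) fun k _ => ?_
    have : 0 < l + |(k.valMinAbs : ℝ)| ^ α := by positivity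
    exact (inv_mul_cancel_left₀ this.ne' _).ge
  have h2 : ∑ k : ZMod (2 * M), (l + |(k.valMinAbs : ℝ)| ^ α)⁻¹ ≤ resolventSum α l := by
    rw [resolventSum, ← Finset.sum_image (s := Finset.univ)
      (g := fun k : ZMod (2 * M) => k.valMinAbs) (f := fun k : ℤ => (l + |(k : ℝ)| ^ α)⁻¹)
      (fun x _ y _ h => ZMod.injective_valMinAbs h)]
    exact (summable_resolvent hα hl).sum_le_tsum _ fun _ _ => by positivity
  have h3 : ∑ k : ZMod (2 * M), (l + |(k.valMinAbs : ℝ)| ^ α) * ‖latticeFourier M g k‖ ^ 2 =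
      2 * π * (l * mass M g + gradSq M α g) := by
    rw [mass_eq, gradSq, mul_left_comm, ← mul_add, mul_inv_cancel_left₀ Real.two_pi_pos.ne',
      Finset.mul_sum, ← Finset.sum_add_distrib]
    exact Finset.sum_congr rfl fun _ _ => by ring
  have h4 : 0 ≤ l * mass M g + gradSq M α g :=
    add_nonneg (mul_nonneg (by linarith) (mass_nonneg M g)) (gradSq_nonneg g)
  rw [h3] at h1
  have h5 : (1 : ℝ) ≤ 2 * π := by linarith [Real.pi_gt_three]
  calc wiener M g ^ 2 = (2 * π)⁻¹ ^ 2 * (∑ k, ‖latticeFourier M g k‖) ^ 2 := by rw [wiener, mul_pow]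
    _ ≤ (2 * π)⁻¹ ^ 2 * (resolventSum α l * (2 * π * (l * mass M g + gradSq M α g))) := by
        refine mul_le_mul_of_nonneg_left (h1.trans ?_) (by positivity)
        gcongr
    _ = (2 * π)⁻¹ * (resolventSum α l * (l * mass M g + gradSq M α g)) := by
        field_simp
    _ ≤ _ := mul_le_of_le_one_left (mul_nonneg (resolventSum_nonneg hl) h4)
        (inv_le_one_of_one_le₀ h5)

theorem sum_norm_pow_four_le (g : ZMod (2 * M) → ℂ) :
    mesh M * ∑ j, ‖g j‖ ^ 4 ≤ wiener M g ^ 2 * mass M g := by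
  rw [mass, mul_left_comm, Finset.mul_sum (a := wiener M g ^ 2)]
  refine mul_le_mul_of_nonneg_left (Finset.sum_le_sum fun j _ => ?_) (mesh_pos M).le
  have : ‖g j‖ ^ 4 = ‖g j‖ ^ 2 * ‖g j‖ ^ 2 := by ring
  rw [this]
  gcongr
  exact norm_le_wiener g j

/-- Uniform bounds on lattice solutions, from conservation of mass and energy. -/
theorem exists_uniform_bound (hα : 1 < α) (hα₂ : α ≤ 2) (r : ℝ) :
    ∃ B : ℝ, 0 ≤ B ∧ ∀ (M : ℕ) [NeZero M] (μ : ℝ), (μ = 1 ∨ μ = -1) →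
      ∀ (v₀ : ZMod (2 * M) → ℂ) (v : ℝ → ZMod (2 * M) → ℂ), IsLatticeSolution M α μ v₀ v →
      mass M v₀ ≤ r ^ 2 → kinetic M α v₀ ≤ r ^ 2 → ∀ t, gradSq M α (v t) ≤ B := by
  have hα0 : 0 ≤ α := by linarith
  -- With such an `l` the quartic term is at most `l r²/4` plus the kinetic energy. The energy
  -- contains half of it, so half of the kinetic energy survives when `μ = -1`.
  have hsmall : ∀ᶠ l in atTop, r ^ 2 * resolventSum α l ≤ 1 / 4 := by
    have := (tendsto_resolventSum hα).const_mul (r ^ 2)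
    rw [mul_zero] at this
    exact this.eventually_le_const (by norm_num)
  obtain ⟨l, hl, hl1⟩ := (hsmall.and (eventually_ge_atTop 1)).exists
  refine ⟨16 * r ^ 2 + 2 * l * r ^ 2, by positivity, ?_⟩
  intro M _ μ hμ v₀ v hv hm hk t
  have hE := hv.isForced.energy_eq (fun _ _ => rfl) t
  rw [hv.apply_zero] at hE
  have key : ∀ g : ZMod (2 * M) → ℂ, mass M g ≤ r ^ 2 →
      0 ≤ mesh M * ∑ j, ‖g j‖ ^ 4 ∧
      mesh M * ∑ j, ‖g j‖ ^ 4 ≤ 1 / 4 * (l * r ^ 2 + 4 * kinetic M α g) := by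
    intro g hg
    refine ⟨mul_nonneg (mesh_pos M).le (Finset.sum_nonneg fun _ _ => by positivity), ?_⟩
    have h1 := sum_norm_pow_four_le g
    have h2 := wiener_sq_le hα hl1 g
    have h3 := gradSq_le_kinetic hα0 hα₂ g
    have h4 := mass_nonneg M g
    have h5 := gradSq_nonneg (α := α) g
    have hS := resolventSum_nonneg (α := α) hl1
    calc _ ≤ wiener M g ^ 2 * r ^ 2 := h1.trans (by gcongr)
      _ ≤ (resolventSum α l * (l * mass M g + gradSq M α g)) * r ^ 2 := by gcongr
      _ = (r ^ 2 * resolventSum α l) * (l * mass M g + gradSq M α g) := by ring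
      _ ≤ 1 / 4 * (l * mass M g + gradSq M α g) := by gcongr
      _ ≤ _ := by gcongr
  obtain ⟨hp, hq⟩ := key (v t) (by rw [hv.mass_eq]; exact hm)
  obtain ⟨hp₀, hq₀⟩ := key v₀ hm
  have h3 := gradSq_le_kinetic hα0 hα₂ (v t)
  have h4 : 0 ≤ l * r ^ 2 := by positivity
  have h5 : 0 ≤ r ^ 2 := by positivity
  -- For `μ = 1` the potential is dropped at time `t` and estimated at time `0`; for `μ = -1` the
  -- other way round.
  rcases hμ with rfl | rfl <;> linarith

/-! ### The Wiener algebra estimate -/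

theorem latticeFourier_mul (f g : ZMod (2 * M) → ℂ) (k : ZMod (2 * M)) :
    latticeFourier M (f * g) k =
      (2 * π : ℂ)⁻¹ * ∑ l, latticeFourier M f l * latticeFourier M g (k - l) := by
  have h1 : ∀ j, f j = (2 * π : ℂ)⁻¹ * ∑ l, latticeFourier M f l * ZMod.stdAddChar (j * l) :=
    fun j => (congrFun (latticeFourierInv_latticeFourier M f) j).symm
  have h2 : ∀ l, latticeFourier M g (k - l) = (mesh M : ℂ) *
      ∑ j, g j * (ZMod.stdAddChar (-(j * k)) * ZMod.stdAddChar (j * l)) := fun l => by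
    rw [latticeFourier]
    congr 1
    refine Finset.sum_congr rfl fun j _ => ?_
    rw [← AddChar.map_add_eq_mul]
    ring_nf
  simp only [h2]
  rw [latticeFourier]
  simp only [Pi.mul_apply, h1, Finset.mul_sum, Finset.sum_mul]
  rw [Finset.sum_comm]
  exact Finset.sum_congr rfl fun j _ => Finset.sum_congr rfl fun l _ => by ring

theorem latticeFourier_conj (g : ZMod (2 * M) → ℂ) (k : ZMod (2 * M)) :
    latticeFourier M (star g) k = starRingEnd ℂ (latticeFourier M g (-k)) := by
  rw [latticeFourier, latticeFourier, map_mul, Complex.conj_ofReal, map_sum]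
  congr 1
  refine Finset.sum_congr rfl fun j _ => ?_
  rw [map_mul, ← AddChar.map_neg_eq_conj, mul_neg, neg_neg]
  rfl

omit [NeZero M] in
theorem abs_valMinAbs_neg (k : ZMod (2 * M)) :
    |((-k).valMinAbs : ℝ)| = |(k.valMinAbs : ℝ)| := by
  have := ZMod.natAbs_valMinAbs_neg k
  rw [← Int.cast_abs, ← Int.cast_abs, Int.abs_eq_natAbs, Int.abs_eq_natAbs, this]

theorem wiener_conj (g : ZMod (2 * M) → ℂ) : wiener M (star g) = wiener M g := by
  unfold wiener
  congr 1
  refine Fintype.sum_equiv (Equiv.neg _) _ _ fun k => ?_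
  rw [latticeFourier_conj, RCLike.norm_conj, Equiv.neg_apply]

theorem gradSq_conj (g : ZMod (2 * M) → ℂ) : gradSq M α (star g) = gradSq M α g := by
  unfold gradSq
  congr 1
  refine Fintype.sum_equiv (Equiv.neg _) _ _ fun k => ?_
  rw [latticeFourier_conj, RCLike.norm_conj, Equiv.neg_apply, abs_valMinAbs_neg]

theorem norm_latticeFourier_mul_le (f g : ZMod (2 * M) → ℂ) (k : ZMod (2 * M)) :
    ‖latticeFourier M (f * g) k‖ ≤
      (2 * π)⁻¹ * ∑ l, ‖latticeFourier M f l‖ * ‖latticeFourier M g (k - l)‖ := by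
  have h : ‖(2 * π : ℂ)⁻¹‖ = (2 * π)⁻¹ := by
    rw [norm_inv, norm_mul, Complex.norm_real, Real.norm_of_nonneg Real.pi_pos.le]
    simp
  rw [latticeFourier_mul, norm_mul, h]
  refine mul_le_mul_of_nonneg_left ((norm_sum_le _ _).trans_eq ?_) (by positivity)
  exact Finset.sum_congr rfl fun l _ => norm_mul _ _

theorem wiener_mul_le (f g : ZMod (2 * M) → ℂ) : wiener M (f * g) ≤ wiener M f * wiener M g := by
  calc wiener M (f * g) ≤ (2 * π)⁻¹ * ∑ k, (2 * π)⁻¹ *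
        ∑ l, ‖latticeFourier M f l‖ * ‖latticeFourier M g (k - l)‖ := by
        unfold wiener
        gcongr
        exact norm_latticeFourier_mul_le f g _
    _ = (2 * π)⁻¹ * ((2 * π)⁻¹ * ∑ l, ∑ k, ‖latticeFourier M f l‖ *
          ‖latticeFourier M g (k - l)‖) := by
        rw [← Finset.mul_sum, Finset.sum_comm]
    _ = (2 * π)⁻¹ * ((2 * π)⁻¹ * ∑ l, ‖latticeFourier M f l‖ * ∑ k, ‖latticeFourier M g k‖) := by
        congr 2
        refine Finset.sum_congr rfl fun l _ => ?_
        rw [← Finset.mul_sum]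
        congr 1
        exact Fintype.sum_equiv (Equiv.subRight l) _ _ fun k => rfl
    _ = wiener M f * wiener M g := by
        rw [← Finset.sum_mul, wiener, wiener]
        ring

/-- Young's inequality for `ℓ² * ℓ¹`: Cauchy–Schwarz against the weight `b (k - l)`, then summation
over `k` before `l`. -/
theorem sum_convolution_sq_le {A : Type*} [Fintype A] [AddCommGroup A] {a b : A → ℝ}
    (hb : ∀ x, 0 ≤ b x) :
    ∑ k, (∑ l, a l * b (k - l)) ^ 2 ≤ (∑ k, b k) ^ 2 * ∑ k, a k ^ 2 := by
  have h1 : ∀ k, (∑ l, a l * b (k - l)) ^ 2 ≤ (∑ l, b l) * ∑ l, a l ^ 2 * b (k - l) := by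
    intro k
    have e : ∑ l, b l = ∑ l, b (k - l) :=
      (Fintype.sum_equiv (Equiv.subLeft k) _ _ fun l => rfl).symm
    rw [e]
    refine Finset.sum_sq_le_sum_mul_sum_of_sq_le_mul _ (fun l _ => hb _)
      (fun l _ => mul_nonneg (sq_nonneg _) (hb _)) fun l _ => le_of_eq (by ring)
  calc _ ≤ ∑ k, (∑ l, b l) * ∑ l, a l ^ 2 * b (k - l) := Finset.sum_le_sum fun k _ => h1 k
    _ = (∑ l, b l) * ∑ l, a l ^ 2 * ∑ k, b (k - l) := by
        rw [← Finset.mul_sum, Finset.sum_comm]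
        simp only [← Finset.mul_sum]
    _ = (∑ l, b l) * ∑ l, a l ^ 2 * ∑ k, b k := by
        congr 1
        refine Finset.sum_congr rfl fun l _ => ?_
        congr 1
        exact Fintype.sum_equiv (Equiv.subRight l) _ _ fun k => rfl
    _ = _ := by
        rw [← Finset.sum_mul]
        ring

omit [NeZero M] in
-- Reduction modulo `2M` to the minimal representative can only shrink a sum, and `x ↦ x^s` is
-- subadditive for `s ≤ 1`. It is applied with `s = α/2`.
theorem rpow_valMinAbs_add_le {s : ℝ} (hs : 0 ≤ s) (hs1 : s ≤ 1) (k l : ZMod (2 * M)) :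
    |(k.valMinAbs : ℝ)| ^ s ≤ |(l.valMinAbs : ℝ)| ^ s + |((k - l).valMinAbs : ℝ)| ^ s := by
  have h1 : |(k.valMinAbs : ℝ)| ≤ |(l.valMinAbs : ℝ)| + |((k - l).valMinAbs : ℝ)| := by
    have h2 := ZMod.natAbs_valMinAbs_add_le l (k - l)
    rw [add_sub_cancel] at h2
    have h3 : |k.valMinAbs| ≤ |l.valMinAbs + (k - l).valMinAbs| := by
      rw [Int.abs_eq_natAbs, Int.abs_eq_natAbs]
      exact_mod_cast h2
    have h4 : |k.valMinAbs| ≤ |l.valMinAbs| + |(k - l).valMinAbs| := h3.trans (abs_add_le _ _)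
    exact_mod_cast h4
  exact (Real.rpow_le_rpow (abs_nonneg _) h1 hs).trans
    (Real.rpow_add_le_add_rpow (abs_nonneg _) (abs_nonneg _) hs hs1)

/-- A fractional Leibniz rule: the weight `|k|^(α/2)` is distributed over the two factors of the
convolution, and Young's inequality measures the unweighted factor in `ℓ¹`, that is, in the Wiener
norm. -/
theorem gradSq_mul_le (hα : 0 ≤ α) (hα₂ : α ≤ 2) (f g : ZMod (2 * M) → ℂ) :
    gradSq M α (f * g) ≤ 2 * (gradSq M α f * wiener M g ^ 2 + wiener M f ^ 2 * gradSq M α g) := by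
  set s := α / 2 with hs
  set F := fun k => ‖latticeFourier M f k‖ with hF
  set G := fun k => ‖latticeFourier M g k‖ with hG
  set w : ZMod (2 * M) → ℝ := fun k => |(k.valMinAbs : ℝ)| ^ s with hw
  have hw2 : ∀ k : ZMod (2 * M), |(k.valMinAbs : ℝ)| ^ α = w k ^ 2 := fun k => by
    rw [hw, ← Real.rpow_natCast, ← Real.rpow_mul (abs_nonneg _), hs]
    norm_num
  have hw0 : ∀ k, 0 ≤ w k := fun k => by positivity
  have hF0 : ∀ k, 0 ≤ F k := fun k => norm_nonneg _
  have hG0 : ∀ k, 0 ≤ G k := fun k => norm_nonneg _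
  set c : ℝ := (2 * π)⁻¹ with hc
  have hc0 : 0 ≤ c := by positivity
  have hk : ∀ k, w k * ‖latticeFourier M (f * g) k‖ ≤
      c * ((∑ l, (w l * F l) * G (k - l)) + ∑ l, (w l * G l) * F (k - l)) := by
    intro k
    have e : ∑ l, (w l * G l) * F (k - l) = ∑ l, F l * (w (k - l) * G (k - l)) := by
      refine Fintype.sum_equiv (Equiv.subLeft k) _ _ fun l => ?_
      simp only [Equiv.subLeft_apply, sub_sub_cancel]
      ring
    calc _ ≤ w k * (c * ∑ l, F l * G (k - l)) := by
          gcongr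
          exact norm_latticeFourier_mul_le f g k
      _ = c * ∑ l, w k * (F l * G (k - l)) := by rw [mul_left_comm, Finset.mul_sum (a := w k)]
      _ ≤ c * ∑ l, (w l + w (k - l)) * (F l * G (k - l)) := by
          refine mul_le_mul_of_nonneg_left (Finset.sum_le_sum fun l _ => ?_) hc0
          exact mul_le_mul_of_nonneg_right (rpow_valMinAbs_add_le (by positivity) (by linarith) k l)
            (mul_nonneg (hF0 _) (hG0 _))
      _ = _ := by
          rw [e, ← Finset.sum_add_distrib]
          congr 1
          exact Finset.sum_congr rfl fun l _ => by ring
  have hk2 : ∀ k, (w k * ‖latticeFourier M (f * g) k‖) ^ 2 ≤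
      2 * c ^ 2 * ((∑ l, (w l * F l) * G (k - l)) ^ 2 + (∑ l, (w l * G l) * F (k - l)) ^ 2) := by
    intro k
    refine (pow_le_pow_left₀ (mul_nonneg (hw0 k) (norm_nonneg _)) (hk k) 2).trans ?_
    rw [mul_pow]
    exact (mul_le_mul_of_nonneg_left add_sq_le (sq_nonneg c)).trans_eq (by ring)
  have h1 := sum_convolution_sq_le (a := fun l => w l * F l) (b := G) hG0
  have h2 := sum_convolution_sq_le (a := fun l => w l * G l) (b := F) hF0
  have e1 : ∀ u : ZMod (2 * M) → ℂ,
      gradSq M α u = c * ∑ k, (w k * ‖latticeFourier M u k‖) ^ 2 := fun u => by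
    rw [gradSq]
    congr 1
    exact Finset.sum_congr rfl fun k _ => by rw [hw2, mul_pow]
  rw [e1 (f * g), e1 f, e1 g, wiener, wiener]
  calc _ ≤ c * ∑ k, 2 * c ^ 2 * ((∑ l, (w l * F l) * G (k - l)) ^ 2 +
        (∑ l, (w l * G l) * F (k - l)) ^ 2) := by
        gcongr with k
        exact hk2 k
    _ = c * (2 * c ^ 2 * (∑ k, (∑ l, (w l * F l) * G (k - l)) ^ 2 +
        ∑ k, (∑ l, (w l * G l) * F (k - l)) ^ 2)) := by
        rw [← Finset.mul_sum, Finset.sum_add_distrib]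
    _ ≤ c * (2 * c ^ 2 * ((∑ k, G k) ^ 2 * ∑ k, (w k * F k) ^ 2 +
        (∑ k, F k) ^ 2 * ∑ k, (w k * G k) ^ 2)) := by gcongr
    _ = _ := by ring

omit [NeZero M] in
theorem latticeCubic_eq (g : ZMod (2 * M) → ℂ) : latticeCubic M g = g * star g * g := by
  ext j
  rw [latticeCubic, Pi.mul_apply, Pi.mul_apply, Pi.star_apply, Complex.ofReal_pow,
    ← Complex.mul_conj']
  rfl

/-- Two applications of the Leibniz rule to `(g ḡ) g`; `10 = 2(2·2 + 1)`. The bound is needed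
because comparing the groups under the Duhamel integral costs `α/2` derivatives. -/
theorem gradSq_latticeCubic_le (hα : 0 ≤ α) (hα₂ : α ≤ 2) (g : ZMod (2 * M) → ℂ) :
    gradSq M α (latticeCubic M g) ≤ 10 * wiener M g ^ 4 * gradSq M α g := by
  have h1 := gradSq_mul_le hα hα₂ g (star g)
  rw [gradSq_conj, wiener_conj] at h1
  have h2 := wiener_mul_le g (star g)
  rw [wiener_conj] at h2
  have h3 := gradSq_mul_le hα hα₂ (g * star g) g
  rw [latticeCubic_eq]
  have hN := gradSq_nonneg (α := α) g
  have hA := wiener_nonneg (M := M) (g * star g)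
  calc _ ≤ _ := h3
    _ ≤ 2 * (2 * (gradSq M α g * wiener M g ^ 2 + wiener M g ^ 2 * gradSq M α g) * wiener M g ^ 2 +
        (wiener M g * wiener M g) ^ 2 * gradSq M α g) := by gcongr
    _ = _ := by ring

end LatticeTheory

/-! ### Step functions -/

section Step

variable (M : ℕ) [NeZero M]

/-- The step function on `𝕋` taking the value `g(x₀)` on `[x₀, x₀ + h)`. -/
def stepFun (g : ZMod (2 * M) → ℂ) (x : Torus) : ℂ :=
  g (⌊(AddCircle.equivIco (2 * π) (-π) x : ℝ) / mesh M⌋ : ℤ)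

/-- A period contains exactly `2M` cells, so any real representative may be used. This reconciles
`discretize`, which integrates over `[0, 2π)`, with `stepFun`, defined on `[-π, π)`. -/
theorem stepFun_coe (g : ZMod (2 * M) → ℂ) (y : ℝ) :
    stepFun M g (y : Torus) = g (⌊y / mesh M⌋ : ℤ) := by
  have h1 : (((AddCircle.equivIco (2 * π) (-π) (y : Torus) : ℝ) - y : ℝ) : Torus) = 0 := by
    rw [AddCircle.coe_sub, AddCircle.coe_equivIco, sub_self]
  rw [AddCircle.coe_eq_zero_iff] at h1
  obtain ⟨n, hn⟩ := h1
  have h2 : (AddCircle.equivIco (2 * π) (-π) (y : Torus) : ℝ) / mesh M =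
      y / mesh M + ((n * ((2 * M : ℕ) : ℤ) : ℤ) : ℝ) := by
    have hh := (mesh_pos M).ne'
    have h3 : (AddCircle.equivIco (2 * π) (-π) (y : Torus) : ℝ) = y + n * (2 * (mesh M * M)) := by
      rw [mesh_mul, ← zsmul_eq_mul, hn]
      ring
    rw [h3]
    push_cast
    field_simp
  rw [stepFun, h2, Int.floor_add_intCast]
  congr 1
  rw [Int.cast_add, Int.cast_mul, Int.cast_natCast, ZMod.natCast_self, mul_zero, add_zero]

theorem measurable_equivIco :
    Measurable fun x : Torus => (AddCircle.equivIco (2 * π) (-π) x : ℝ) :=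
  measurable_subtype_coe.comp (AddCircle.measurableEquivIco (2 * π) (-π)).measurable

omit [NeZero M] in
theorem measurable_stepFun (g : ZMod (2 * M) → ℂ) : Measurable (stepFun M g) := by
  have h1 : Measurable fun j : ℤ => g (j : ZMod (2 * M)) := measurable_from_top
  exact h1.comp (Int.measurable_floor.comp (measurable_equivIco.div_const _))

theorem memLp_stepFun (g : ZMod (2 * M) → ℂ) (p : ℝ≥0∞) :
    MemLp (stepFun M g) p (volume : Measure Torus) :=
  MemLp.of_bound (measurable_stepFun M g).aestronglyMeasurable ‖g‖
    (Eventually.of_forall fun _ => norm_le_pi_norm g _)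

/-- Piecewise constant interpolation, as a continuous linear map into `L²(𝕋)`. -/
def stepL : (ZMod (2 * M) → ℂ) →L[ℂ] L2T :=
  LinearMap.toContinuousLinearMap
    { toFun := fun g => (memLp_stepFun M g 2).toLp (stepFun M g)
      map_add' := fun f g => by rw [← MemLp.toLp_add]; rfl
      map_smul' := fun c f => by rw [RingHom.id_apply, ← MemLp.toLp_const_smul]; rfl }

theorem coeFn_stepL (g : ZMod (2 * M) → ℂ) : (stepL M g : Torus → ℂ) =ᵐ[volume] stepFun M g :=
  (memLp_stepFun M g 2).coeFn_toLp

theorem intervalIntegrable_coe {φ : Torus → ℂ} (hφ : Integrable φ) :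
    IntervalIntegrable (fun y : ℝ => φ y) volume 0 (2 * π) := by
  rw [intervalIntegrable_iff_integrableOn_Ioc_of_le Real.two_pi_pos.le]
  have := (AddCircle.measurePreserving_mk (2 * π) 0).integrable_comp_of_integrable hφ
  rwa [zero_add] at this

theorem sum_val_eq_sum_range {N : ℕ} [NeZero N] {A : Type*} [AddCommMonoid A] (f : ℕ → A) :
    ∑ j : ZMod N, f j.val = ∑ n ∈ Finset.range N, f n :=
  Finset.sum_nbij' (fun j => j.val) (fun n => (n : ZMod N))
    (fun j _ => Finset.mem_range.2 (ZMod.val_lt j)) (fun _ _ => Finset.mem_univ _)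
    (fun j _ => ZMod.natCast_zmod_val j)
    (fun _ hn => ZMod.val_cast_of_lt (Finset.mem_range.1 hn)) fun _ _ => rfl

/-- A step function sees only the cell averages of `φ`. This makes `discretize` the adjoint of
`stepL` and, for `φ` a character, yields the Fourier coefficients of step functions. -/
theorem integral_mul_stepFun {φ : Torus → ℂ} (hφ : Integrable φ) (g : ZMod (2 * M) → ℂ) :
    ∫ x, φ x * stepFun M g x = (mesh M : ℂ) * ∑ j, discretize M φ j * g j := by
  have hh := mesh_pos M
  have hi : Integrable fun x => φ x * stepFun M g x :=
    hφ.mul_bdd (c := ‖g‖) (measurable_stepFun M g).aestronglyMeasurable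
      (Eventually.of_forall fun _ => norm_le_pi_norm g _)
  have hI := intervalIntegrable_coe hi
  rw [← AddCircle.intervalIntegral_preimage (2 * π) 0, zero_add]
  have hend : 2 * π = mesh M * ((2 * M : ℕ) : ℝ) := by
    rw [← mesh_mul M]
    push_cast
    ring
  have hsub : ∀ n < 2 * M, IntervalIntegrable (fun y : ℝ => φ y * stepFun M g y) volume
      (mesh M * (n : ℝ)) (mesh M * ((n + 1 : ℕ) : ℝ)) := by
    intro n hn
    refine hI.mono_set ?_
    rw [Set.uIcc_of_le (by gcongr; simp), Set.uIcc_of_le Real.two_pi_pos.le, hend]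
    refine Set.Icc_subset_Icc (by positivity) ?_
    have : n + 1 ≤ 2 * M := hn
    gcongr
  have hsum := intervalIntegral.sum_integral_adjacent_intervals hsub
  rw [Nat.cast_zero, mul_zero, ← hend] at hsum
  rw [← hsum, Finset.mul_sum]
  rw [← sum_val_eq_sum_range (N := 2 * M) fun n => ∫ y in (mesh M * (n : ℝ))..(mesh M *
    ((n + 1 : ℕ) : ℝ)), φ (y : Torus) * stepFun M g (y : Torus)]
  refine Finset.sum_congr rfl fun j _ => ?_
  have hpiece : ∫ y in (mesh M * (j.val : ℝ))..(mesh M * ((j.val + 1 : ℕ) : ℝ)),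
      φ (y : Torus) * stepFun M g (y : Torus) =
      ∫ y in (mesh M * (j.val : ℝ))..(mesh M * ((j.val + 1 : ℕ) : ℝ)), φ (y : Torus) * g j := by
    refine intervalIntegral.integral_congr_Ioo_of_le (by gcongr; simp) fun y hy => ?_
    rw [stepFun_coe]
    congr 2
    have : ⌊y / mesh M⌋ = (j.val : ℤ) := by
      rw [Int.floor_eq_iff]
      have h1 := hy.1
      have h2 := hy.2
      push_cast at h2 ⊢
      rw [le_div_iff₀ hh, div_lt_iff₀ hh]
      constructor <;> linarith
    rw [this, Int.cast_natCast, ZMod.natCast_zmod_val]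
  rw [hpiece, intervalIntegral.integral_mul_const, discretize]
  have hm : (mesh M : ℂ) ≠ 0 := by exact_mod_cast hh.ne'
  push_cast
  rw [← mul_assoc, ← mul_assoc, mul_inv_cancel₀ hm, one_mul]

theorem integrable_coeFn (u : L2T) : Integrable (u : Torus → ℂ) :=
  (Lp.memLp u).integrable (by norm_num)

theorem inner_stepL (f : ZMod (2 * M) → ℂ) (u : L2T) :
    inner ℂ (stepL M f) u = (mesh M : ℂ) * ∑ j, starRingEnd ℂ (f j) * discretize M u j := by
  have h := integral_mul_stepFun M (integrable_coeFn u) (star f)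
  rw [L2.inner_def]
  calc _ = ∫ x, u x * stepFun M (star f) x := by
        refine integral_congr_ae ?_
        filter_upwards [coeFn_stepL M f] with x hx
        rw [hx, RCLike.inner_apply]
        rfl
    _ = _ := by
        rw [h]
        congr 1
        exact Finset.sum_congr rfl fun j _ => mul_comm _ _

theorem discretize_congr {φ ψ : Torus → ℂ} (h : φ =ᵐ[volume] ψ) (hφ : Integrable φ)
    (hψ : Integrable ψ) : discretize M φ = discretize M ψ := by
  have hm : (mesh M : ℂ) ≠ 0 := by exact_mod_cast (mesh_pos M).ne'
  ext j
  have h1 := integral_mul_stepFun M hφ (Pi.single j 1)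
  have h2 := integral_mul_stepFun M hψ (Pi.single j 1)
  have h3 : ∫ x, φ x * stepFun M (Pi.single j 1) x = ∫ x, ψ x * stepFun M (Pi.single j 1) x := by
    refine integral_congr_ae ?_
    filter_upwards [h] with x hx
    rw [hx]
  rw [h1, h2] at h3
  simpa [Pi.single_apply, hm] using h3

theorem discretize_stepL (g : ZMod (2 * M) → ℂ) : discretize M (stepL M g) = g := by
  have hm : (mesh M : ℂ) ≠ 0 := by exact_mod_cast (mesh_pos M).ne'
  have hh := mesh_pos M
  rw [discretize_congr M (coeFn_stepL M g) (integrable_coeFn _)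
    ((memLp_stepFun M g 1).integrable le_rfl)]
  ext j
  have hpiece : ∫ y in (mesh M * (j.val : ℝ))..(mesh M * ((j.val : ℝ) + 1)),
      stepFun M g (y : Torus) = ∫ y in (mesh M * (j.val : ℝ))..(mesh M * ((j.val : ℝ) + 1)), g j := by
    refine intervalIntegral.integral_congr_Ioo_of_le (by gcongr; simp) fun y hy => ?_
    rw [stepFun_coe]
    congr 1
    have : ⌊y / mesh M⌋ = (j.val : ℤ) := by
      rw [Int.floor_eq_iff]
      have h1 := hy.1
      have h2 := hy.2
      push_cast
      rw [le_div_iff₀ hh, div_lt_iff₀ hh]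
      constructor <;> linarith
    rw [this, Int.cast_natCast, ZMod.natCast_zmod_val]
  rw [discretize, hpiece, intervalIntegral.integral_const]
  have : mesh M * ((j.val : ℝ) + 1) - mesh M * (j.val : ℝ) = mesh M := by ring
  rw [this, Complex.real_smul, inv_mul_cancel_left₀ hm]

theorem norm_stepL_sq (g : ZMod (2 * M) → ℂ) : ‖stepL M g‖ ^ 2 = mass M g := by
  have h := inner_stepL M g (stepL M g)
  rw [discretize_stepL, inner_self_eq_norm_sq_to_K] at h
  simp only [Complex.conj_mul'] at h
  have h' : ((‖stepL M g‖ ^ 2 : ℝ) : ℂ) = ((mass M g : ℝ) : ℂ) := by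
    rw [mass]
    push_cast
    exact h
  exact Complex.ofReal_injective h'

/-- `stepL ∘ discretize` is an orthogonal projection, so the cell averages may be replaced in
estimates by any convenient lattice function. -/
theorem norm_sub_stepL_discretize_le (u : L2T) (g : ZMod (2 * M) → ℂ) :
    ‖u - stepL M (discretize M u)‖ ≤ ‖u - stepL M g‖ := by
  set d := discretize M u with hd
  have h1 : inner ℂ (u - stepL M d) (stepL M (d - g)) = 0 := by
    rw [← inner_conj_symm, inner_sub_right, inner_stepL, inner_stepL, discretize_stepL, hd,
      sub_self, map_zero]
  have h2 : u - stepL M g = (u - stepL M d) + stepL M (d - g) := by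
    rw [map_sub]
    abel
  rw [h2, ← sq_le_sq₀ (norm_nonneg _) (norm_nonneg _), sq, sq,
    norm_add_sq_eq_norm_sq_add_norm_sq_of_inner_eq_zero _ _ h1]
  nlinarith [norm_nonneg (stepL M (d - g))]

theorem mass_discretize_le (u : L2T) : mass M (discretize M u) ≤ ‖u‖ ^ 2 := by
  have h := inner_stepL M (discretize M u) u
  simp only [Complex.conj_mul'] at h
  have h1 : ((mass M (discretize M u) : ℝ) : ℂ) = inner ℂ (stepL M (discretize M u)) u := by
    rw [h, mass]
    push_cast
    rfl
  have h2 : mass M (discretize M u) ≤ ‖stepL M (discretize M u)‖ * ‖u‖ := by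
    have := norm_inner_le_norm (𝕜 := ℂ) (stepL M (discretize M u)) u
    rwa [← h1, Complex.norm_real, Real.norm_of_nonneg (mass_nonneg _ _)] at this
  rw [← norm_stepL_sq] at h2 ⊢
  have h3 : ‖stepL M (discretize M u)‖ ≤ ‖u‖ := by
    by_contra! hlt
    nlinarith [norm_nonneg u]
  gcongr

/-! ### Fourier coefficients of step functions -/

/-- The averages `h⁻¹ ∫₀ʰ e^{-iky} dy`. -/
def cellCoeff (k : ℤ) : ℂ :=
  (mesh M : ℂ)⁻¹ * ∫ y in (0 : ℝ)..mesh M, Complex.exp (Complex.I * ((-(k * y) : ℝ) : ℂ))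

/-- The product of the bounds `|x|` and 2. A single power of `x = h k` is what `|k| ≤ |k|^α` can
absorb. -/
theorem norm_exp_sub_one_sq_le (x : ℝ) : ‖Complex.exp (Complex.I * (x : ℂ)) - 1‖ ^ 2 ≤ 2 * |x| := by
  have h1 : ‖Complex.exp (Complex.I * (x : ℂ)) - 1‖ ≤ |x| := Real.norm_exp_I_mul_ofReal_sub_one_le
  have h2 : ‖Complex.exp (Complex.I * (x : ℂ)) - 1‖ ≤ 2 := by
    refine (norm_sub_le _ _).trans ?_
    rw [Complex.norm_exp]
    norm_num
  nlinarith [norm_nonneg (Complex.exp (Complex.I * (x : ℂ)) - 1)]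

theorem norm_cellCoeff_le (k : ℤ) : ‖cellCoeff M k‖ ≤ 1 := by
  have hh := mesh_pos M
  have h := intervalIntegral.norm_integral_le_of_norm_le_const (a := 0) (b := mesh M)
    (f := fun y : ℝ => Complex.exp (Complex.I * ((-(k * y) : ℝ) : ℂ))) (C := 1) fun y _ => by
      rw [Complex.norm_exp]
      simp
  rw [cellCoeff, norm_mul, norm_inv, Complex.norm_real, Real.norm_of_nonneg hh.le,
    inv_mul_le_iff₀ hh]
  rwa [sub_zero, abs_of_pos hh, mul_comm] at h

theorem norm_cellCoeff_sub_one_le (k : ℤ) : ‖cellCoeff M k - 1‖ ≤ mesh M * |(k : ℝ)| := by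
  have hh := mesh_pos M
  have hm : (mesh M : ℂ) ≠ 0 := by exact_mod_cast hh.ne'
  have e : cellCoeff M k - 1 = (mesh M : ℂ)⁻¹ *
      ∫ y in (0 : ℝ)..mesh M, (Complex.exp (Complex.I * ((-(k * y) : ℝ) : ℂ)) - 1) := by
    rw [intervalIntegral.integral_sub (by apply Continuous.intervalIntegrable; fun_prop)
      (by simp), intervalIntegral.integral_const, sub_zero, Complex.real_smul, mul_one, mul_sub,
      inv_mul_cancel₀ hm, cellCoeff]
  have h := intervalIntegral.norm_integral_le_of_norm_le_const (a := 0) (b := mesh M)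
    (f := fun y : ℝ => Complex.exp (Complex.I * ((-(k * y) : ℝ) : ℂ)) - 1)
    (C := mesh M * |(k : ℝ)|) fun y hy => by
      rw [Set.uIoc_of_le hh.le] at hy
      refine Real.norm_exp_I_mul_ofReal_sub_one_le.trans ?_
      rw [Real.norm_eq_abs, abs_neg, abs_mul, mul_comm, abs_of_pos hy.1]
      gcongr
      exact hy.2
  rw [e, norm_mul, norm_inv, Complex.norm_real, Real.norm_of_nonneg hh.le, inv_mul_le_iff₀ hh]
  rwa [sub_zero, abs_of_pos hh, mul_comm] at h

theorem fourier_coe (k : ℤ) (y : ℝ) :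
    (fourier k : C(Torus, ℂ)) (y : Torus) = Complex.exp (Complex.I * ((k * y : ℝ) : ℂ)) := by
  rw [fourier_coe_apply]
  congr 1
  have := two_pi_ne_zero
  push_cast
  field_simp

theorem stdAddChar_intCast (n : ℤ) :
    (ZMod.stdAddChar (n : ZMod (2 * M)) : ℂ) =
      Complex.exp (Complex.I * ((mesh M * n : ℝ) : ℂ)) := by
  rw [ZMod.stdAddChar_coe]
  congr 1
  have h3 : (M : ℂ) ≠ 0 := by exact_mod_cast NeZero.ne M
  rw [mesh]
  push_cast
  field_simp

/-- Each cell is a translate of `[0, h)`, and the translations assemble into the lattice transform.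
That factor is `2M`-periodic in `k` (aliasing); `cellCoeff` supplies the decay. -/
theorem fourierT_stepL (g : ZMod (2 * M) → ℂ) (k : ℤ) :
    fourierT (stepL M g) k = cellCoeff M k * latticeFourier M g k := by
  have h := integral_mul_stepFun M (φ := fun x => (fourier (-k) : C(Torus, ℂ)) x)
    ((fourier (-k)).continuous.integrable_of_hasCompactSupport
      (HasCompactSupport.of_compactSpace _)) g
  rw [fourierT_congr (coeFn_stepL M g), fourierT_eq_integral, h, latticeFourier, mul_left_comm,
    Finset.mul_sum (a := cellCoeff M k)]
  congr 1
  refine Finset.sum_congr rfl fun j _ => ?_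
  have e : discretize M (fun x => (fourier (-k) : C(Torus, ℂ)) x) j =
      ZMod.stdAddChar (-(j * (k : ZMod (2 * M)))) * cellCoeff M k := by
    have hj : -(j * (k : ZMod (2 * M))) = ((-((j.val : ℤ) * k) : ℤ) : ZMod (2 * M)) := by
      push_cast
      rw [ZMod.natCast_zmod_val]
    rw [hj, stdAddChar_intCast, discretize, cellCoeff, mul_left_comm]
    congr 1
    rw [← intervalIntegral.integral_const_mul]
    have hs := intervalIntegral.integral_comp_add_left (a := 0) (b := mesh M)
      (fun y : ℝ => (fourier (-k) : C(Torus, ℂ)) (y : Torus)) (mesh M * (j.val : ℝ))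
    rw [add_zero] at hs
    rw [mul_add, mul_one, ← hs]
    refine intervalIntegral.integral_congr fun y _ => ?_
    rw [fourier_coe, ← Complex.exp_add]
    congr 1
    push_cast
    ring
  rw [e]
  ring

end Step

/-! ### Approximation by step functions in Fourier variables -/

section Approximation

variable {M : ℕ} [NeZero M] {α : ℝ}

/-- The homogeneous Sobolev seminorm squared, `(2π)⁻¹ ∑ₖ |k|^α |f̂(k)|²`. -/
def gradT (α : ℝ) (f : L2T) : ℝ := (2 * π)⁻¹ * ∑' k : ℤ, |(k : ℝ)| ^ α * ‖fourierT f k‖ ^ 2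

theorem gradT_nonneg (f : L2T) : 0 ≤ gradT α f :=
  mul_nonneg (by positivity) (tsum_nonneg fun _ => by positivity)

variable (M) in
/-- The representatives of the lattice frequencies. -/
def freqs : Finset ℤ := Finset.univ.image fun k : ZMod (2 * M) => k.valMinAbs

theorem sum_freqs (a : ℤ → ℝ) : ∑ k ∈ freqs M, a k = ∑ k : ZMod (2 * M), a k.valMinAbs :=
  Finset.sum_image fun _ _ _ _ h => ZMod.injective_valMinAbs h

theorem le_abs_of_notMem_freqs {k : ℤ} (hk : k ∉ freqs M) : (M : ℝ) ≤ |(k : ℝ)| := by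
  by_contra! h
  have h1 : |k| < (M : ℤ) := by exact_mod_cast h
  rw [abs_lt] at h1
  refine hk (Finset.mem_image.2 ⟨(k : ZMod (2 * M)), Finset.mem_univ _, ?_⟩)
  rw [ZMod.valMinAbs_spec]
  refine ⟨rfl, ?_, ?_⟩ <;> push_cast <;> omega

theorem tsum_eq_sum_add_tail {a : ℤ → ℝ} (ha : Summable a) :
    ∑' k, a k = ∑ k : ZMod (2 * M), a k.valMinAbs + ∑' k, if k ∈ freqs M then 0 else a k := by
  rw [← sum_freqs]
  have h1 : HasSum (fun k => if k ∈ freqs M then a k else 0) (∑ k ∈ freqs M, a k) := by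
    have : HasSum (fun k => if k ∈ freqs M then a k else 0)
        (∑ k ∈ freqs M, if k ∈ freqs M then a k else 0) :=
      hasSum_sum_of_ne_finset_zero fun k hk => if_neg hk
    rwa [Finset.sum_congr rfl fun k hk => if_pos hk] at this
  have h2 := ha.hasSum.sub h1
  have e : (fun k => a k - if k ∈ freqs M then a k else 0) =
      fun k => if k ∈ freqs M then 0 else a k := by
    ext k
    split_ifs <;> simp
  rw [e] at h2
  rw [h2.tsum_eq]
  ring

theorem summable_tail {a : ℤ → ℝ} (ha : Summable a) :
    Summable fun k => if k ∈ freqs M then 0 else a k := by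
  refine ha.abs.of_norm_bounded fun k => ?_
  split_ifs
  · simp
  · exact le_rfl

theorem norm_sq_le_of_split {f : L2T} {P : ZMod (2 * M) → ℝ} {Q : ℤ → ℝ} (hQ : Summable Q)
    (h1 : ∀ k : ZMod (2 * M), ‖fourierT f k.valMinAbs‖ ^ 2 ≤ P k)
    (h2 : ∀ k ∉ freqs M, ‖fourierT f k‖ ^ 2 ≤ Q k) :
    ‖f‖ ^ 2 ≤ (2 * π)⁻¹ * (∑ k, P k + ∑' k, if k ∈ freqs M then 0 else Q k) := by
  have hs := (hasSum_norm_fourierT_sq f).summable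
  rw [norm_sq_eq_tsum, tsum_eq_sum_add_tail (M := M) hs]
  refine mul_le_mul_of_nonneg_left (add_le_add (Finset.sum_le_sum fun k _ => h1 k) ?_)
    (by positivity)
  refine (summable_tail hs).tsum_le_tsum (fun k => ?_) (summable_tail hQ)
  split_ifs with hk
  · exact le_rfl
  · exact h2 k hk

theorem abs_intCast_le_rpow (hα : 1 ≤ α) (k : ℤ) : |(k : ℝ)| ≤ |(k : ℝ)| ^ α := by
  rcases eq_or_ne k 0 with rfl | hk
  · simp only [Int.cast_zero, abs_zero]
    positivity
  · have : (1 : ℝ) ≤ |(k : ℝ)| := by exact_mod_cast Int.one_le_abs hk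
    exact Real.self_le_rpow_of_one_le this hα

theorem gradSq_sum (g : ZMod (2 * M) → ℂ) :
    ∑ k : ZMod (2 * M), |(k.valMinAbs : ℝ)| ^ α * ‖latticeFourier M g k‖ ^ 2 =
      2 * π * gradSq M α g := by
  rw [gradSq, mul_inv_cancel_left₀ Real.two_pi_pos.ne']

theorem fourierT_stepL_valMinAbs (g : ZMod (2 * M) → ℂ) (k : ZMod (2 * M)) :
    fourierT (stepL M g) k.valMinAbs = cellCoeff M k.valMinAbs * latticeFourier M g k := by
  rw [fourierT_stepL, ZMod.coe_valMinAbs]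

/-- The high frequencies of a step function. -/
theorem tail_stepL_le (hα : 1 ≤ α) (g : ZMod (2 * M) → ℂ) :
    ∑' k : ℤ, (if k ∈ freqs M then 0 else ‖fourierT (stepL M g) k‖ ^ 2) ≤
      2 * mesh M * (2 * π * gradSq M α g) := by
  have hh := mesh_pos M
  -- As `stepL` is an isometry, the tail equals the low-frequency defect `∑ (1 - |c_k|²)|ĝ(k)|²`
  -- with `c_k` the `cellCoeff`, so no aliases have to be summed; and `1 - |c_k|² ≤ 2|c_k - 1| ≤
  -- 2h|k|`.
  have h1 := tsum_eq_sum_add_tail (M := M) (hasSum_norm_fourierT_sq (stepL M g)).summable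
  rw [(hasSum_norm_fourierT_sq (stepL M g)).tsum_eq, norm_stepL_sq, mass_eq,
    mul_inv_cancel_left₀ Real.two_pi_pos.ne'] at h1
  rw [← gradSq_sum, Finset.mul_sum (a := 2 * mesh M), ← sub_nonneg]
  have h2 : 0 ≤ ∑ k : ZMod (2 * M), (2 * mesh M * (|(k.valMinAbs : ℝ)| ^ α *
      ‖latticeFourier M g k‖ ^ 2) - (‖latticeFourier M g k‖ ^ 2 -
        ‖fourierT (stepL M g) k.valMinAbs‖ ^ 2)) := by
    refine Finset.sum_nonneg fun k _ => ?_
    rw [fourierT_stepL_valMinAbs, norm_mul, mul_pow]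
    have hc := norm_cellCoeff_le M k.valMinAbs
    have hc1 := norm_cellCoeff_sub_one_le M k.valMinAbs
    have hc2 : 1 ≤ ‖cellCoeff M k.valMinAbs‖ + ‖cellCoeff M k.valMinAbs - 1‖ := by
      have := norm_sub_le (cellCoeff M k.valMinAbs) (cellCoeff M k.valMinAbs - 1)
      rwa [sub_sub_cancel, norm_one] at this
    have hk : mesh M * |(k.valMinAbs : ℝ)| ≤ mesh M * |(k.valMinAbs : ℝ)| ^ α := by
      gcongr
      exact abs_intCast_le_rpow hα _
    have h3 : 0 ≤ 2 * (mesh M * |(k.valMinAbs : ℝ)| ^ α) - (1 - ‖cellCoeff M k.valMinAbs‖ ^ 2) := by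
      nlinarith [norm_nonneg (cellCoeff M k.valMinAbs)]
    have h4 := mul_nonneg h3 (sq_nonneg ‖latticeFourier M g k‖)
    linarith
  rw [Finset.sum_sub_distrib, Finset.sum_sub_distrib] at h2
  linarith

/-- By best approximation one good competitor suffices: the step function whose lattice transform
copies `û` on the representatives. Low frequencies cost `2h`, the tails of the step function and of
`u` cost `4h` and `2h`. -/
theorem norm_sub_stepL_discretize_sq_le (hα : 1 ≤ α) {u : L2T}
    (hu : Summable fun k : ℤ => |(k : ℝ)| ^ α * ‖fourierT u k‖ ^ 2) :
    ‖u - stepL M (discretize M u)‖ ^ 2 ≤ 8 * mesh M * gradT α u := by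
  have hh := mesh_pos M
  set g : ZMod (2 * M) → ℂ := latticeFourierInv M fun k => fourierT u k.valMinAbs with hg
  have hgF : ∀ k, latticeFourier M g k = fourierT u k.valMinAbs := fun k => by
    rw [hg, latticeFourier_latticeFourierInv]
  have hgN : gradSq M α g ≤ gradT α u := by
    rw [gradSq, gradT]
    refine mul_le_mul_of_nonneg_left ?_ (by positivity)
    simp only [hgF]
    rw [← sum_freqs fun k : ℤ => |(k : ℝ)| ^ α * ‖fourierT u k‖ ^ 2]
    exact hu.sum_le_tsum _ fun _ _ => by positivity
  have hQ1 := (hasSum_norm_fourierT_sq (stepL M g)).summable.mul_left 2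
  have hQ2 := hu.mul_left (2 * mesh M)
  refine (pow_le_pow_left₀ (norm_nonneg _) (norm_sub_stepL_discretize_le M u g) 2).trans ?_
  have h := norm_sq_le_of_split (M := M) (f := u - stepL M g)
    (P := fun k => 2 * mesh M * (|(k.valMinAbs : ℝ)| ^ α * ‖latticeFourier M g k‖ ^ 2))
    (hQ1.add hQ2) (fun k => ?_) (fun k hk => ?_)
  · refine h.trans ?_
    have e : ∀ k : ℤ, (if k ∈ freqs M then 0 else 2 * ‖fourierT (stepL M g) k‖ ^ 2 +
        2 * mesh M * (|(k : ℝ)| ^ α * ‖fourierT u k‖ ^ 2)) =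
        2 * (if k ∈ freqs M then 0 else ‖fourierT (stepL M g) k‖ ^ 2) +
        2 * mesh M * (if k ∈ freqs M then 0 else |(k : ℝ)| ^ α * ‖fourierT u k‖ ^ 2) := by
      intro k
      split_ifs <;> simp
    have ht := tail_stepL_le hα g
    have ht2 : ∑' k : ℤ, (if k ∈ freqs M then 0 else |(k : ℝ)| ^ α * ‖fourierT u k‖ ^ 2) ≤
        2 * π * gradT α u := by
      rw [gradT, mul_inv_cancel_left₀ Real.two_pi_pos.ne', tsum_eq_sum_add_tail (M := M) hu]
      exact le_add_of_nonneg_left (Finset.sum_nonneg fun _ _ => by positivity)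
    rw [tsum_congr e, Summable.tsum_add
      ((summable_tail (hasSum_norm_fourierT_sq (stepL M g)).summable).mul_left _)
      ((summable_tail hu).mul_left _), tsum_mul_left, tsum_mul_left, ← Finset.mul_sum, gradSq_sum,
      inv_mul_le_iff₀ Real.two_pi_pos]
    have h5 : mesh M * (2 * π * gradSq M α g) ≤ mesh M * (2 * π * gradT α u) := by
      gcongr
    have h6 := mul_le_mul_of_nonneg_left ht2 hh.le
    linarith
  · rw [fourierT_sub, fourierT_stepL_valMinAbs, hgF]
    have e : fourierT u k.valMinAbs - cellCoeff M k.valMinAbs * fourierT u k.valMinAbs =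
        -(cellCoeff M k.valMinAbs - 1) * fourierT u k.valMinAbs := by ring
    rw [e, norm_mul, norm_neg, mul_pow, ← mul_assoc]
    refine mul_le_mul_of_nonneg_right ?_ (sq_nonneg _)
    have hc := norm_cellCoeff_le M k.valMinAbs
    have hc1 := norm_cellCoeff_sub_one_le M k.valMinAbs
    have hc2 : ‖cellCoeff M k.valMinAbs - 1‖ ≤ 2 := by
      have := norm_sub_le (cellCoeff M k.valMinAbs) 1
      rw [norm_one] at this
      linarith
    have hk : mesh M * |(k.valMinAbs : ℝ)| ≤ mesh M * |(k.valMinAbs : ℝ)| ^ α := by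
      gcongr
      exact abs_intCast_le_rpow hα _
    nlinarith [norm_nonneg (cellCoeff M k.valMinAbs - 1)]
  · rw [fourierT_sub]
    have h1 : ‖fourierT u k - fourierT (stepL M g) k‖ ^ 2 ≤
        2 * ‖fourierT (stepL M g) k‖ ^ 2 + 2 * ‖fourierT u k‖ ^ 2 := by
      have := norm_sub_le (fourierT u k) (fourierT (stepL M g) k)
      nlinarith [norm_nonneg (fourierT u k - fourierT (stepL M g) k),
        sq_nonneg (‖fourierT u k‖ - ‖fourierT (stepL M g) k‖)]
    -- Outside `freqs M` one has `|k| ≥ M`, hence `h |k|^α ≥ h M = π`.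
    have h2 : 1 ≤ mesh M * |(k : ℝ)| ^ α := by
      have h3 := (le_abs_of_notMem_freqs hk).trans (abs_intCast_le_rpow hα k)
      have h4 := mul_le_mul_of_nonneg_left h3 hh.le
      rw [mesh_mul] at h4
      linarith [Real.pi_gt_three]
    have h5 := mul_le_mul_of_nonneg_right h2 (sq_nonneg ‖fourierT u k‖)
    linarith

/-! ### Energy of the discretization -/

theorem hasSum_inner_fourierT (f g : L2T) :
    HasSum (fun k : ℤ => (2 * π : ℂ)⁻¹ * (starRingEnd ℂ (fourierT f k) * fourierT g k))
      (inner ℂ f g) := by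
  have h := (innerSL ℂ f).hasSum (hasSum_fourier_series g)
  have e : (fun k : ℤ => (2 * π : ℂ)⁻¹ * (starRingEnd ℂ (fourierT f k) * fourierT g k)) =
      fun k : ℤ => innerSL ℂ f (((2 * π : ℂ)⁻¹ * fourierT g k) • mode k) := by
    ext k
    rw [innerSL_apply_apply, inner_smul_right, ← inner_conj_symm, ← fourierT_eq_inner]
    ring
  rw [e]
  exact h

/-- The kinetic energy of `d` is the inner product of `u` with the step function of transform `σ
d̂`. Giving one factor `√σ` to each side, with `σ ≤ |k|^α` at every integer frequency, and using `ab
≤ (a² + b²)/2` bounds it by half of itself plus half of `gradT α u`. -/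
theorem kinetic_discretize_le (hα : 0 ≤ α) {u : L2T}
    (hu : Summable fun k : ℤ => |(k : ℝ)| ^ α * ‖fourierT u k‖ ^ 2) :
    kinetic M α (discretize M u) ≤ gradT α u := by
  set d := discretize M u with hd
  set D := latticeFourier M d with hD
  set σ := latticeSymbol M α with hσ
  have hσ0 : ∀ k, 0 ≤ σ k := latticeSymbol_nonneg
  set g := latticeFourierInv M fun k => (σ k : ℂ) * D k with hg
  set w := latticeFourierInv M fun k => ((√(σ k) : ℝ) : ℂ) * D k with hw
  have hgF : ∀ k, latticeFourier M g k = (σ k : ℂ) * D k := fun k => by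
    rw [hg, latticeFourier_latticeFourierInv]
  have hwF : ∀ k, latticeFourier M w k = ((√(σ k) : ℝ) : ℂ) * D k := fun k => by
    rw [hw, latticeFourier_latticeFourierInv]
  have hwm : ‖stepL M w‖ ^ 2 = kinetic M α d := by
    rw [norm_stepL_sq, mass_eq, kinetic]
    congr 1
    refine Finset.sum_congr rfl fun k _ => ?_
    rw [hwF, norm_mul, mul_pow, Complex.norm_real, Real.norm_of_nonneg (Real.sqrt_nonneg _),
      Real.sq_sqrt (hσ0 k)]
  have h1 : inner ℂ (stepL M g) u = ((kinetic M α d : ℝ) : ℂ) := by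
    rw [inner_stepL, ← hd]
    have h2 := lattice_parseval M d g
    rw [Finset.sum_congr rfl fun j _ => mul_comm _ _] at h2
    rw [h2, kinetic]
    push_cast
    congr 1
    refine Finset.sum_congr rfl fun k _ => ?_
    rw [hgF, map_mul, Complex.conj_ofReal, mul_left_comm, Complex.mul_conj']
  have h3 := hasSum_inner_fourierT (stepL M g) u
  rw [h1] at h3
  have hs1 := (hasSum_norm_fourierT_sq (stepL M w)).summable
  have hbound : ∀ k : ℤ, ‖(2 * π : ℂ)⁻¹ * (starRingEnd ℂ (fourierT (stepL M g) k) * fourierT u k)‖ ≤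
      (2 * π)⁻¹ * (1 / 2 * ‖fourierT (stepL M w) k‖ ^ 2 +
        1 / 2 * (|(k : ℝ)| ^ α * ‖fourierT u k‖ ^ 2)) := by
    intro k
    have h : ‖(2 * π : ℂ)⁻¹‖ = (2 * π)⁻¹ := by
      rw [norm_inv, norm_mul, Complex.norm_real, Real.norm_of_nonneg Real.pi_pos.le]
      simp
    rw [norm_mul, h, norm_mul, RCLike.norm_conj]
    refine mul_le_mul_of_nonneg_left ?_ (by positivity)
    have h4 : ‖fourierT (stepL M g) k‖ = √(σ k) * ‖fourierT (stepL M w) k‖ := by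
      rw [fourierT_stepL, fourierT_stepL, hgF, hwF]
      simp only [norm_mul, Complex.norm_real]
      rw [Real.norm_of_nonneg (hσ0 _), Real.norm_of_nonneg (Real.sqrt_nonneg _)]
      have := Real.mul_self_sqrt (hσ0 (k : ZMod (2 * M)))
      linear_combination (-‖cellCoeff M k‖ * ‖D k‖) * this
    have h5 : σ k * ‖fourierT u k‖ ^ 2 ≤ |(k : ℝ)| ^ α * ‖fourierT u k‖ ^ 2 := by
      gcongr
      exact latticeSymbol_intCast_le hα k
    have h6 := Real.sq_sqrt (hσ0 (k : ZMod (2 * M)))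
    rw [h4]
    nlinarith [sq_nonneg (‖fourierT (stepL M w) k‖ - √(σ k) * ‖fourierT u k‖)]
  have h7 := tsum_of_norm_bounded
    (((hs1.hasSum.mul_left (1 / 2)).add (hu.hasSum.mul_left (1 / 2))).mul_left ((2 * π)⁻¹)) hbound
  rw [h3.tsum_eq, mul_add, mul_left_comm, ← norm_sq_eq_tsum, hwm, mul_left_comm, Complex.norm_real]
    at h7
  have h8 := (le_abs_self _).trans h7
  rw [gradT]
  linarith

/-! ### Comparison of the two unitary groups -/

theorem mul_cos_le_sin {y : ℝ} (h0 : 0 ≤ y) (h1 : y ≤ π / 2) : y * Real.cos y ≤ Real.sin y := by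
  rcases h1.lt_or_eq with h | rfl
  · have hc := Real.cos_pos_of_mem_Ioo ⟨by linarith [Real.pi_pos], h⟩
    have := Real.le_tan h0 h
    rwa [Real.tan_eq_sin_div_cos, le_div_iff₀ hc] at this
  · simp

/-- `sin² y ≥ y² cos² y = y² (1 - sin² y) ≥ y² (1 - y²)`. -/
theorem sq_sub_pow_four_le_sin_sq {y : ℝ} (h : |y| ≤ π / 2) :
    |y| ^ 2 * (1 - y ^ 2) ≤ |Real.sin y| ^ 2 := by
  have h1 := mul_cos_le_sin (abs_nonneg y) h
  have hc : 0 ≤ Real.cos |y| :=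
    Real.cos_nonneg_of_mem_Icc ⟨by linarith [abs_nonneg y, Real.pi_pos], h⟩
  have h2 := pow_le_pow_left₀ (mul_nonneg (abs_nonneg y) hc) h1 2
  have h3 : Real.sin |y| ^ 2 = |Real.sin y| ^ 2 := by
    rw [sq_abs]
    rcases abs_choice y with h | h <;> (rw [h]; try simp)
  have h4 : Real.sin |y| ^ 2 ≤ y ^ 2 := by
    rw [h3, sq_abs]
    exact Real.sin_sq_le_sq
  have h5 := Real.sin_sq_add_cos_sq |y|
  rw [h3, mul_pow] at h2
  refine le_trans ?_ h2
  gcongr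
  linarith

/-- With `y = h k / 2` and `x = |sin y| / |y| ≤ 1` the symbol is `|k|^α x^α`, and `α ≤ 2` gives `1 -
x^α ≤ 1 - x² ≤ y²`. -/
theorem abs_symbol_sub_le (hα : 0 ≤ α) (hα₂ : α ≤ 2) (k : ZMod (2 * M)) :
    |latticeSymbol M α k - |(k.valMinAbs : ℝ)| ^ α| ≤
      mesh M ^ 2 * |(k.valMinAbs : ℝ)| ^ (α + 2) := by
  have hh := mesh_pos M
  have hle : latticeSymbol M α k ≤ |(k.valMinAbs : ℝ)| ^ α := by
    simpa using latticeSymbol_intCast_le (M := M) hα k.valMinAbs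
  have hk := abs_mesh_mul_valMinAbs_le k
  rw [abs_sub_comm, abs_of_nonneg (sub_nonneg.2 hle)]
  set n : ℝ := (k.valMinAbs : ℝ) with hn
  rcases eq_or_ne n 0 with h0 | h0
  · rw [latticeSymbol, ← hn, h0]
    simp only [abs_zero, mul_zero, zero_div, Real.sin_zero, sub_self]
    positivity
  have hn0 : 0 < |n| := abs_pos.2 h0
  set y := mesh M * n / 2 with hy
  have hya : |y| = mesh M * |n| / 2 := by
    rw [hy, abs_div, abs_mul, abs_of_pos hh, abs_of_pos (by norm_num : (0 : ℝ) < 2)]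
  have hy0 : 0 < |y| := by rw [hya]; positivity
  have hyp : |y| ≤ π / 2 := by rw [hya]; linarith
  set x := |Real.sin y| / |y| with hx
  have hx0 : 0 < x := by
    have h1 := Real.mul_abs_le_abs_sin hyp
    have : 0 < |Real.sin y| := lt_of_lt_of_le (by positivity) h1
    positivity
  have hx1 : x ≤ 1 := by
    rw [hx, div_le_one hy0]
    exact Real.abs_sin_le_abs
  have hσ : latticeSymbol M α k = |n| ^ α * x ^ α := by
    rw [latticeSymbol, ← Real.mul_rpow (abs_nonneg _) hx0.le]
    congr 1
    rw [abs_mul, abs_of_pos (by positivity : 0 < 2 / mesh M), hx, hya]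
    field_simp
    rfl
  have hx2 : 1 - y ^ 2 ≤ x ^ α := by
    have h1 : x ^ (2 : ℝ) ≤ x ^ α := Real.rpow_le_rpow_of_exponent_ge hx0 hx1 hα₂
    rw [Real.rpow_two] at h1
    refine le_trans ?_ h1
    rw [hx, div_pow |Real.sin y|, le_div_iff₀ (by positivity), mul_comm]
    exact sq_sub_pow_four_le_sin_sq hyp
  have hn2 : |n| ^ (α + 2) = |n| ^ α * n ^ 2 := by
    rw [Real.rpow_add hn0, Real.rpow_two, sq_abs]
  rw [hσ, hn2]
  have hna : 0 ≤ |n| ^ α := by positivity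
  have h2 : |n| ^ α * (1 - x ^ α) ≤ |n| ^ α * (mesh M ^ 2 * n ^ 2) := by
    gcongr
    have : y ^ 2 = mesh M ^ 2 * n ^ 2 / 4 := by rw [hy]; ring
    nlinarith [sq_nonneg (mesh M * n)]
  linarith

theorem norm_exp_sub_exp_le (a b : ℝ) :
    ‖Complex.exp (-Complex.I * (a : ℂ)) - Complex.exp (-Complex.I * (b : ℂ))‖ ≤ |a - b| := by
  have e : Complex.exp (-Complex.I * (a : ℂ)) - Complex.exp (-Complex.I * (b : ℂ)) =
      Complex.exp (-Complex.I * (b : ℂ)) * (Complex.exp (Complex.I * ((b - a : ℝ) : ℂ)) - 1) := by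
    rw [mul_sub, ← Complex.exp_add, mul_one]
    congr 2
    push_cast
    ring
  rw [e, norm_mul, norm_exp_neg_I_mul, one_mul, abs_sub_comm]
  exact Real.norm_exp_I_mul_ofReal_sub_one_le

/-- The origin of the rate. With `a = |t| h² |k|^(α+2)` the difference is at most `min a 2 ≤ 2 a^θ`.
The exponent `θ = α/(2(2+α))` is chosen so that `(α+2)θ = α/2`, the regularity controlled by the
energy; this leaves `h^(2θ) = h^(α/(2+α))`. -/
theorem norm_phase_sub_le (hα : 0 ≤ α) (hα₂ : α ≤ 2) (t : ℝ) (k : ZMod (2 * M)) :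
    ‖latticePhase M α t k - phase α t k.valMinAbs‖ ≤
      2 * (1 + |t|) * mesh M ^ (α / (2 + α)) * |(k.valMinAbs : ℝ)| ^ (α / 2) := by
  have hh := mesh_pos M
  set n : ℝ := |(k.valMinAbs : ℝ)| with hn
  have hn0 : 0 ≤ n := abs_nonneg _
  set θ : ℝ := α / (2 * (2 + α)) with hθ
  have hθ0 : 0 ≤ θ := by positivity
  have hθ1 : θ ≤ 1 := by
    rw [hθ, div_le_one (by positivity)]
    linarith
  set a : ℝ := |t| * (mesh M ^ 2 * n ^ (α + 2)) with ha
  have ha0 : 0 ≤ a := by positivity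
  have h1 : ‖latticePhase M α t k - phase α t k.valMinAbs‖ ≤ a := by
    refine (norm_exp_sub_exp_le _ _).trans ?_
    rw [← mul_sub, abs_mul]
    exact mul_le_mul_of_nonneg_left (abs_symbol_sub_le hα hα₂ k) (abs_nonneg t)
  have h2 : ‖latticePhase M α t k - phase α t k.valMinAbs‖ ≤ 2 := by
    refine (norm_sub_le _ _).trans ?_
    rw [norm_latticePhase, norm_phase]
    norm_num
  have h3 : ‖latticePhase M α t k - phase α t k.valMinAbs‖ ≤ 2 * a ^ θ := by
    rcases le_total 1 a with h | h
    · have := Real.one_le_rpow h hθ0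
      linarith
    · have : a ≤ a ^ θ := by
        rcases ha0.eq_or_lt with h0 | h0
        · rw [← h0]
          positivity
        · simpa using Real.rpow_le_rpow_of_exponent_ge h0 h hθ1
      have : 0 ≤ a ^ θ := by positivity
      linarith
  have h4 : a ^ θ ≤ (1 + |t|) * (mesh M ^ (α / (2 + α)) * n ^ (α / 2)) := by
    rw [ha, Real.mul_rpow (abs_nonneg _) (by positivity), Real.mul_rpow (by positivity)
      (by positivity), ← Real.rpow_natCast, ← Real.rpow_mul hh.le, ← Real.rpow_mul hn0]
    have e1 : ((2 : ℕ) : ℝ) * θ = α / (2 + α) := by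
      rw [hθ]
      push_cast
      field_simp
    have e2 : (α + 2) * θ = α / 2 := by
      rw [hθ]
      field_simp
      ring
    rw [e1, e2]
    gcongr
    calc |t| ^ θ ≤ (1 + |t|) ^ θ := by gcongr; linarith
      _ ≤ (1 + |t|) ^ (1 : ℝ) :=
        Real.rpow_le_rpow_of_exponent_le (by linarith [abs_nonneg t]) hθ1
      _ = _ := Real.rpow_one _
  linarith

/-- `h = h^(1-2γ) (h^γ)²`, where `γ ≤ 1/2` because `α ≤ 2`, and `h ≤ π ≤ 4`. It absorbs all `O(√h)`
errors into the rate. -/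
theorem mesh_le_rpow (hα : 0 ≤ α) (hα₂ : α ≤ 2) : mesh M ≤ 4 * (mesh M ^ (α / (2 + α))) ^ 2 := by
  have hh := mesh_pos M
  have hγ : α / (2 + α) ≤ 1 / 2 := by
    rw [div_le_div_iff₀ (by linarith) (by norm_num)]
    linarith
  have hγ0 : 0 ≤ α / (2 + α) := by positivity
  set γ := α / (2 + α) with hγd
  have e : mesh M = mesh M ^ (1 - 2 * γ) * (mesh M ^ γ) ^ 2 := by
    rw [← Real.rpow_natCast, ← Real.rpow_mul hh.le, ← Real.rpow_add hh]
    conv_lhs => rw [← Real.rpow_one (mesh M)]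
    congr 1
    push_cast
    ring
  have h1 : mesh M ^ (1 - 2 * γ) ≤ 4 := by
    calc mesh M ^ (1 - 2 * γ) ≤ 4 ^ (1 - 2 * γ) :=
          Real.rpow_le_rpow hh.le ((mesh_le_pi M).trans Real.pi_le_four) (by linarith)
      _ ≤ 4 ^ (1 : ℝ) := Real.rpow_le_rpow_of_exponent_le (by norm_num) (by linarith)
      _ = 4 := Real.rpow_one _
  conv_lhs => rw [e]
  gcongr

/-- The same `cellCoeff` appears on both sides, so the difference is the Fourier multiplier by a
difference of phases. Low frequencies use `norm_phase_sub_le`, high ones only the smallness of the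
tail; `6² = 4 + 8·4`. -/
theorem norm_stepL_latticePropagator_sub_le (hα : 1 ≤ α) (hα₂ : α ≤ 2) (t : ℝ)
    (g : ZMod (2 * M) → ℂ) :
    ‖stepL M (latticePropagator M α t g) - propagator α t (stepL M g)‖ ≤
      6 * (1 + |t|) * mesh M ^ (α / (2 + α)) * √(gradSq M α g) := by
  have hα0 : 0 ≤ α := by linarith
  have hh := mesh_pos M
  have hF : ∀ k : ℤ, fourierT (stepL M (latticePropagator M α t g) -
      propagator α t (stepL M g) : L2T) k = (latticePhase M α t k - phase α t k) *
        fourierT (stepL M g) k := by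
    intro k
    rw [fourierT_sub, fourierT_propagator, fourierT_stepL, latticeFourier_latticePropagator,
      fourierT_stepL]
    ring
  set γ := α / (2 + α) with hγ
  have hs := (hasSum_norm_fourierT_sq (stepL M g)).summable
  have h := norm_sq_le_of_split (M := M)
    (f := stepL M (latticePropagator M α t g) - propagator α t (stepL M g))
    (P := fun k => (2 * (1 + |t|) * mesh M ^ γ) ^ 2 *
      (|(k.valMinAbs : ℝ)| ^ α * ‖latticeFourier M g k‖ ^ 2))
    (Q := fun k => 4 * ‖fourierT (stepL M g) k‖ ^ 2) (hs.mul_left 4) (fun k => ?_) (fun k hk => ?_)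
  · have e : ∀ k : ℤ, (if k ∈ freqs M then 0 else 4 * ‖fourierT (stepL M g) k‖ ^ 2) =
        4 * (if k ∈ freqs M then 0 else ‖fourierT (stepL M g) k‖ ^ 2) := by
      intro k
      split_ifs <;> simp
    rw [tsum_congr e, tsum_mul_left, ← Finset.mul_sum, gradSq_sum] at h
    have ht := tail_stepL_le hα g
    have hN := gradSq_nonneg (α := α) g
    have h1 : ‖stepL M (latticePropagator M α t g) - propagator α t (stepL M g)‖ ^ 2 ≤
        (2 * (1 + |t|) * mesh M ^ γ) ^ 2 * gradSq M α g + 8 * mesh M * gradSq M α g := by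
      refine h.trans ?_
      rw [inv_mul_le_iff₀ Real.two_pi_pos]
      linarith
    have h2 := mesh_le_rpow (M := M) hα0 hα₂
    rw [← sq_le_sq₀ (norm_nonneg _) (by positivity)]
    refine h1.trans ?_
    rw [mul_pow _ (√(gradSq M α g)), Real.sq_sqrt hN, ← add_mul]
    refine mul_le_mul_of_nonneg_right ?_ hN
    have h3 : (mesh M ^ γ) ^ 2 ≤ ((1 + |t|) * mesh M ^ γ) ^ 2 := by
      have : 0 ≤ mesh M ^ γ := by positivity
      gcongr
      nlinarith [abs_nonneg t]
    nlinarith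
  · rw [hF, ZMod.coe_valMinAbs, fourierT_stepL_valMinAbs, norm_mul, norm_mul, mul_pow, mul_pow]
    have h1 := pow_le_pow_left₀ (norm_nonneg _) (norm_phase_sub_le hα0 hα₂ t k) 2
    have h2 : (|(k.valMinAbs : ℝ)| ^ (α / 2)) ^ 2 = |(k.valMinAbs : ℝ)| ^ α := by
      rw [← Real.rpow_natCast, ← Real.rpow_mul (abs_nonneg _)]
      norm_num
    rw [mul_pow _ (|(k.valMinAbs : ℝ)| ^ (α / 2)), h2] at h1
    have h3 : ‖cellCoeff M k.valMinAbs‖ ^ 2 * ‖latticeFourier M g k‖ ^ 2 ≤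
        ‖latticeFourier M g k‖ ^ 2 :=
      mul_le_of_le_one_left (sq_nonneg _)
        (pow_le_one₀ (norm_nonneg _) (norm_cellCoeff_le M k.valMinAbs))
    exact (mul_le_mul h1 h3 (by positivity) (by positivity)).trans_eq (mul_assoc _ _ _)
  · rw [hF, norm_mul, mul_pow]
    gcongr
    have : ‖latticePhase M α t k - phase α t k‖ ≤ 2 := by
      refine (norm_sub_le _ _).trans ?_
      rw [norm_latticePhase, norm_phase]
      norm_num
    nlinarith [norm_nonneg (latticePhase M α t k - phase α t k)]

/-! ### Linear interpolation -/

omit [NeZero M] in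
theorem measurable_interpolate (g : ZMod (2 * M) → ℂ) : Measurable (interpolate M g) := by
  have hj : Measurable fun x : Torus => ⌊(AddCircle.equivIco (2 * π) (-π) x : ℝ) / mesh M⌋ :=
    Int.measurable_floor.comp (measurable_equivIco.div_const _)
  have h1 : Measurable fun j : ℤ => g (j : ZMod (2 * M)) := measurable_from_top
  have h2 : Measurable fun j : ℤ => (g ((j : ZMod (2 * M)) + 1) - g (j : ZMod (2 * M))) /
    (mesh M : ℂ) := measurable_from_top
  have h3 : Measurable fun j : ℤ => mesh M * (j : ℝ) := measurable_from_top
  exact (h1.comp hj).add ((h2.comp hj).mul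
    (Complex.measurable_ofReal.comp (measurable_equivIco.sub (h3.comp hj))))

theorem norm_interpolate_sub_stepFun_le (g : ZMod (2 * M) → ℂ) (x : Torus) :
    ‖interpolate M g x - stepFun M g x‖ ≤ ‖stepFun M (fun j => g (j + 1) - g j) x‖ := by
  have hh := mesh_pos M
  simp only [interpolate, stepFun, add_sub_cancel_left]
  set y : ℝ := (AddCircle.equivIco (2 * π) (-π) x : ℝ) with hy
  rw [norm_mul, norm_div, Complex.norm_real, Complex.norm_real, Real.norm_of_nonneg hh.le,
    div_mul_eq_mul_div, div_le_iff₀ hh]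
  gcongr
  have h1 := Int.floor_le (y / mesh M)
  have h2 := Int.lt_floor_add_one (y / mesh M)
  rw [le_div_iff₀ hh] at h1
  rw [div_lt_iff₀ hh] at h2
  rw [Real.norm_eq_abs, abs_le]
  constructor <;> linarith

theorem latticeFourier_shift (g : ZMod (2 * M) → ℂ) (k : ZMod (2 * M)) :
    latticeFourier M (fun j => g (j + 1)) k = ZMod.stdAddChar k * latticeFourier M g k := by
  rw [latticeFourier, latticeFourier, mul_left_comm, Finset.mul_sum (a := ZMod.stdAddChar k)]
  congr 1
  refine Fintype.sum_equiv (Equiv.addRight 1) _ _ fun j => ?_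
  rw [Equiv.coe_addRight, mul_left_comm, ← AddChar.map_add_eq_mul]
  ring_nf

/-- A shift acts as `e^{ihk}`, and `|e^{ihk} - 1|² ≤ 2h|k|`. This bounds the gap between linear and
piecewise constant interpolation. -/
theorem mass_shift_sub_le (hα : 1 ≤ α) (g : ZMod (2 * M) → ℂ) :
    mass M (fun j => g (j + 1) - g j) ≤ 2 * mesh M * gradSq M α g := by
  have hh := mesh_pos M
  rw [mass_eq, gradSq, mul_left_comm, Finset.mul_sum (a := 2 * mesh M)]
  refine mul_le_mul_of_nonneg_left (Finset.sum_le_sum fun k _ => ?_) (by positivity)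
  have e : latticeFourier M (fun j => g (j + 1) - g j) k =
      (ZMod.stdAddChar k - 1) * latticeFourier M g k := by
    have := latticeFourier_sub M (fun j => g (j + 1)) g k
    rw [latticeFourier_shift] at this
    rw [sub_mul, one_mul, ← this]
    rfl
  rw [e, norm_mul, mul_pow, ← mul_assoc]
  gcongr
  conv_lhs => rw [← ZMod.coe_valMinAbs k]
  rw [stdAddChar_intCast]
  refine (norm_exp_sub_one_sq_le _).trans ?_
  rw [abs_mul, abs_of_pos hh, ← mul_assoc]
  gcongr
  exact abs_intCast_le_rpow hα _

theorem eLpNorm_interpolate_sub_le (hα : 1 ≤ α) (g : ZMod (2 * M) → ℂ) (u : L2T) :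
    eLpNorm (fun x : Torus => interpolate M g x - u x) 2 volume ≤
      ENNReal.ofReal (√(2 * mesh M * gradSq M α g) + ‖stepL M g - u‖) := by
  have h1 : eLpNorm (fun x : Torus => interpolate M g x - stepFun M g x) 2 volume ≤
      ENNReal.ofReal (√(2 * mesh M * gradSq M α g)) := by
    refine (eLpNorm_mono (norm_interpolate_sub_stepFun_le g)).trans ?_
    rw [← eLpNorm_congr_ae (coeFn_stepL M fun j => g (j + 1) - g j), ← Lp.enorm_def,
      ← ofReal_norm]
    refine ENNReal.ofReal_le_ofReal (Real.le_sqrt_of_sq_le ?_)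
    rw [norm_stepL_sq]
    exact mass_shift_sub_le hα g
  have h2 : eLpNorm (fun x : Torus => stepFun M g x - u x) 2 volume =
      ENNReal.ofReal ‖stepL M g - u‖ := by
    rw [ofReal_norm, Lp.enorm_def]
    refine eLpNorm_congr_ae ?_
    filter_upwards [coeFn_stepL M g, Lp.coeFn_sub (stepL M g) u] with x h3 h4
    rw [h4, Pi.sub_apply, h3]
  have h3 : (fun x : Torus => interpolate M g x - u x) =
      (fun x : Torus => interpolate M g x - stepFun M g x) +
        fun x : Torus => stepFun M g x - u x := by
    ext x
    simp
  rw [h3, ENNReal.ofReal_add (Real.sqrt_nonneg _) (norm_nonneg _), ← h2]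
  refine (eLpNorm_add_le ?_ ?_ (by norm_num)).trans (by gcongr)
  · exact ((measurable_interpolate g).sub (measurable_stepFun M g)).aestronglyMeasurable
  · exact (measurable_stepFun M g).aestronglyMeasurable.sub (Lp.aestronglyMeasurable u)

end Approximation

section Continuum

variable {α μ : ℝ}

/-! ### Sobolev spaces on the torus -/

theorem rpow_le_sobolev_weight (hα : 0 ≤ α) (k : ℤ) :
    |(k : ℝ)| ^ α ≤ (1 + (k : ℝ) ^ 2) ^ (α / 2) := by
  have : |(k : ℝ)| ^ α = ((k : ℝ) ^ 2) ^ (α / 2) := by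
    rw [← sq_abs, ← Real.rpow_natCast, ← Real.rpow_mul (abs_nonneg _)]
    congr 1
    push_cast
    ring
  rw [this]
  gcongr
  linarith

theorem sobolev_weight_le (hα : 0 ≤ α) (hα₂ : α ≤ 2) (k : ℤ) :
    (1 + (k : ℝ) ^ 2) ^ (α / 2) ≤ 1 + |(k : ℝ)| ^ α := by
  have h1 : |(k : ℝ)| ^ α = ((k : ℝ) ^ 2) ^ (α / 2) := by
    rw [← sq_abs, ← Real.rpow_natCast, ← Real.rpow_mul (abs_nonneg _)]
    congr 1
    push_cast
    ring
  have h2 := Real.rpow_add_le_add_rpow (p := α / 2) zero_le_one (sq_nonneg (k : ℝ)) (by positivity)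
    (by linarith)
  rwa [Real.one_rpow, ← h1] at h2

theorem one_le_sobolev_weight (hα : 0 ≤ α) (k : ℤ) : 1 ≤ (1 + (k : ℝ) ^ 2) ^ (α / 2) :=
  Real.one_le_rpow (by nlinarith [sq_nonneg (k : ℝ)]) (by positivity)

theorem memSobolev_iff (hα : 0 ≤ α) (hα₂ : α ≤ 2) (f : L2T) :
    MemSobolev (α / 2) f ↔ Summable fun k : ℤ => |(k : ℝ)| ^ α * ‖fourierT f k‖ ^ 2 := by
  constructor <;> intro h
  · refine h.of_nonneg_of_le (fun _ => by positivity) fun k => ?_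
    gcongr
    exact rpow_le_sobolev_weight hα k
  · refine ((hasSum_norm_fourierT_sq f).summable.add h).of_nonneg_of_le
      (fun _ => by positivity) fun k => ?_
    have := mul_le_mul_of_nonneg_right (sobolev_weight_le hα hα₂ k) (sq_nonneg ‖fourierT f k‖)
    linarith

theorem sobolevNorm_sq (s : ℝ) (f : L2T) : sobolevNorm s f ^ 2 =
    (2 * π)⁻¹ * ∑' k : ℤ, (1 + (k : ℝ) ^ 2) ^ s * ‖fourierT f k‖ ^ 2 :=
  Real.sq_sqrt (mul_nonneg (by positivity) (tsum_nonneg fun _ => by positivity))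

theorem sobolevNorm_nonneg (s : ℝ) (f : L2T) : 0 ≤ sobolevNorm s f := Real.sqrt_nonneg _

theorem gradT_le_sobolevNorm_sq (hα : 0 ≤ α) (hα₂ : α ≤ 2) {f : L2T}
    (hf : MemSobolev (α / 2) f) : gradT α f ≤ sobolevNorm (α / 2) f ^ 2 := by
  rw [sobolevNorm_sq, gradT]
  refine mul_le_mul_of_nonneg_left ?_ (by positivity)
  refine ((memSobolev_iff hα hα₂ f).1 hf).tsum_le_tsum (fun k => ?_) hf
  gcongr
  exact rpow_le_sobolev_weight hα k

theorem norm_le_sobolevNorm (hα : 0 ≤ α) {f : L2T} (hf : MemSobolev (α / 2) f) :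
    ‖f‖ ≤ sobolevNorm (α / 2) f := by
  rw [← sq_le_sq₀ (norm_nonneg _) (sobolevNorm_nonneg _ _), sobolevNorm_sq, norm_sq_eq_tsum]
  refine mul_le_mul_of_nonneg_left ?_ (by positivity)
  refine (hasSum_norm_fourierT_sq f).summable.tsum_le_tsum (fun k => ?_) hf
  exact le_mul_of_one_le_left (sq_nonneg _) (one_le_sobolev_weight hα k)

theorem sobolevNorm_sq_le (hα : 0 ≤ α) (hα₂ : α ≤ 2) {f : L2T}
    (hf : MemSobolev (α / 2) f) : sobolevNorm (α / 2) f ^ 2 ≤ ‖f‖ ^ 2 + gradT α f := by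
  have h1 := (memSobolev_iff hα hα₂ f).1 hf
  have h2 := (hasSum_norm_fourierT_sq f).summable
  rw [sobolevNorm_sq, gradT, norm_sq_eq_tsum, ← mul_add, ← h2.tsum_add h1]
  refine mul_le_mul_of_nonneg_left (hf.tsum_le_tsum (fun k => ?_) (h2.add h1)) (by positivity)
  have := mul_le_mul_of_nonneg_right (sobolev_weight_le hα hα₂ k) (sq_nonneg ‖fourierT f k‖)
  linarith

theorem summable_grad_add {f g : L2T}
    (hf : Summable fun k : ℤ => |(k : ℝ)| ^ α * ‖fourierT f k‖ ^ 2)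
    (hg : Summable fun k : ℤ => |(k : ℝ)| ^ α * ‖fourierT g k‖ ^ 2) :
    (Summable fun k : ℤ => |(k : ℝ)| ^ α * ‖fourierT (f + g : L2T) k‖ ^ 2) ∧
      gradT α (f + g) ≤ 2 * gradT α f + 2 * gradT α g := by
  have h1 : ∀ k : ℤ, |(k : ℝ)| ^ α * ‖fourierT (f + g : L2T) k‖ ^ 2 ≤
      2 * (|(k : ℝ)| ^ α * ‖fourierT f k‖ ^ 2) + 2 * (|(k : ℝ)| ^ α * ‖fourierT g k‖ ^ 2) := by
    intro k
    rw [fourierT_add]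
    have h2 : ‖fourierT f k + fourierT g k‖ ^ 2 ≤ 2 * (‖fourierT f k‖ ^ 2 + ‖fourierT g k‖ ^ 2) :=
      (pow_le_pow_left₀ (norm_nonneg _) (norm_add_le _ _) 2).trans add_sq_le
    have h3 : 0 ≤ |(k : ℝ)| ^ α := by positivity
    have := mul_le_mul_of_nonneg_left h2 h3
    linarith
  have hs := (hf.mul_left 2).add (hg.mul_left 2)
  have h4 := hs.of_nonneg_of_le (fun _ => by positivity) h1
  refine ⟨h4, ?_⟩
  have h5 := h4.tsum_le_tsum h1 hs
  rw [(hf.mul_left 2).tsum_add (hg.mul_left 2), tsum_mul_left, tsum_mul_left] at h5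
  have h6 := mul_le_mul_of_nonneg_left h5 (by positivity : 0 ≤ (2 * π)⁻¹)
  unfold gradT
  linarith

/-- The Sobolev embedding into `L^∞`. -/
theorem ae_norm_le (hα : 1 < α) {f : L2T}
    (hf : Summable fun k : ℤ => |(k : ℝ)| ^ α * ‖fourierT f k‖ ^ 2) :
    ∀ᵐ x, ‖f x‖ ≤ resolventSum α 1 + ‖f‖ ^ 2 + gradT α f := by
  have hp : ‖(2 * π : ℂ)⁻¹‖ = (2 * π)⁻¹ := by
    rw [norm_inv, norm_mul, Complex.norm_real, Real.norm_of_nonneg Real.pi_pos.le]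
    simp
  have h2 := (hasSum_norm_fourierT_sq f).summable
  have hR := summable_resolvent hα le_rfl
  have hb : ∀ k : ℤ, ‖((2 * π : ℂ)⁻¹ * fourierT f k) • (fourier k : C(Torus, ℂ))‖ ≤
      (2 * π)⁻¹ * ((1 + |(k : ℝ)| ^ α)⁻¹ + (‖fourierT f k‖ ^ 2 +
        |(k : ℝ)| ^ α * ‖fourierT f k‖ ^ 2)) := by
    intro k
    rw [norm_smul, fourier_norm, mul_one, norm_mul, hp]
    gcongr
    set w := 1 + |(k : ℝ)| ^ α with hw
    have hw0 : 0 < w := by positivity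
    have e : ‖fourierT f k‖ ^ 2 + |(k : ℝ)| ^ α * ‖fourierT f k‖ ^ 2 = w * ‖fourierT f k‖ ^ 2 := by
      rw [hw]; ring
    rw [e]
    -- Completing the square gives `2|f̂| ≤ w⁻¹ + w|f̂|²`, an additive Cauchy–Schwarz inequality;
    -- the final bound need not be homogeneous.
    have h3 : w⁻¹ * (w * ‖fourierT f k‖ - 1) ^ 2 =
        w * ‖fourierT f k‖ ^ 2 - 2 * ‖fourierT f k‖ + w⁻¹ := by
      field_simp
      ring
    have h4 : 0 ≤ w⁻¹ * (w * ‖fourierT f k‖ - 1) ^ 2 := by positivity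
    linarith [norm_nonneg (fourierT f k)]
  have hs : Summable fun k : ℤ => (2 * π)⁻¹ * ((1 + |(k : ℝ)| ^ α)⁻¹ + (‖fourierT f k‖ ^ 2 +
        |(k : ℝ)| ^ α * ‖fourierT f k‖ ^ 2)) := (hR.add (h2.add hf)).mul_left _
  have hsum : Summable fun k : ℤ => ((2 * π : ℂ)⁻¹ * fourierT f k) • (fourier k : C(Torus, ℂ)) :=
    Summable.of_norm_bounded hs hb
  set F : C(Torus, ℂ) := ∑' k : ℤ, ((2 * π : ℂ)⁻¹ * fourierT f k) • (fourier k : C(Torus, ℂ))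
    with hF
  have hFn : ‖F‖ ≤ resolventSum α 1 + ‖f‖ ^ 2 + gradT α f := by
    have h3 := tsum_of_norm_bounded hs.hasSum hb
    rw [tsum_mul_left, hR.tsum_add (h2.add hf), h2.tsum_add hf, mul_add, mul_add,
      ← norm_sq_eq_tsum, ← gradT, ← add_assoc] at h3
    refine h3.trans ?_
    gcongr
    refine mul_le_of_le_one_left (resolventSum_nonneg le_rfl) (inv_le_one_of_one_le₀ ?_)
    linarith [Real.pi_gt_three]
  have hFf : ContinuousMap.toLp (E := ℂ) 2 (volume : Measure Torus) ℂ F = f := by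
    have h3 := (ContinuousMap.toLp (E := ℂ) 2 (volume : Measure Torus) ℂ).hasSum hsum.hasSum
    refine HasSum.unique ?_ (hasSum_fourier_series f)
    convert h3 using 2 with k
    rw [map_smul]
    rfl
  have h3 := ContinuousMap.coeFn_toLp (p := 2) (𝕜 := ℂ) (volume : Measure Torus) F
  rw [hFf] at h3
  filter_upwards [h3] with x hx
  rw [hx]
  exact (F.norm_coe_le_norm x).trans hFn

/-! ### The nonlinearity on `L²(𝕋)` -/

theorem lipschitzWith_trunc {R : ℝ} (hR : 0 ≤ R) :
    LipschitzWith (3 * R ^ 2).toNNReal (trunc R) :=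
  LipschitzWith.of_dist_le_mul fun z w => by
    rw [dist_eq_norm, dist_eq_norm, Real.coe_toNNReal _ (by positivity)]
    exact norm_trunc_sub_le hR z w

/-- The truncated nonlinearity on `L²(𝕋)`. -/
def truncT {R : ℝ} (hR : 0 ≤ R) (f : L2T) : L2T :=
  (lipschitzWith_trunc hR).compLp (trunc_zero R) f

theorem norm_truncT_sub_le {R : ℝ} (hR : 0 ≤ R) (f g : L2T) :
    ‖truncT hR f - truncT hR g‖ ≤ 3 * R ^ 2 * ‖f - g‖ := by
  have := (lipschitzWith_trunc hR).norm_compLp_sub_le (trunc_zero R) f g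
  rwa [Real.coe_toNNReal _ (by positivity)] at this

theorem truncT_zero {R : ℝ} (hR : 0 ≤ R) : truncT hR 0 = 0 :=
  (lipschitzWith_trunc hR).compLp_zero (trunc_zero R)

theorem continuous_truncT {R : ℝ} (hR : 0 ≤ R) : Continuous (truncT hR) :=
  (lipschitzWith_trunc hR).continuous_compLp (trunc_zero R)

theorem coeFn_truncT {R : ℝ} (hR : 0 ≤ R) (f : L2T) :
    (truncT hR f : Torus → ℂ) =ᵐ[volume] fun x => trunc R (f x) :=
  (lipschitzWith_trunc hR).coeFn_compLp (trunc_zero R) f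

/-- The bound also makes `|f|² f` square-integrable, so the default branch of `cubic` is not taken.
-/
theorem truncT_eq_cubic {R : ℝ} (hR : 0 ≤ R) {f : L2T} (hf : ∀ᵐ x, ‖f x‖ ≤ R) :
    truncT hR f = cubic f := by
  have h1 : (truncT hR f : Torus → ℂ) =ᵐ[volume] fun x => ((‖f x‖ ^ 2 : ℝ) : ℂ) * f x := by
    filter_upwards [coeFn_truncT hR f, hf] with x hx hx2
    rw [hx, trunc_of_le hx2]
  have h2 : MemLp (fun x : Torus => ((‖f x‖ ^ 2 : ℝ) : ℂ) * f x) 2 volume :=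
    (memLp_congr_ae h1).1 (Lp.memLp _)
  rw [cubic, dif_pos h2]
  refine Lp.ext ?_
  filter_upwards [h1, h2.coeFn_toLp] with x hx hx2
  rw [hx, hx2]

/-- Pointwise maps commute with piecewise constant interpolation, so the nonlinearity causes no
consistency error. This is the reason for working with `stepL` and bringing in `interpolate` only at
the end. -/
theorem truncT_stepL {R : ℝ} (hR : 0 ≤ R) {M : ℕ} [NeZero M] {g : ZMod (2 * M) → ℂ}
    (hg : ∀ j, ‖g j‖ ≤ R) : truncT hR (stepL M g) = stepL M (latticeCubic M g) := by
  refine Lp.ext ?_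
  filter_upwards [coeFn_truncT hR (stepL M g), coeFn_stepL M g,
    coeFn_stepL M (latticeCubic M g)] with x h1 h2 h3
  rw [h1, h2, h3, stepFun, trunc_of_le (hg _)]
  rfl

theorem isBoundedGroup_propagatorL (α : ℝ) : IsBoundedGroup (propagatorL α) 1 where
  add := propagatorL_add α
  norm_le t f := by rw [one_mul]; exact (norm_propagator α t f).le
  continuous := continuous_propagatorL α

/-! ### Lower semicontinuity -/

/-- Fatou over finite sets of frequencies: each coefficient converges, a finite set eventually lies
in `freqs (n + 1)`, and `|cellCoeff| ≤ 1`. -/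
theorem grad_le_of_tendsto {f : L2T} {B : ℝ} {g : ∀ n : ℕ, ZMod (2 * (n + 1)) → ℂ}
    (hg : ∀ n, gradSq (n + 1) α (g n) ≤ B)
    (h : Tendsto (fun n => stepL (n + 1) (g n)) atTop (𝓝 f)) :
    (Summable fun k : ℤ => |(k : ℝ)| ^ α * ‖fourierT f k‖ ^ 2) ∧ gradT α f ≤ B := by
  have key : ∀ S : Finset ℤ, ∑ k ∈ S, |(k : ℝ)| ^ α * ‖fourierT f k‖ ^ 2 ≤ 2 * π * B := by
    intro S
    have h1 : Tendsto (fun n => ∑ k ∈ S, |(k : ℝ)| ^ α * ‖fourierT (stepL (n + 1) (g n)) k‖ ^ 2)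
        atTop (𝓝 (∑ k ∈ S, |(k : ℝ)| ^ α * ‖fourierT f k‖ ^ 2)) :=
      tendsto_finsetSum _ fun k _ =>
        ((((continuous_fourierT k).tendsto f).comp h).norm.pow 2).const_mul _
    obtain ⟨N, hN⟩ : ∃ N : ℕ, ∀ k ∈ S, |k| ≤ (N : ℤ) := by
      refine ⟨S.sup fun k => k.natAbs, fun k hk => ?_⟩
      rw [Int.abs_eq_natAbs]
      exact_mod_cast Finset.le_sup (f := fun k : ℤ => k.natAbs) hk
    refine le_of_tendsto h1 ?_
    filter_upwards [eventually_ge_atTop N] with n hn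
    have hsub : S ⊆ freqs (n + 1) := by
      intro k hk
      by_contra hk'
      have h2 := le_abs_of_notMem_freqs hk'
      have h3 : ((|k| : ℤ) : ℝ) ≤ ((N : ℤ) : ℝ) := by exact_mod_cast hN k hk
      have h4 : (N : ℝ) ≤ n := by exact_mod_cast hn
      push_cast at h2 h3
      linarith
    calc _ ≤ ∑ k ∈ freqs (n + 1), |(k : ℝ)| ^ α * ‖fourierT (stepL (n + 1) (g n)) k‖ ^ 2 :=
          Finset.sum_le_sum_of_subset_of_nonneg hsub fun _ _ _ => by positivity
      _ = ∑ k : ZMod (2 * (n + 1)), |(k.valMinAbs : ℝ)| ^ α *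
            ‖fourierT (stepL (n + 1) (g n)) k.valMinAbs‖ ^ 2 := sum_freqs _
      _ ≤ ∑ k : ZMod (2 * (n + 1)), |(k.valMinAbs : ℝ)| ^ α *
            ‖latticeFourier (n + 1) (g n) k‖ ^ 2 := by
          refine Finset.sum_le_sum fun k _ => ?_
          rw [fourierT_stepL_valMinAbs, norm_mul]
          gcongr
          exact mul_le_of_le_one_left (norm_nonneg _) (norm_cellCoeff_le _ _)
      _ = 2 * π * gradSq (n + 1) α (g n) := gradSq_sum _
      _ ≤ 2 * π * B := by gcongr; exact hg n
  have h0 : ∀ k : ℤ, 0 ≤ |(k : ℝ)| ^ α * ‖fourierT f k‖ ^ 2 := fun _ => by positivity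
  refine ⟨summable_of_sum_le h0 key, ?_⟩
  rw [gradT, inv_mul_le_iff₀ Real.two_pi_pos]
  exact Real.tsum_le_of_sum_le h0 key

/-- The seminorm is not continuous on `L²`. Minkowski's inequality is therefore applied to its
restriction to a finite set `S` of frequencies, the Euclidean norm of a bounded map `L`, uniformly
in `S`. -/
theorem grad_integral_le {H : ℝ → L2T} (hH : Continuous H) {K : ℝ} (hK : 0 ≤ K)
    (hs : ∀ τ, Summable fun k : ℤ => |(k : ℝ)| ^ α * ‖fourierT (H τ) k‖ ^ 2)
    (h : ∀ τ, gradT α (H τ) ≤ K) (a b : ℝ) :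
    (Summable fun k : ℤ => |(k : ℝ)| ^ α * ‖fourierT (∫ τ in a..b, H τ : L2T) k‖ ^ 2) ∧
      gradT α (∫ τ in a..b, H τ) ≤ K * (b - a) ^ 2 := by
  have key : ∀ S : Finset ℤ, ∑ k ∈ S, |(k : ℝ)| ^ α * ‖fourierT (∫ τ in a..b, H τ : L2T) k‖ ^ 2 ≤
      2 * π * (K * (b - a) ^ 2) := by
    intro S
    set L : L2T →L[ℂ] EuclideanSpace ℂ S :=
      (EuclideanSpace.equiv S ℂ).symm.toContinuousLinearMap.comp
        (ContinuousLinearMap.pi fun k : S =>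
          ((|((k : ℤ) : ℝ)| ^ (α / 2) : ℝ) : ℂ) • innerSL ℂ (mode k)) with hL
    have hLn : ∀ f : L2T, ‖L f‖ ^ 2 = ∑ k ∈ S, |(k : ℝ)| ^ α * ‖fourierT f k‖ ^ 2 := by
      intro f
      rw [EuclideanSpace.norm_sq_eq, ← Finset.sum_coe_sort S]
      refine Finset.sum_congr rfl fun k _ => ?_
      have e : L f k = ((|((k : ℤ) : ℝ)| ^ (α / 2) : ℝ) : ℂ) * fourierT f k := by
        rw [fourierT_eq_inner]
        rfl
      rw [e, norm_mul, mul_pow, Complex.norm_real, Real.norm_of_nonneg (by positivity),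
        ← Real.rpow_natCast, ← Real.rpow_mul (abs_nonneg _)]
      norm_num
    have hb : ∀ τ, ‖L (H τ)‖ ≤ √(2 * π * K) := by
      intro τ
      refine Real.le_sqrt_of_sq_le ?_
      rw [hLn]
      refine ((hs τ).sum_le_tsum _ fun _ _ => by positivity).trans ?_
      have := h τ
      rwa [gradT, inv_mul_le_iff₀ Real.two_pi_pos] at this
    rw [← hLn, ← L.intervalIntegral_comp_comm (hH.intervalIntegrable _ _)]
    have h1 := intervalIntegral.norm_integral_le_of_norm_le_const (a := a) (b := b)
      (f := fun τ => L (H τ)) fun τ _ => hb τ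
    refine (pow_le_pow_left₀ (norm_nonneg _) h1 2).trans_eq ?_
    rw [mul_pow, sq_abs, Real.sq_sqrt (by positivity), mul_assoc]
  have h0 : ∀ k : ℤ, 0 ≤ |(k : ℝ)| ^ α * ‖fourierT (∫ τ in a..b, H τ : L2T) k‖ ^ 2 :=
    fun _ => by positivity
  refine ⟨summable_of_sum_le h0 key, ?_⟩
  rw [gradT, inv_mul_le_iff₀ Real.two_pi_pos]
  exact Real.tsum_le_of_sum_le h0 key

theorem gradT_propagator (t : ℝ) (f : L2T) : gradT α (propagator α t f) = gradT α f := by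
  simp only [gradT, fourierT_propagator, norm_mul, norm_phase, one_mul]

theorem gradT_smul_of_norm_eq_one {c : ℂ} (hc : ‖c‖ = 1) (f : L2T) :
    gradT α (c • f) = gradT α f := by
  simp only [gradT, fourierT_smul, norm_mul, hc, one_mul]

end Continuum

/-! ### Convergence of the lattice flows and the continuum Cauchy problem -/

section Limit

variable {α μ : ℝ}

/-- The difference between the interpolated lattice flow and the flow of the truncated equation. -/
theorem norm_stepL_sub_le (hα : 1 < α) (hα₂ : α ≤ 2) (hμ : μ = 1 ∨ μ = -1) {r B R : ℝ}
    (hr : 0 ≤ r) (hR : 0 ≤ R) {M : ℕ} [NeZero M] {u₀ : L2T}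
    (hu₀ : Summable fun k : ℤ => |(k : ℝ)| ^ α * ‖fourierT u₀ k‖ ^ 2)
    (hg : gradT α u₀ ≤ r ^ 2) {v : ℝ → ZMod (2 * M) → ℂ}
    (hv : IsLatticeSolution M α μ (discretize M u₀) v) (hvR : ∀ t j, ‖v t j‖ ≤ R)
    (hvB : ∀ t, gradSq M α (latticeCubic M (v t)) ≤ B) {u : ℝ → L2T} (hu : Continuous u)
    (hum : IsMild (propagatorL α) (Complex.I * μ) (truncT hR) u₀ u) (t : ℝ) :
    ‖stepL M (v t) - u t‖ ≤ (18 * r + 6 * √B) * mesh M ^ (α / (2 + α)) *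
      Real.exp ((3 * R ^ 2 + 2) * |t|) := by
  have hα0 : 0 ≤ α := by linarith
  have hh := mesh_pos M
  set γ := α / (2 + α) with hγ
  set c : ℂ := Complex.I * μ with hc
  have hc1 : ‖c‖ = 1 := norm_I_mul hμ
  set d := discretize M u₀ with hd
  have hU := isBoundedGroup_propagatorL α
  have hUl := isBoundedGroup_latticePropagatorL M α
  have hFv : Continuous fun τ => latticeCubic M (v τ) := continuous_latticeCubic.comp hv.1
  have hsv : Continuous fun τ => stepL M (v τ) := (stepL M).continuous.comp hv.1
  have hsF : Continuous fun τ => stepL M (latticeCubic M (v τ)) := (stepL M).continuous.comp hFv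
  have hTu : Continuous fun τ => truncT hR (u τ) := (continuous_truncT hR).comp hu
  set E : ℝ → ℝ → L2T := fun s τ => stepL M (latticePropagator M α (s - τ) (latticeCubic M (v τ))) -
    propagator α (s - τ) (stepL M (latticeCubic M (v τ))) with hE
  -- The consistency error, independent of `u`: group comparison on the datum, projection of the
  -- datum, group comparison in the Duhamel term. What remains is Lipschitz in `stepL M (v s) - u
  -- s`.
  set e : ℝ → L2T := fun s => (stepL M (latticePropagator M α s d) - propagator α s (stepL M d)) +
    propagatorL α s (stepL M d - u₀) - c • ∫ τ in (0 : ℝ)..s, E s τ with he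
  have hstep : ∀ s, stepL M (v s) = stepL M (latticePropagator M α s d) -
      c • ∫ τ in (0 : ℝ)..s, stepL M (latticePropagator M α (s - τ) (latticeCubic M (v τ))) := by
    intro s
    conv_lhs => rw [hv.2 s]
    rw [map_sub, map_smul, ← (stepL M).intervalIntegral_comp_comm]
    · rfl
    · exact (hUl.continuous_apply (by fun_prop) hFv).intervalIntegrable _ _
  have i1 : ∀ s, IntervalIntegrable (fun τ => stepL M (latticePropagator M α (s - τ)
      (latticeCubic M (v τ)))) volume 0 s := fun s =>
    ((stepL M).continuous.comp
      (hUl.continuous_apply (s := fun τ => s - τ) (by fun_prop) hFv)).intervalIntegrable _ _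
  have i2 : ∀ s, IntervalIntegrable (fun τ => propagator α (s - τ)
      (stepL M (latticeCubic M (v τ)))) volume 0 s := fun s =>
    (hU.continuous_apply (s := fun τ => s - τ) (by fun_prop) hsF).intervalIntegrable _ _
  have i3 : ∀ s, IntervalIntegrable (fun τ => propagator α (s - τ) (truncT hR (u τ))) volume 0 s :=
    fun s => (hU.continuous_apply (s := fun τ => s - τ) (by fun_prop) hTu).intervalIntegrable _ _
  have heq : ∀ s, |s| ≤ |t| → stepL M (v s) - u s = e s - c • ∫ τ in (0 : ℝ)..s,
      propagatorL α (s - τ) (stepL M (latticeCubic M (v τ)) - truncT hR (u τ)) := by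
    intro s _
    have h1 : ∫ τ in (0 : ℝ)..s, E s τ = (∫ τ in (0 : ℝ)..s, stepL M (latticePropagator M α (s - τ)
        (latticeCubic M (v τ)))) - ∫ τ in (0 : ℝ)..s, propagator α (s - τ)
          (stepL M (latticeCubic M (v τ))) := intervalIntegral.integral_sub (i1 s) (i2 s)
    have h2 : ∫ τ in (0 : ℝ)..s, propagatorL α (s - τ)
        (stepL M (latticeCubic M (v τ)) - truncT hR (u τ)) =
        (∫ τ in (0 : ℝ)..s, propagator α (s - τ) (stepL M (latticeCubic M (v τ)))) -
          ∫ τ in (0 : ℝ)..s, propagator α (s - τ) (truncT hR (u τ)) := by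
      rw [← intervalIntegral.integral_sub (i2 s) (i3 s)]
      refine intervalIntegral.integral_congr fun τ _ => ?_
      simp only [map_sub]
      rfl
    have h3 := hum s
    simp only [propagatorL_apply] at h3
    simp only [he]
    rw [h1, h2, hstep s, h3, map_sub, propagatorL_apply, propagatorL_apply, smul_sub, smul_sub]
    abel
  have hB0 : 0 ≤ √B := Real.sqrt_nonneg B
  have hhγ : 0 ≤ mesh M ^ γ := by positivity
  have hbound : ∀ s, |s| ≤ |t| → ‖e s‖ ≤ (18 * r + 6 * √B) * mesh M ^ γ * (1 + |t|) ^ 2 := by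
    intro s hs
    have ht0 := abs_nonneg t
    have hs0 := abs_nonneg s
    have hK := kinetic_discretize_le (M := M) hα0 hu₀
    have hN := gradSq_le_kinetic hα0 hα₂ d
    have b1 : ‖stepL M (latticePropagator M α s d) - propagator α s (stepL M d)‖ ≤
        6 * (1 + |t|) * mesh M ^ γ * (2 * r) := by
      refine (norm_stepL_latticePropagator_sub_le hα.le hα₂ s d).trans ?_
      have : √(gradSq M α d) ≤ 2 * r := by
        refine Real.sqrt_le_iff.2 ⟨by positivity, ?_⟩
        linarith
      gcongr
    have b2 : ‖propagatorL α s (stepL M d - u₀)‖ ≤ 6 * r * mesh M ^ γ := by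
      rw [propagatorL_apply, norm_propagator, norm_sub_rev]
      refine (sq_le_sq₀ (norm_nonneg _) (by positivity)).1 ?_
      refine (norm_sub_stepL_discretize_sq_le hα.le hu₀).trans ?_
      have h1 := mesh_le_rpow (M := M) hα0 hα₂
      have := gradT_nonneg (α := α) u₀
      calc 8 * mesh M * gradT α u₀ ≤ 8 * (4 * (mesh M ^ γ) ^ 2) * r ^ 2 := by gcongr
        _ ≤ (6 * r * mesh M ^ γ) ^ 2 := by nlinarith [sq_nonneg (r * mesh M ^ γ)]
    have b3 : ‖c • ∫ τ in (0 : ℝ)..s, E s τ‖ ≤ 6 * (1 + |t|) * mesh M ^ γ * √B * |t| := by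
      rw [norm_smul, hc1, one_mul]
      have := intervalIntegral.norm_integral_le_of_norm_le_const (a := 0) (b := s) (f := E s)
        (C := 6 * (1 + |t|) * mesh M ^ γ * √B) fun τ hτ => by
          refine (norm_stepL_latticePropagator_sub_le hα.le hα₂ (s - τ) _).trans ?_
          have hst : |s - τ| ≤ |t| := by
            refine le_trans ?_ hs
            rcases Set.mem_uIoc.1 hτ with h | h
            · rw [abs_of_nonneg (by linarith), abs_of_nonneg (by linarith)]; linarith
            · rw [abs_of_nonpos (by linarith), abs_of_nonpos (by linarith)]; linarith
          gcongr
          exact hvB τ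
      rw [sub_zero] at this
      refine this.trans ?_
      gcongr
    have h4 : ‖e s‖ ≤ 6 * (1 + |t|) * mesh M ^ γ * (2 * r) + 6 * r * mesh M ^ γ +
        6 * (1 + |t|) * mesh M ^ γ * √B * |t| :=
      (norm_sub_le _ _).trans (add_le_add ((norm_add_le _ _).trans (add_le_add b1 b2)) b3)
    refine h4.trans ?_
    have p1 : 0 ≤ r * mesh M ^ γ * |t| := by positivity
    have p2 : 0 ≤ r * mesh M ^ γ * |t| ^ 2 := by positivity
    have p3 : 0 ≤ √B * mesh M ^ γ * |t| := by positivity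
    have p4 : 0 ≤ √B * mesh M ^ γ := by positivity
    nlinarith
  have h := hU.stability zero_le_one hc1.le hsv hu (e := e)
    (G := fun τ => stepL M (latticeCubic M (v τ)) - truncT hR (u τ))
    (a := (18 * r + 6 * √B) * mesh M ^ γ * (1 + |t|) ^ 2) (K := 3 * R ^ 2) (T := |t|)
    (by positivity) heq hbound (fun s _ => by
      rw [← truncT_stepL hR (hvR s)]
      exact norm_truncT_sub_le hR _ _) (t := t) le_rfl
  refine h.trans ?_
  -- The polynomial growth in time is what adds 2 to the exponent.
  have h1 : (1 + |t|) ^ 2 ≤ Real.exp (2 * |t|) := by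
    have := Real.add_one_le_exp |t|
    rw [two_mul, Real.exp_add, ← sq]
    gcongr
    linarith
  have h2 : Real.exp ((3 * R ^ 2 + 2) * |t|) =
      Real.exp (2 * |t|) * Real.exp (1 * (3 * R ^ 2) * |t|) := by
    rw [← Real.exp_add]
    ring_nf
  rw [h2, mul_assoc _ ((1 + |t|) ^ 2)]
  gcongr

/-! ### Continuity in the Sobolev space -/

/-- `u t - u t₀` is the sum of `-c U(t) ∫ U(-τ) G(τ) dτ` over `[t₀, t]` and `(U(t - t₀) - 1) u(t₀)`.
In the seminorm the first is `O(|t - t₀|)`, for which boundedness of `G` suffices, and the second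
vanishes in the limit by dominated convergence. -/
theorem continuousInSobolev_of_mild (hα : 0 ≤ α) (hα₂ : α ≤ 2) {c : ℂ} (hc : ‖c‖ = 1) {K : ℝ}
    (hK : 0 ≤ K) {u₀ : L2T} {u G : ℝ → L2T} (hu : Continuous u) (hG : Continuous G)
    (hs : ∀ t, Summable fun k : ℤ => |(k : ℝ)| ^ α * ‖fourierT (u t) k‖ ^ 2)
    (hGs : ∀ t, Summable fun k : ℤ => |(k : ℝ)| ^ α * ‖fourierT (G t) k‖ ^ 2)
    (hGK : ∀ t, gradT α (G t) ≤ K)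
    (h : ∀ t, u t = propagatorL α t u₀ - c • ∫ τ in (0 : ℝ)..t, propagatorL α (t - τ) (G τ)) :
    ContinuousInSobolev (α / 2) u := by
  have hU := isBoundedGroup_propagatorL α
  have hH : Continuous fun τ => propagatorL α (-τ) (G τ) :=
    hU.continuous_apply continuous_neg hG
  refine ⟨fun t => (memSobolev_iff hα hα₂ _).2 (hs t), fun t₀ => ?_⟩
  have hD' : ∀ t, ∫ τ in (0 : ℝ)..t, propagatorL α (t - τ) (G τ) =
      propagatorL α t (∫ τ in (0 : ℝ)..t, propagatorL α (-τ) (G τ)) := fun t => hU.duhamel_eq hG t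
  have hI : ∀ t, _ := fun t => grad_integral_le (α := α) hH hK (fun τ => by
      simpa only [propagatorL_apply, fourierT_propagator, norm_mul, norm_phase, one_mul]
        using hGs τ)
    (fun τ => by rw [propagatorL_apply, gradT_propagator]; exact hGK τ) t₀ t
  have hsplit : ∀ t, u t - u t₀ = (-c) • propagatorL α t (∫ τ in t₀..t, propagatorL α (-τ) (G τ)) +
      (propagatorL α (t - t₀) (u t₀) - u t₀) := by
    intro t
    have h1 : propagatorL α (t - t₀) (u t₀) = propagatorL α t u₀ -
        c • propagatorL α t (∫ τ in (0 : ℝ)..t₀, propagatorL α (-τ) (G τ)) := by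
      rw [h t₀, hD', map_sub, map_smul, ← hU.add, ← hU.add, sub_add_cancel]
    have h2 : ∫ τ in (0 : ℝ)..t, propagatorL α (-τ) (G τ) =
        (∫ τ in (0 : ℝ)..t₀, propagatorL α (-τ) (G τ)) +
          ∫ τ in t₀..t, propagatorL α (-τ) (G τ) :=
      (intervalIntegral.integral_add_adjacent_intervals (hH.intervalIntegrable _ _)
        (hH.intervalIntegrable _ _)).symm
    rw [h1, h t, hD', h2, map_add, smul_add, neg_smul]
    abel
  set D : ℝ → ℝ := fun t => (2 * π)⁻¹ * ∑' k : ℤ, ‖phase α t k - phase α t₀ k‖ ^ 2 *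
    (|(k : ℝ)| ^ α * ‖fourierT (u t₀) k‖ ^ 2) with hD
  have hDs : ∀ t, (Summable fun k : ℤ => |(k : ℝ)| ^ α *
      ‖fourierT (propagatorL α (t - t₀) (u t₀) - u t₀ : L2T) k‖ ^ 2) ∧
      gradT α (propagatorL α (t - t₀) (u t₀) - u t₀) = D t := by
    intro t
    have e : ∀ k : ℤ, |(k : ℝ)| ^ α * ‖fourierT (propagatorL α (t - t₀) (u t₀) - u t₀ : L2T) k‖ ^ 2 =
        ‖phase α t k - phase α t₀ k‖ ^ 2 * (|(k : ℝ)| ^ α * ‖fourierT (u t₀) k‖ ^ 2) := by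
      intro k
      have e1 : phase α t k - phase α t₀ k = phase α t₀ k * (phase α (t - t₀) k - 1) := by
        have : phase α t k = phase α t₀ k * phase α (t - t₀) k := by
          rw [← phase_add, add_sub_cancel]
        rw [this]; ring
      rw [fourierT_sub, propagatorL_apply, fourierT_propagator, e1, norm_mul, norm_phase, one_mul,
        ← sub_one_mul, norm_mul]
      ring
    refine ⟨?_, by simp only [gradT, hD, e]⟩
    refine ((hs t₀).mul_left 4).of_nonneg_of_le (fun _ => by positivity) fun k => ?_
    rw [e]
    gcongr
    have : ‖phase α t k - phase α t₀ k‖ ≤ 2 := by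
      refine (norm_sub_le _ _).trans ?_
      rw [norm_phase, norm_phase]
      norm_num
    nlinarith [norm_nonneg (phase α t k - phase α t₀ k)]
  have hDt : Tendsto D (𝓝 t₀) (𝓝 0) := by
    have := (tendsto_tsum_multiplier (α := α) (t₀ := t₀) (hs t₀)
      fun _ => by positivity).const_mul ((2 * π)⁻¹)
    rwa [mul_zero] at this
  have hmain : ∀ t, sobolevNorm (α / 2) (u t - u t₀) ≤
      √(‖u t - u t₀‖ ^ 2 + (2 * (K * (t - t₀) ^ 2) + 2 * D t)) := by
    intro t
    have hw : Summable fun k : ℤ => |(k : ℝ)| ^ α * ‖fourierT ((-c) •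
        propagatorL α t (∫ τ in t₀..t, propagatorL α (-τ) (G τ)) : L2T) k‖ ^ 2 := by
      simpa only [fourierT_smul, propagatorL_apply, fourierT_propagator, norm_mul, norm_phase,
        norm_neg, hc, one_mul] using (hI t).1
    have hadd := summable_grad_add hw (hDs t).1
    rw [← hsplit t, gradT_smul_of_norm_eq_one (by rwa [norm_neg]), propagatorL_apply,
      gradT_propagator, (hDs t).2] at hadd
    refine Real.le_sqrt_of_sq_le ((sobolevNorm_sq_le hα hα₂
      ((memSobolev_iff hα hα₂ _).2 hadd.1)).trans ?_)
    have := (hI t).2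
    linarith [hadd.2]
  refine squeeze_zero (fun _ => sobolevNorm_nonneg _ _) hmain ?_
  have h1 : Tendsto (fun t => ‖u t - u t₀‖ ^ 2) (𝓝 t₀) (𝓝 0) := by
    have : Continuous fun t => ‖u t - u t₀‖ ^ 2 := by fun_prop
    simpa using this.tendsto t₀
  have h2 : Tendsto (fun t => 2 * (K * (t - t₀) ^ 2)) (𝓝 t₀) (𝓝 0) := by
    have : Continuous fun t => 2 * (K * (t - t₀) ^ 2) := by fun_prop
    simpa using this.tendsto t₀
  have h3 := (h1.add (h2.add (hDt.const_mul 2))).sqrt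
  simpa using h3

/-! ### Uniqueness -/

theorem ContinuousInSobolev.continuous (hα : 0 ≤ α) (hα₂ : α ≤ 2) {u : ℝ → L2T}
    (h : ContinuousInSobolev (α / 2) u) : Continuous u := by
  rw [continuous_iff_continuousAt]
  intro t₀
  rw [ContinuousAt, tendsto_iff_norm_sub_tendsto_zero]
  refine squeeze_zero (fun _ => norm_nonneg _) (fun t => ?_) (h.2 t₀)
  refine norm_le_sobolevNorm hα ((memSobolev_iff hα hα₂ _).2 ?_)
  have hneg : Summable fun k : ℤ => |(k : ℝ)| ^ α * ‖fourierT ((-1 : ℂ) • u t₀ : L2T) k‖ ^ 2 := by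
    simpa only [fourierT_smul, norm_mul, norm_neg, norm_one, one_mul] using
      (memSobolev_iff hα hα₂ _).1 (h.1 t₀)
  have := (summable_grad_add ((memSobolev_iff hα hα₂ _).1 (h.1 t)) hneg).1
  rwa [neg_one_smul, ← sub_eq_add_neg] at this

/-- From the Sobolev embedding. One `R` for all nearby times lets a single Lipschitz truncation
stand for `cubic` there. -/
theorem ContinuousInSobolev.eventually_bounded (hα : 1 < α) (hα₂ : α ≤ 2) {u : ℝ → L2T}
    (h : ContinuousInSobolev (α / 2) u) (t₀ : ℝ) :
    ∃ R : ℝ, 0 ≤ R ∧ ∀ᶠ t in 𝓝 t₀, ∀ᵐ x, ‖u t x‖ ≤ R := by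
  have hα0 : 0 ≤ α := by linarith
  have hcont := h.continuous hα0 hα₂
  have hS := resolventSum_nonneg (α := α) le_rfl
  have hg0 := gradT_nonneg (α := α) (u t₀)
  refine ⟨resolventSum α 1 + (‖u t₀‖ + 1) ^ 2 + (2 * gradT α (u t₀) + 2), by positivity, ?_⟩
  have h1 : ∀ᶠ t in 𝓝 t₀, ‖u t‖ ≤ ‖u t₀‖ + 1 :=
    (hcont.norm.tendsto t₀).eventually_le_const (by linarith)
  have h2 : ∀ᶠ t in 𝓝 t₀, sobolevNorm (α / 2) (u t - u t₀) ≤ 1 :=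
    (h.2 t₀).eventually_le_const (by norm_num)
  filter_upwards [h1, h2] with t ht1 ht2
  have hs := (memSobolev_iff hα0 hα₂ _).1 (h.1 t)
  have hs0 := (memSobolev_iff hα0 hα₂ _).1 (h.1 t₀)
  have hneg : Summable fun k : ℤ => |(k : ℝ)| ^ α * ‖fourierT ((-1 : ℂ) • u t₀ : L2T) k‖ ^ 2 := by
    simpa only [fourierT_smul, norm_mul, norm_neg, norm_one, one_mul] using hs0
  have hsub := (summable_grad_add hs hneg).1
  rw [neg_one_smul, ← sub_eq_add_neg] at hsub
  have hadd := (summable_grad_add hs0 hsub).2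
  rw [add_sub_cancel] at hadd
  have h3 := gradT_le_sobolevNorm_sq hα0 hα₂ ((memSobolev_iff hα0 hα₂ _).2 hsub)
  have h4 : sobolevNorm (α / 2) (u t - u t₀) ^ 2 ≤ 1 :=
    pow_le_one₀ (sobolevNorm_nonneg _ _) ht2
  filter_upwards [ae_norm_le hα hs] with x hx
  refine hx.trans ?_
  gcongr
  linarith

theorem ContinuousInSobolev.bounded (hα : 1 < α) (hα₂ : α ≤ 2) {u : ℝ → L2T}
    (h : ContinuousInSobolev (α / 2) u) (T : ℝ) :
    ∃ R : ℝ, 0 ≤ R ∧ ∀ t, |t| ≤ T → ∀ᵐ x, ‖u t x‖ ≤ R := by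
  have := (isCompact_Icc (a := -T) (b := T)).induction_on
    (p := fun s => ∃ R : ℝ, 0 ≤ R ∧ ∀ t ∈ s, ∀ᵐ x, ‖u t x‖ ≤ R) ⟨0, le_rfl, by simp⟩
    (fun s s' hss ⟨R, hR, hb⟩ => ⟨R, hR, fun t ht => hb t (hss ht)⟩)
    (fun s s' ⟨R, hR, hb⟩ ⟨R', _, hb'⟩ => ⟨max R R', hR.trans (le_max_left _ _), fun t ht => by
      rcases ht with ht | ht
      · exact (hb t ht).mono fun x hx => hx.trans (le_max_left _ _)
      · exact (hb' t ht).mono fun x hx => hx.trans (le_max_right _ _)⟩)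
    (fun t _ => by
      obtain ⟨R, hR, hb⟩ := h.eventually_bounded hα hα₂ t
      exact ⟨_, mem_nhdsWithin_of_mem_nhds hb, R, hR, fun s hs => hs⟩)
  obtain ⟨R, hR, hb⟩ := this
  exact ⟨R, hR, fun t ht => hb t (abs_le.1 ht)⟩

theorem ContinuousInSobolev.continuous_cubic (hα : 1 < α) (hα₂ : α ≤ 2) {u : ℝ → L2T}
    (h : ContinuousInSobolev (α / 2) u) : Continuous fun t => cubic (u t) := by
  rw [continuous_iff_continuousAt]
  intro t₀
  obtain ⟨R, hR, hb⟩ := h.eventually_bounded hα hα₂ t₀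
  refine ((continuous_truncT hR).comp (h.continuous (by linarith) hα₂)).continuousAt.congr ?_
  filter_upwards [hb] with t ht
  exact truncT_eq_cubic hR ht

theorem IsSolution.unique (hα : 1 < α) (hα₂ : α ≤ 2) (hμ : μ = 1 ∨ μ = -1) {u₀ : L2T}
    {u w : ℝ → L2T} (hu : IsSolution α μ u₀ u) (hw : IsSolution α μ u₀ w) : u = w := by
  have hα0 : 0 ≤ α := by linarith
  have hU := isBoundedGroup_propagatorL α
  ext1 t
  rw [← sub_eq_zero, ← norm_le_zero_iff]
  obtain ⟨R₁, hR₁, hb₁⟩ := hu.1.bounded hα hα₂ |t|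
  obtain ⟨R₂, hR₂, hb₂⟩ := hw.1.bounded hα hα₂ |t|
  set R := max R₁ R₂ with hRd
  have hR : 0 ≤ R := hR₁.trans (le_max_left _ _)
  have h := hU.stability zero_le_one (norm_I_mul hμ).le (hu.1.continuous hα0 hα₂)
    (hw.1.continuous hα0 hα₂) (e := fun _ => 0) (G := fun τ => cubic (u τ) - cubic (w τ)) (a := 0)
    (K := 3 * R ^ 2) (T := |t|) (by positivity) (fun s _ => ?_) (fun _ _ => by simp)
    (fun s hs => ?_) (t := t) le_rfl
  · simpa using h
  · rw [hu.2 s, hw.2 s, sub_sub_sub_cancel_left, zero_sub, ← smul_sub, ← smul_neg]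
    simp only [map_sub]
    rw [intervalIntegral.integral_sub]
    · rw [neg_sub]; rfl
    · exact (hU.continuous_apply (by fun_prop)
        (hu.1.continuous_cubic hα hα₂)).intervalIntegrable _ _
    · exact (hU.continuous_apply (by fun_prop)
        (hw.1.continuous_cubic hα hα₂)).intervalIntegrable _ _
  · rw [← truncT_eq_cubic hR ((hb₁ s hs).mono fun x hx => hx.trans (le_max_left _ _)),
      ← truncT_eq_cubic hR ((hb₂ s hs).mono fun x hx => hx.trans (le_max_right _ _))]
    exact norm_truncT_sub_le hR _ _

/-! ### Existence and the convergence rate -/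

/-- Existence and rate come together: the truncated solution is the limit of the lattice solutions
and inherits from them the bounds showing that its truncation is inactive. -/
theorem exists_solution_with_rate (hα : 1 < α) (hα₂ : α ≤ 2) (r : ℝ) :
    ∃ C₁ C₂ : ℝ, 0 < C₁ ∧ 0 < C₂ ∧ ∀ (μ : ℝ), (μ = 1 ∨ μ = -1) →
      ∀ u₀ : L2T, MemSobolev (α / 2) u₀ → sobolevNorm (α / 2) u₀ = r →
      ∃ u, IsSolution α μ u₀ u ∧ ∀ (M : ℕ) [NeZero M] (v : ℝ → ZMod (2 * M) → ℂ),
        IsLatticeSolution M α μ (discretize M u₀) v → ∀ t : ℝ,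
          eLpNorm (fun x : Torus => interpolate M (v t) x - u t x) 2 volume ≤
            ENNReal.ofReal (C₁ * mesh M ^ (α / (2 + α)) * Real.exp (C₂ * |t|)) := by
  have hα0 : 0 ≤ α := by linarith
  obtain ⟨B, hB, hbound⟩ := exists_uniform_bound hα hα₂ r
  have hS := resolventSum_nonneg (α := α) le_rfl
  set W : ℝ := resolventSum α 1 * (r ^ 2 + B) with hW
  have hW0 : 0 ≤ W := by positivity
  set B' : ℝ := 10 * W ^ 2 * B with hB'
  -- The first entry bounds the lattice solutions through the Wiener norm, the second their limit
  -- through the Sobolev embedding, so neither feels the truncation.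
  set R : ℝ := max (√W) (resolventSum α 1 + r ^ 2 + B) with hRd
  have hR : 0 ≤ R := (Real.sqrt_nonneg _).trans (le_max_left _ _)
  refine ⟨3 * √B + (18 * |r| + 6 * √B') + 1, 3 * R ^ 2 + 2, by positivity, by positivity, ?_⟩
  intro μ hμ u₀ hu₀ hr
  have hr0 : 0 ≤ r := hr ▸ sobolevNorm_nonneg _ _
  have hs₀ := (memSobolev_iff hα0 hα₂ u₀).1 hu₀
  have hg₀ : gradT α u₀ ≤ r ^ 2 := hr ▸ gradT_le_sobolevNorm_sq hα0 hα₂ hu₀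
  have hn₀ : ‖u₀‖ ^ 2 ≤ r ^ 2 :=
    pow_le_pow_left₀ (norm_nonneg _) (hr ▸ norm_le_sobolevNorm hα0 hu₀) 2
  have hU := isBoundedGroup_propagatorL α
  obtain ⟨u, hu, hum⟩ := hU.exists_mild zero_le_one (norm_I_mul hμ).le (F := truncT hR)
    (K := 3 * R ^ 2) (by positivity) (norm_truncT_sub_le hR) (truncT_zero hR) u₀
  have hlat : ∀ (M : ℕ) [NeZero M] (v : ℝ → ZMod (2 * M) → ℂ),
      IsLatticeSolution M α μ (discretize M u₀) v → ∀ t, mass M (v t) ≤ r ^ 2 ∧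
        gradSq M α (v t) ≤ B ∧ gradSq M α (latticeCubic M (v t)) ≤ B' ∧ ∀ j, ‖v t j‖ ≤ R := by
    intro M _ v hv t
    have hm₀ : mass M (discretize M u₀) ≤ r ^ 2 := (mass_discretize_le M u₀).trans hn₀
    have hm : mass M (v t) ≤ r ^ 2 := by rw [hv.mass_eq]; exact hm₀
    have hg := hbound M μ hμ _ v hv hm₀ ((kinetic_discretize_le hα0 hs₀).trans hg₀) t
    have hw : wiener M (v t) ^ 2 ≤ W := by
      refine (wiener_sq_le hα le_rfl (v t)).trans ?_
      rw [one_mul]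
      exact mul_le_mul_of_nonneg_left (add_le_add hm hg) hS
    have hwn := wiener_nonneg (M := M) (v t)
    refine ⟨hm, hg, (gradSq_latticeCubic_le hα0 hα₂ (v t)).trans ?_, fun j => ?_⟩
    · have : wiener M (v t) ^ 4 = (wiener M (v t) ^ 2) ^ 2 := by ring
      rw [this]
      have := gradSq_nonneg (α := α) (v t)
      exact mul_le_mul (mul_le_mul_of_nonneg_left (pow_le_pow_left₀ (sq_nonneg _) hw 2)
        (by norm_num)) hg this (by positivity)
    · exact (norm_le_wiener (v t) j).trans ((Real.le_sqrt_of_sq_le hw).trans (le_max_left _ _))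
  have hrate : ∀ (M : ℕ) [NeZero M] (v : ℝ → ZMod (2 * M) → ℂ),
      IsLatticeSolution M α μ (discretize M u₀) v → ∀ t, ‖stepL M (v t) - u t‖ ≤
        (18 * r + 6 * √B') * mesh M ^ (α / (2 + α)) * Real.exp ((3 * R ^ 2 + 2) * |t|) :=
    fun M _ v hv t => norm_stepL_sub_le hα hα₂ hμ hr0 hR hs₀ hg₀ hv
      (fun t => (hlat M v hv t).2.2.2) (fun t => (hlat M v hv t).2.2.1) hu hum t
  choose v hv using fun n : ℕ => exists_isLatticeSolution (M := n + 1) (α := α) hμ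
    (discretize (n + 1) u₀)
  have hlim : ∀ t, Tendsto (fun n => stepL (n + 1) (v n t)) atTop (𝓝 (u t)) := by
    intro t
    rw [tendsto_iff_norm_sub_tendsto_zero]
    refine squeeze_zero (fun _ => norm_nonneg _) (fun n => hrate (n + 1) (v n) (hv n) t) ?_
    have h1 : Tendsto (fun n : ℕ => mesh (n + 1)) atTop (𝓝 0) := by
      have := (tendsto_const_div_atTop_nhds_zero_nat π).comp (tendsto_add_atTop_nat 1)
      exact this
    have hγ : 0 < α / (2 + α) := by positivity
    have h2 := h1.rpow_const (p := α / (2 + α)) (Or.inr hγ.le)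
    rw [Real.zero_rpow hγ.ne'] at h2
    simpa using (h2.const_mul (18 * r + 6 * √B')).mul_const (Real.exp ((3 * R ^ 2 + 2) * |t|))
  have hug : ∀ t, _ := fun t => grad_le_of_tendsto (α := α) (B := B)
    (fun n => (hlat (n + 1) (v n) (hv n) t).2.1) (hlim t)
  have hGlim : ∀ t, Tendsto (fun n => stepL (n + 1) (latticeCubic (n + 1) (v n t))) atTop
      (𝓝 (truncT hR (u t))) := by
    intro t
    have := ((continuous_truncT hR).tendsto (u t)).comp (hlim t)
    refine this.congr fun n => ?_
    exact truncT_stepL hR (hlat (n + 1) (v n) (hv n) t).2.2.2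
  have hGg : ∀ t, _ := fun t => grad_le_of_tendsto (α := α) (B := B')
    (fun n => (hlat (n + 1) (v n) (hv n) t).2.2.1) (hGlim t)
  have hun : ∀ t, ‖u t‖ ^ 2 ≤ r ^ 2 := by
    intro t
    refine le_of_tendsto ((hlim t).norm.pow 2) (Eventually.of_forall fun n => ?_)
    rw [norm_stepL_sq]
    exact (hlat (n + 1) (v n) (hv n) t).1
  have hcub : ∀ t, truncT hR (u t) = cubic (u t) := by
    intro t
    refine truncT_eq_cubic hR ?_
    filter_upwards [ae_norm_le hα (hug t).1] with x hx
    refine hx.trans (le_trans ?_ (le_max_right _ _))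
    linarith [hun t, (hug t).2]
  refine ⟨u, ⟨?_, fun t => ?_⟩, fun M _ w hw t => ?_⟩
  · exact continuousInSobolev_of_mild hα0 hα₂ (norm_I_mul hμ) (by positivity : 0 ≤ B') hu
      ((continuous_truncT hR).comp hu) (fun t => (hug t).1) (fun t => (hGg t).1)
      (fun t => (hGg t).2) hum
  · have := hum t
    simp only [hcub, propagatorL_apply] at this
    exact this
  · refine (eLpNorm_interpolate_sub_le hα.le (w t) (u t)).trans (ENNReal.ofReal_le_ofReal ?_)
    have hh := mesh_pos M
    have h1 := hrate M w hw t
    set γ := α / (2 + α) with hγ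
    have hE : 1 ≤ Real.exp ((3 * R ^ 2 + 2) * |t|) := Real.one_le_exp (by positivity)
    have hm : 0 ≤ mesh M ^ γ := by positivity
    have h2 : √(2 * mesh M * gradSq M α (w t)) ≤ 3 * √B * mesh M ^ γ := by
      refine Real.sqrt_le_iff.2 ⟨by positivity, ?_⟩
      rw [mul_pow, mul_pow, Real.sq_sqrt hB]
      have h3 := mesh_le_rpow (M := M) hα0 hα₂
      have := gradSq_nonneg (α := α) (w t)
      calc 2 * mesh M * gradSq M α (w t) ≤ 2 * (4 * (mesh M ^ γ) ^ 2) * B := by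
            gcongr
            exact (hlat M w hw t).2.1
        _ ≤ _ := by nlinarith [mul_nonneg hB (sq_nonneg (mesh M ^ γ))]
    rw [abs_of_nonneg hr0]
    have h4 : 3 * √B * mesh M ^ γ ≤ 3 * √B * mesh M ^ γ * Real.exp ((3 * R ^ 2 + 2) * |t|) :=
      le_mul_of_one_le_right (by positivity) hE
    have h5 : 0 ≤ mesh M ^ γ * Real.exp ((3 * R ^ 2 + 2) * |t|) := by positivity
    linarith

end Limit

end FDNLS
end

theorem mainTheorem3 (α : ℝ) (hα₁ : 1 < α) (hα₂ : α ≤ 2) :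
    ∃ C₁ C₂ : ℝ → ℝ, (∀ r, 0 < C₁ r ∧ 0 < C₂ r) ∧
      ∀ (μ : ℝ), (μ = 1 ∨ μ = -1) →
      ∀ u₀ : FDNLS.L2T, FDNLS.MemSobolev (α / 2) u₀ →
        (∃! u : ℝ → FDNLS.L2T, FDNLS.IsSolution α μ u₀ u) ∧
        ∀ (M : ℕ) [NeZero M],
          (∃! v : ℝ → ZMod (2 * M) → ℂ,
            FDNLS.IsLatticeSolution M α μ (FDNLS.discretize M u₀) v) ∧
          ∀ (u : ℝ → FDNLS.L2T) (v : ℝ → ZMod (2 * M) → ℂ),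
            FDNLS.IsSolution α μ u₀ u →
            FDNLS.IsLatticeSolution M α μ (FDNLS.discretize M u₀) v →
            ∀ t : ℝ,
              MeasureTheory.eLpNorm (fun x : FDNLS.Torus => FDNLS.interpolate M (v t) x - u t x) 2
                  MeasureTheory.volume ≤
                ENNReal.ofReal (C₁ (FDNLS.sobolevNorm (α / 2) u₀) *
                  FDNLS.mesh M ^ (α / (2 + α)) *
                  Real.exp (C₂ (FDNLS.sobolevNorm (α / 2) u₀) * |t|) *
                  (1 + FDNLS.sobolevNorm (α / 2) u₀) ^ 3) := by
  choose C₁ C₂ h₁ h₂ h using FDNLS.exists_solution_with_rate hα₁ hα₂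
  refine ⟨C₁, C₂, fun r => ⟨h₁ r, h₂ r⟩, fun μ hμ u₀ hu₀ => ?_⟩
  obtain ⟨u', hu', hrate⟩ := h _ μ hμ u₀ hu₀ rfl
  refine ⟨⟨u', hu', fun w hw => hw.unique hα₁ hα₂ hμ hu'⟩, fun M _ => ⟨?_, ?_⟩⟩
  · obtain ⟨v, hv⟩ := FDNLS.exists_isLatticeSolution (α := α) hμ (FDNLS.discretize M u₀)
    exact ⟨v, hv, fun w hw => hw.unique hμ hv⟩
  · intro u v hu hv t
    rw [hu.unique hα₁ hα₂ hμ hu']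
    -- The rate holds without the cubic factor, which is at least 1: `C₁` and `C₂` may depend
    -- arbitrarily on the norm.
    refine (hrate M v hv t).trans (ENNReal.ofReal_le_ofReal (le_mul_of_one_le_right ?_ ?_))
    · have := FDNLS.mesh_pos M
      have := h₁ (FDNLS.sobolevNorm (α / 2) u₀)
      positivity
    · exact one_le_pow₀ (by linarith [FDNLS.sobolevNorm_nonneg (α / 2) u₀])
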